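/- **Setting.** Let $H$ be a Hermitian operator on a finite-dimensional complex Hilbert space with an orthonormal basis of eigenvectors $\psi_0,\dots,\psi_{M}$ and eigenvalues $\lambda_0,\dots,\lambda_{M}\in[-\pi,\pi]$ ($\lambda_0$ is the target, e.g. the ground-state energy). Let $\psi$ be a unit vector, $p_m=|\langle\psi_m,\psi\rangle|^2$, and $p_0>0$. Let $I\subset I'\subset[-\pi,\pi]$ be intervals with $\lambda_0\in I$ and $$D=\operatorname{dist}(\mathbb R\setminus I',I)>0,\qquad p_r=p_r(I,I')=\frac{p_0\,\mathbf 1_{\lambda_0\in I}}{\sum_{\lambda_k\in I'}p_k}.$$ *Circuit.* The Hadamard test with time $t$ and $W\in\{\mathrm{Id},S^\dagger\}$ starts from $|0\rangle\otimes\psi$, applies a Hadamard gate to the ancilla, the controlled evolution $e^{-itH}$, the gate $W$ and a second Hadamard gate to the ancilla, and measures the ancilla; outcome $0$ is recorded as $+1$, outcome $1$ as $-1$. *Filter.* A filter of degree $d$ and error $q$ is $F_q(x)=\sum_{l=-d}^{d}\hat F_l e^{-ilx}$ with $|F_q-1|\le q$ on $I$, $|F_q|\le q$ on $[-\pi,\pi]\setminus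 I'$ and $|F_q|\le 1+q$ everywhere. Put $\mathcal F=\sum_l|\hat F_l|$ and $\hat F_l=|\hat F_l|e^{i\phi_l}$. *Algorithm.* Given $\epsilon,\delta,N,N_s$, put $J=\lceil\log_2(1/\epsilon)\rceil+1$ and $\tau_j=2^{j-1-\lceil\log_2(1/\epsilon)\rceil}\frac{\delta}{N\epsilon}$ for $1\le j\le J$. For all $j\le J$, $0\le n<N$, $1\le k\le N_s$, independently: draw $l\in\{-d,\dots,d\}$ with probability $|\hat F_l|/\mathcal F$, run the circuit at time $l+n\tau_j$ once with $W=\mathrm{Id}$ (result $X$) and once with $W=S^\dagger$ (result $Y$), and set $Z_{k,n}=(X+iY)e^{i\phi_l}\mathcal F$. Let $Z_n=\frac1{N_s}\sum_kZ_{k,n}$ at level $j$, and let $(r_j^*,\theta_j^*)$ be a minimizer of $\frac1N\sum_{n=0}^{N-1}|Z_n-re^{-i\theta n\tau_j}|^2$ over $r\in\mathbb C$ and $\theta$ in the search interval, which is $[-\pi,\pi]$ for $j=1$ and $[\theta_{j-1}^*-\frac{\pi}{2\tau_{j-1}},\theta_{j-1}^*+\frac{\pi}{2\tau_{j-1}}]$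 for $j>1$. The output is $\theta^*=\theta^*_J$. The maximal evolution time is $T_{\max}=d+N\tau_J$. The total evolution time $T_{\rm total}=\sum_{j=1}^J\sum_{n=0}^{N-1}2N_s(d+n\tau_j)$ charges to each circuit its largest possible evolution time. Write $\operatorname{polylog}_k(x)=\log(e+x)^k$ and $$X=p_0^{-2}\,\delta^{-(2+\zeta)}\operatorname{polylog}_{k_2}\!\big(\log(\zeta^{-1})\log(\epsilon^{-1})D^{-1}\eta^{-1}p_0^{-1}\big).$$ **Theorem.** There are absolute constants $c_1,\delta_0,\kappa>0$ and $k_1,k_2\in\mathbb N$ such that for every $0<\kappa'\le\kappa$ there is $A_0\ge1$ such that for every $A\ge A_0$ and $0<\zeta<1$ there is $C>0$ with the following property. In the setting above let $0<\epsilon<1/2$, $0<\eta<1$, $\delta>0$, $$c_1\sqrt{1-p_r}\le\delta\le\delta_0,\qquad \kappa'p_0\delta^2\le q\le\kappa p_0\delta^2$$ (so $\delta=\Theta(\sqrt{1-p_r})$ is allowed as soon as $p_r$ is close enough to $1$, and $q=\Theta(p_0\delta^2)$). Then: 1. There is a filter $F_q$ of degree $d$ and error $q$ with $$A^{-1}D^{-1}\operatorname{polylog}_{k_1}(p_0^{-1}\delta^{-1})\le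 d\le A\,D^{-1}\operatorname{polylog}_{k_1}(p_0^{-1}\delta^{-1}),\qquad \mathcal F\le A\log(e+d).\tag{$*$}$$ 2. For every filter of degree $d$ and error $q$ with $(*)$ and all $N\ge2$, $N_s$ with $NN_s\ge C\,X$: - with probability at least $1-\eta$, the output satisfies $|\theta^*-\lambda_0|<\epsilon$ (whatever minimizers are chosen); - $T_{\max}=d+\delta/\epsilon$, and no circuit has a longer evolution time; - the evolution times of all circuits always add up to at most $T_{\rm total}$; and $T_{\rm total}\ge\frac C2X\,(Jd+\delta/\epsilon)$, while $T_{\rm total}\le2B\,X\,(Jd+\delta/\epsilon)$ whenever $NN_s\le B\,X$. In particular $T_{\rm total}=\widetilde\Theta\big(p_0^{-2}\delta^{-(2+\zeta)}(d+\delta/\epsilon)\big)$ if $NN_s=\Theta(X)$, since $J=O(\log(1/\epsilon))$. -/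

import Mathlib

open MeasureTheory

noncomputable section

namespace QCELS

/-! ### Eigenpairs, overlaps, intervals -/

section Spectral

variable {E : Type*} [NormedAddCommGroup E] [InnerProductSpace ℂ E]

/-- The vectors `v 0, …, v M` form an orthonormal basis of eigenvectors of `H`, with real
eigenvalues `lam 0, …, lam M`. (In particular `H` is a Hermitian operator on a
finite-dimensional space.) -/
def IsEigensystem {M : ℕ} (H : E →L[ℂ] E) (v : OrthonormalBasis (Fin (M + 1)) ℂ E)
    (lam : Fin (M + 1) → ℝ) : Prop :=
  ∀ m, H (v m) = (lam m : ℂ) • v m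

/-- The overlap `p_m = |⟨ψ_m, ψ⟩|²`. -/
def overlap {M : ℕ} (v : OrthonormalBasis (Fin (M + 1)) ℂ E) (ψ : E) (m : Fin (M + 1)) : ℝ :=
  ‖inner ℂ (v m) ψ‖ ^ 2

/-- The relative overlap `p_r(I, I') = p_0 1_{λ_0 ∈ I} / ∑_{λ_k ∈ I'} p_k`. -/
def relOverlap {M : ℕ} (v : OrthonormalBasis (Fin (M + 1)) ℂ E) (lam : Fin (M + 1) → ℝ) (ψ : E)
    (I I' : Set ℝ) : ℝ :=
  I.indicator (fun _ => overlap v ψ 0) (lam 0) /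
    ∑ k, I'.indicator (fun _ => overlap v ψ k) (lam k)

/-- `D = dist((I')ᶜ, I) = inf {|x₁ - x₂| : x₁ ∉ I', x₂ ∈ I}`, the complement being taken in `ℝ`. -/
def gapDist (I I' : Set ℝ) : ℝ :=
  sInf {s : ℝ | ∃ x₁ ∉ I', ∃ x₂ ∈ I, s = |x₁ - x₂|}

/-! ### The Hadamard test circuit -/

/-- The Hamiltonian evolution `exp(-i t H)`. -/
def evolution (H : E →L[ℂ] E) (t : ℝ) : E →L[ℂ] E :=
  NormedSpace.exp ((-(Complex.I * (t : ℂ))) • H)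

/-- Hadamard gate on the ancilla; a state `|0⟩ ⊗ a + |1⟩ ⊗ b` of ancilla and system is the
pair `(a, b)`. -/
def hadamardGate (s : E × E) : E × E :=
  ((((Real.sqrt 2)⁻¹ : ℝ) : ℂ) • (s.1 + s.2), (((Real.sqrt 2)⁻¹ : ℝ) : ℂ) • (s.1 - s.2))

/-- The operator `U` on the system, controlled by the ancilla. -/
def controlled (U : E →L[ℂ] E) (s : E × E) : E × E := (s.1, U s.2)

/-- The gate `diag(1, w)` on the ancilla: the identity for `w = 1`, and `S†` for `w = -i`. -/
def ancillaPhase (w : ℂ) (s : E × E) : E × E := (s.1, w • s.2)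

/-- State of ancilla and system before the measurement, with `W = diag(1, w)`. -/
def circuitState (H : E →L[ℂ] E) (ψ : E) (w : ℂ) (t : ℝ) : E × E :=
  hadamardGate (ancillaPhase w (controlled (evolution H t) (hadamardGate (ψ, 0))))

/-- Law of the measurement outcome (`0` or `1`) of the ancilla. -/
def circuitLaw (H : E →L[ℂ] E) (ψ : E) (w : ℂ) (t : ℝ) : Measure (Fin 2) :=
  ENNReal.ofReal (‖(circuitState H ψ w t).1‖ ^ 2) • Measure.dirac 0 +
    ENNReal.ofReal (‖(circuitState H ψ w t).2‖ ^ 2) • Measure.dirac 1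

end Spectral

/-- The value `1` for the outcome `0`, and `-1` for the outcome `1`. -/
def outcomeSign (o : Fin 2) : ℝ := if o = 0 then 1 else -1

/-! ### Fourier filters -/

/-- The frequencies `-d, …, d`. -/
abbrev Freq (d : ℕ) : Type := {l : ℤ // l ∈ Finset.Icc (-(d : ℤ)) (d : ℤ)}

/-- The trigonometric polynomial `F_q(x) = ∑_{|l| ≤ d} F̂_l exp(-i l x)`. The sign in the exponent is
the one for which `F_q(H)` is the combination of the evolutions `exp(-i l H)` with weights `F̂_l`. -/
def filterEval {d : ℕ} (F : Freq d → ℂ) (x : ℝ) : ℂ :=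
  ∑ l, F l * Complex.exp (-(Complex.I * ((l : ℤ) : ℂ) * (x : ℂ)))

/-- `∑_{|l| ≤ d} |F̂_l|`. -/
def filterNorm {d : ℕ} (F : Freq d → ℂ) : ℝ := ∑ l, ‖F l‖

/-- `F` separates `I` from `[-π, π] \ I'` with error `q`, and it is bounded by `1 + q`. -/
def IsFilter {d : ℕ} (F : Freq d → ℂ) (q : ℝ) (I I' : Set ℝ) : Prop :=
  (∀ x ∈ I, ‖filterEval F x - 1‖ ≤ q) ∧
  (∀ x ∈ Set.Icc (-Real.pi) Real.pi \ I', ‖filterEval F x‖ ≤ q) ∧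
  (∀ x, ‖filterEval F x‖ ≤ 1 + q)

/-- The polylogarithmic factor `log(e + x)^k`. -/
def polylog (k : ℕ) (x : ℝ) : ℝ := Real.log (Real.exp 1 + x) ^ k

/-- Size bounds for a filter, with implied constant `A`:
`d = Θ(D⁻¹ polylog(p₀⁻¹ δ⁻¹))` and `∑ |F̂_l| = O(log d)`. -/
def FilterSize {d : ℕ} (F : Freq d → ℂ) (A : ℝ) (k : ℕ) (D p₀ δ : ℝ) : Prop :=
  A⁻¹ * (D⁻¹ * polylog k (p₀⁻¹ * δ⁻¹)) ≤ (d : ℝ) ∧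
  (d : ℝ) ≤ A * (D⁻¹ * polylog k (p₀⁻¹ * δ⁻¹)) ∧
  filterNorm F ≤ A * Real.log (Real.exp 1 + (d : ℝ))

/-! ### Time steps -/

/-- The number of levels `J = ⌈log₂(1/ε)⌉ + 1`. -/
def numLevels (ε : ℝ) : ℕ := ⌈Real.logb 2 (1 / ε)⌉₊ + 1

/-- The time steps `2^{j-1-⌈log₂(1/ε)⌉} δ/(N ε)`, `1 ≤ j ≤ J`. Levels are counted from `0` here:
`timeStep ε δ N i` is the step of level `j = i + 1`. -/
def timeStep (ε δ : ℝ) (N : ℕ) (i : ℕ) : ℝ :=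
  (2 : ℝ) ^ ((i : ℤ) - (⌈Real.logb 2 (1 / ε)⌉₊ : ℤ)) * (δ / (N * ε))

/-! ### The filtered data set -/

/-- One run of the data generator: the random frequency and the two measurement outcomes
(for `W = I` and `W = S†`). -/
abbrev Sample (d : ℕ) : Type := Freq d × Fin 2 × Fin 2

/-- The outcomes of all runs, indexed by level, data point `n` and repetition `k`. -/
abbrev Outcomes (d J N Ns : ℕ) : Type := Fin J × Fin N × Fin Ns → Sample d

section Data

variable {E : Type*} [NormedAddCommGroup E] [InnerProductSpace ℂ E]

/-- Law of one run at base time `t = n τ`: the frequency `l` is drawn with probability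
`β_l = |F̂_l| / ∑ |F̂|`, then the circuit is run at time `l + t` with `W = I` and, independently,
with `W = S†`. -/
def sampleLaw (H : E →L[ℂ] E) (ψ : E) {d : ℕ} (F : Freq d → ℂ) (t : ℝ) : Measure (Sample d) :=
  ∑ l : Freq d, ENNReal.ofReal (‖F l‖ / filterNorm F) •
    (Measure.dirac l).prod
      ((circuitLaw H ψ 1 (((l : ℤ) : ℝ) + t)).prod
        (circuitLaw H ψ (-Complex.I) (((l : ℤ) : ℝ) + t)))

/-- Law of the outcomes of all runs; different runs are independent. -/
def outcomesLaw (H : E →L[ℂ] E) (ψ : E) {d : ℕ} (F : Freq d → ℂ) (J N Ns : ℕ) (τ : ℕ → ℝ) :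
    Measure (Outcomes d J N Ns) :=
  Measure.pi fun a => sampleLaw H ψ F (((a.2.1 : ℕ) : ℝ) * τ a.1)

end Data

/-- `Z_{k,n,q} = (X + i Y) exp(i φ_l) ∑ |F̂|`, where `φ_l` is the argument of `F̂_l`. -/
def sampleValue {d : ℕ} (F : Freq d → ℂ) (s : Sample d) : ℂ :=
  ((outcomeSign s.2.1 : ℂ) + Complex.I * (outcomeSign s.2.2 : ℂ)) *
    Complex.exp (Complex.I * ((F s.1).arg : ℂ)) * (filterNorm F : ℂ)

/-- `Z_{n,q} = N_s⁻¹ ∑_k Z_{k,n,q}` at level `i`. -/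
def filteredData {d J N Ns : ℕ} (F : Freq d → ℂ) (ω : Outcomes d J N Ns) (i : Fin J) (n : Fin N) :
    ℂ :=
  (Ns : ℂ)⁻¹ * ∑ k, sampleValue F (ω (i, n, k))

/-! ### Multi-level least squares -/

/-- The loss `L(r, θ) = N⁻¹ ∑_n |Z_n - r exp(-i θ n τ)|²`. -/
def loss {N : ℕ} (Z : Fin N → ℂ) (τ : ℝ) (r : ℂ) (θ : ℝ) : ℝ :=
  (N : ℝ)⁻¹ * ∑ n : Fin N, ‖Z n - r * Complex.exp (-(Complex.I * θ * ((n : ℕ) : ℂ) * τ))‖ ^ 2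

/-- Search interval `[λ_min, λ_max]` at each level: `[-π, π]` at the first one, and then
`[θ - π/(2τ), θ + π/(2τ)]` with the estimate `θ` and the time step `τ` of the previous level. -/
def searchInterval (τ θ : ℕ → ℝ) : ℕ → Set ℝ
  | 0 => Set.Icc (-Real.pi) Real.pi
  | i + 1 => Set.Icc (θ i - Real.pi / (2 * τ i)) (θ i + Real.pi / (2 * τ i))

/-- `(r i, θ i)`, `i < J`, are the successive minimizers of a run of the multi-level algorithm on the
data `Z` (any choice of minimizers is allowed). -/
def IsRun {J N : ℕ} (Z : Fin J → Fin N → ℂ) (τ : ℕ → ℝ) (r : ℕ → ℂ) (θ : ℕ → ℝ) : Prop :=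
  ∀ i : Fin J, θ i ∈ searchInterval τ θ i ∧
    ∀ r' : ℂ, ∀ θ' ∈ searchInterval τ θ i, loss (Z i) (τ i) (r i) (θ i) ≤ loss (Z i) (τ i) r' θ'

/-- The event that the algorithm estimates `lam₀` to precision `ε`: whatever minimizers are chosen,
the output (the estimate of the last level) is at distance less than `ε` from `lam₀`. -/
def successEvent {d J N Ns : ℕ} (F : Freq d → ℂ) (τ : ℕ → ℝ) (lam₀ ε : ℝ) :
    Set (Outcomes d J N Ns) :=
  {ω | ∀ r θ, IsRun (filteredData F ω) τ r θ → |θ (J - 1) - lam₀| < ε}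

/-! ### Evolution times -/

/-- Evolution time `|l + n τ_j|` of the two circuits of one run. -/
def circuitTime {d J N Ns : ℕ} (τ : ℕ → ℝ) (ω : Outcomes d J N Ns)
    (a : Fin J × Fin N × Fin Ns) : ℝ :=
  |(((ω a).1 : ℤ) : ℝ) + ((a.2.1 : ℕ) : ℝ) * τ a.1|

/-- Maximal evolution time `d + N τ_J`. -/
def maxTime (d J N : ℕ) (τ : ℕ → ℝ) : ℝ := d + N * τ (J - 1)

/-- Total evolution time: every level `j` and `n < N` needs `2 N_s` circuits (`W = I` and `W = S†`),
each of evolution time at most `d + n τ_j`. -/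
def totalTime (d J N Ns : ℕ) (τ : ℕ → ℝ) : ℝ :=
  ∑ i ∈ Finset.range J, ∑ n ∈ Finset.range N, 2 * (Ns : ℝ) * (d + n * τ i)

/-- `p₀⁻² δ^{-(2+ζ)} polylog(log(ζ⁻¹) log(ε⁻¹) D⁻¹ η⁻¹ p₀⁻¹)`. -/
def sampleBound (k : ℕ) (ζ ε η p₀ δ D : ℝ) : ℝ :=
  (p₀ ^ 2)⁻¹ * δ ^ (-(2 + ζ)) *
    polylog k (Real.log ζ⁻¹ * Real.log ε⁻¹ * D⁻¹ * η⁻¹ * p₀⁻¹)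

end QCELS

end

noncomputable section

namespace QCELS

/-! Drawing `l` with weight `|F̂_l|` and multiplying by the phase of `F̂_l` is importance sampling
of `F_q(H) exp(-i n τ H)`, so `Z_n` has mean `∑_m p_m F_q(λ_m) exp(-i n τ λ_m)`
(`IsEigensystem.integral_sampleValue`). The filter and the lower bound on `p_r` leave one
oscillation of frequency `λ_0` and amplitude about `p_0`, plus a bias of order `p_0 δ²`
(`norm_bias_le`).

Minimizing over `r` turns the fit into the maximization of `|correlation|` over `θ` (`loss_eq`). The
pure oscillation contributes its amplitude times a Dirichlet average at `x = (θ - λ_0) τ`, and with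
`u = N |x|` this loses at least a constant times `p_0 min(1, u²)` (`one_sub_norm_dirichletAvg_ge`).
A crude comparison would require noise of order `p_0 δ²`, hence about `δ⁻⁴` samples. The gain is
that the noise at `θ` is compared with the same noise at `λ_0`: if its size is `σ`, its increment is
`O(σ u)`. With `σ` a small multiple of `p_0 δ`, the resulting quadratic inequality in `u` forces `u
< δ` (`abs_sub_lt_of_minimizer`).

The increment bound comes from summation by parts and needs only the partial sums of the noise at
frequencies in a finite grid (`SmallNoise`). Hoeffding's inequality and a union bound control these
(`IsEigensystem.smallNoise_prob`). The cost is `N N_s` of order `𝓕² p_0⁻² δ⁻²` times logarithms;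
powers of `log(1/δ)` are absorbed by `δ^(-ζ)` and the other logarithms by the polylogarithm
(`exists_sample_constant`).

Precision `δ / (N τ_j)` at one level keeps `λ_0` in the next search interval, which is short enough
to exclude aliasing (`IsRun.abs_sub_lt`). At the last level `N τ_J = δ / ε`, so the precision is
`ε`.

Filters arise by convolving the indicator of `I`, enlarged by `D / 2`, with a normalized power of
the Fejér kernel (`exists_kernel`, `exists_isFilter`). The mass of the kernel away from the origin
is the error, and the `1/|l|` decay of the Fourier coefficients of an interval gives `𝓕 = O(log d)`.
-/

/-! ### Unit phases and the Dirichlet average -/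

/-- The unit complex number `exp(i x)`. -/
def phase (x : ℝ) : ℂ := Complex.exp (x * Complex.I)

lemma phase_zero : phase 0 = 1 := by simp [phase]

lemma phase_add (x y : ℝ) : phase (x + y) = phase x * phase y := by
  simp [phase, add_mul, Complex.exp_add]

lemma norm_phase (x : ℝ) : ‖phase x‖ = 1 := Complex.norm_exp_ofReal_mul_I x

lemma conj_phase (x : ℝ) : (starRingEnd ℂ) (phase x) = phase (-x) := by
  simp [phase, ← Complex.exp_conj]

lemma phase_mul_phase_neg (x : ℝ) : phase x * phase (-x) = 1 := by
  rw [← phase_add, add_neg_cancel, phase_zero]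

lemma norm_phase_sub_one_le (x : ℝ) : ‖phase x - 1‖ ≤ |x| := by
  have := Real.norm_exp_I_mul_ofReal_sub_one_le (x := x)
  rwa [mul_comm, Real.norm_eq_abs] at this

lemma norm_phase_sub_le (x y : ℝ) : ‖phase x - phase y‖ ≤ |x - y| := by
  have : phase x - phase y = phase y * (phase (x - y) - 1) := by
    rw [mul_sub, ← phase_add]; simp
  rw [this, norm_mul, norm_phase, one_mul]
  exact norm_phase_sub_one_le _

lemma norm_one_add_phase (x : ℝ) : ‖1 + phase x‖ = 2 * |Real.cos (x / 2)| := by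
  have : 1 + phase x = phase (x / 2) * ((2 * Real.cos (x / 2) : ℝ) : ℂ) := by
    have h1 : ((2 * Real.cos (x / 2) : ℝ) : ℂ) = phase (x / 2) + phase (-(x / 2)) := by
      push_cast
      rw [Complex.two_cos, phase, phase]
      push_cast
      ring_nf
    rw [h1, mul_add, phase_mul_phase_neg, ← phase_add, add_halves, add_comm]
  rw [this, norm_mul, norm_phase, one_mul, Complex.norm_real, Real.norm_eq_abs, abs_mul]
  norm_num

/-- The average `N⁻¹ ∑_{n < N} exp(i n x)`. -/
def dirichletAvg (N : ℕ) (x : ℝ) : ℂ := (N : ℂ)⁻¹ * ∑ n ∈ Finset.range N, phase (n * x)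

lemma norm_sum_phase_le (s : Finset ℕ) (x : ℝ) : ‖∑ n ∈ s, phase (n * x)‖ ≤ s.card := by
  refine (norm_sum_le _ _).trans ?_
  simp [norm_phase]

/-- Pairing each term with its shift by `h`. -/
lemma norm_dirichletAvg_le (h m : ℕ) (hN : 0 < h + m) (x : ℝ) :
    ((h + m : ℕ) : ℝ) * ‖dirichletAvg (h + m) x‖ ≤ m * |Real.cos (h * x / 2)| + h := by
  have hN' : ((h + m : ℕ) : ℝ) ≠ 0 := by positivity
  have e0 : ((h + m : ℕ) : ℝ) * ‖dirichletAvg (h + m) x‖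
      = ‖∑ n ∈ Finset.range (h + m), phase (n * x)‖ := by
    rw [dirichletAvg, norm_mul, norm_inv, Complex.norm_natCast, mul_inv_cancel_left₀ hN']
  set S := ∑ n ∈ Finset.range (h + m), phase (n * x) with hS
  have e1 : S = ∑ n ∈ Finset.range h, phase (n * x)
      + ∑ n ∈ Finset.range m, phase (h * x) * phase (n * x) := by
    rw [hS, Finset.sum_range_add]
    congr 1
    refine Finset.sum_congr rfl fun n _ => ?_
    rw [← phase_add]; congr 1; push_cast; ring
  have e2 : S = ∑ n ∈ Finset.range m, phase (n * x)
      + ∑ n ∈ Finset.range h, phase (m * x) * phase (n * x) := by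
    rw [hS, add_comm h m, Finset.sum_range_add]
    congr 1
    refine Finset.sum_congr rfl fun n _ => ?_
    rw [← phase_add]; congr 1; push_cast; ring
  -- Adding the splittings at `h` and at `m` gives the block of length `m` the factor `1 + exp(i h
  -- x)`, of modulus `2 |cos(h x / 2)|`; for the other block the trivial bound `2` is enough.
  have e3 : 2 * S = (1 + phase (h * x)) * ∑ n ∈ Finset.range m, phase (n * x)
      + (1 + phase (m * x)) * ∑ n ∈ Finset.range h, phase (n * x) := by
    rw [two_mul]
    nth_rewrite 1 [e1]
    rw [e2, ← Finset.mul_sum, ← Finset.mul_sum]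
    ring
  have b1 := norm_sum_phase_le (Finset.range m) x
  have b2 := norm_sum_phase_le (Finset.range h) x
  rw [Finset.card_range] at b1 b2
  have b3 : ‖1 + phase (m * x)‖ ≤ 2 := by
    refine (norm_add_le _ _).trans ?_
    rw [norm_one, norm_phase]; norm_num
  have : 2 * ‖S‖ ≤ 2 * |Real.cos (h * x / 2)| * m + 2 * h := by
    have := norm_add_le ((1 + phase (h * x)) * ∑ n ∈ Finset.range m, phase (n * x))
      ((1 + phase (m * x)) * ∑ n ∈ Finset.range h, phase (n * x))
    rw [← e3] at this
    rw [norm_mul, norm_mul, norm_mul, norm_one_add_phase] at this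
    simp only [Complex.norm_ofNat] at this
    refine this.trans ?_
    gcongr
  rw [e0]
  linarith

lemma norm_dirichletAvg_le_one (N : ℕ) (x : ℝ) : ‖dirichletAvg N x‖ ≤ 1 := by
  rcases Nat.eq_zero_or_pos N with rfl | hN
  · simp [dirichletAvg]
  · have := norm_sum_phase_le (Finset.range N) x
    rw [Finset.card_range] at this
    rw [dirichletAvg, norm_mul, norm_inv, Complex.norm_natCast]
    have hN' : (0 : ℝ) < N := by positivity
    rwa [inv_mul_le_iff₀ hN', mul_one]

lemma norm_one_sub_dirichletAvg_le {N : ℕ} (hN : 0 < N) (x : ℝ) :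
    ‖1 - dirichletAvg N x‖ ≤ N * |x| := by
  have hN' : (N : ℂ) ≠ 0 := by exact_mod_cast hN.ne'
  have : 1 - dirichletAvg N x = (N : ℂ)⁻¹ * ∑ n ∈ Finset.range N, (1 - phase (n * x)) := by
    rw [dirichletAvg, Finset.sum_sub_distrib, mul_sub]
    simp [hN']
  rw [this, norm_mul, norm_inv, Complex.norm_natCast, inv_mul_le_iff₀ (by positivity)]
  calc ‖∑ n ∈ Finset.range N, (1 - phase (n * x))‖
      ≤ ∑ n ∈ Finset.range N, (N : ℝ) * |x| := by
        refine norm_sum_le_of_le _ fun n hn => ?_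
        rw [norm_sub_rev]
        refine (norm_phase_sub_one_le _).trans ?_
        rw [abs_mul, Nat.abs_cast]
        have : (n : ℝ) ≤ N := by exact_mod_cast (Finset.mem_range.1 hn).le
        gcongr
    _ = N * (N * |x|) := by simp

/-- Since `|cos|` returns to `1` at `π`, the range stops short of it. Near `π` the deficit is at
least `(2/π²)(π/4)² = 1/8`, while `y²/45 ≤ π²/80 < 1/8`. -/
lemma abs_cos_le {y : ℝ} (h0 : 0 ≤ y) (h1 : y ≤ 3 * Real.pi / 4) :
    |Real.cos y| ≤ 1 - y ^ 2 / 45 := by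
  have hpi := Real.pi_gt_three
  have hpi' := Real.pi_lt_d2
  have a1 := Real.cos_le_one_sub_mul_cos_sq (x := y) (by rw [abs_le]; constructor <;> linarith)
  have a2 := Real.cos_le_one_sub_mul_cos_sq (x := Real.pi - y)
    (by rw [abs_le]; constructor <;> linarith)
  rw [Real.cos_pi_sub] at a2
  have hp2 : (0 : ℝ) < Real.pi ^ 2 := by positivity
  have c1 : y ^ 2 / 45 ≤ 2 / Real.pi ^ 2 * y ^ 2 := by
    have : (1 : ℝ) / 45 ≤ 2 / Real.pi ^ 2 := by
      rw [div_le_div_iff₀ (by norm_num) hp2]; nlinarith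
    nlinarith [sq_nonneg y]
  have c2 : y ^ 2 / 45 ≤ 2 / Real.pi ^ 2 * (Real.pi - y) ^ 2 := by
    have h3 : (Real.pi / 4) ^ 2 ≤ (Real.pi - y) ^ 2 := by
      apply pow_le_pow_left₀ (by positivity); linarith
    have h4 : y ^ 2 ≤ (3 * Real.pi / 4) ^ 2 := pow_le_pow_left₀ h0 h1 2
    have h5 : 2 / Real.pi ^ 2 * (Real.pi / 4) ^ 2 = 1 / 8 := by field_simp; norm_num
    have h6 : 2 / Real.pi ^ 2 * (Real.pi / 4) ^ 2 ≤ 2 / Real.pi ^ 2 * (Real.pi - y) ^ 2 := by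
      gcongr
    nlinarith
  rw [abs_le]; constructor <;> linarith

/-- The Dirichlet average is bounded away from `1`, quadratically near the origin. -/
lemma one_sub_norm_dirichletAvg_ge {N : ℕ} (hN : 2 ≤ N) {x : ℝ} (hx : |x| ≤ 3 * Real.pi / 2) :
    min 1 ((N * |x|) ^ 2) / 20000 ≤ 1 - ‖dirichletAvg N x‖ := by
  have hNr : (2 : ℝ) ≤ N := by exact_mod_cast hN
  -- A shift `h` is useful if `h |x| / 2` stays away from `π` and a fixed fraction of the terms gets
  -- paired: `720 = 4 · 4 · 45`.
  have key : ∀ h m : ℕ, h + m = N → (h : ℝ) * |x| ≤ 3 * Real.pi / 2 → (N : ℝ) / 4 ≤ m →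
      ((h : ℝ) * |x|) ^ 2 / 720 ≤ 1 - ‖dirichletAvg N x‖ := by
    intro h m hm hh hm4
    have h1 := norm_dirichletAvg_le h m (by omega) x
    rw [hm] at h1
    have h2 : |Real.cos (h * x / 2)| ≤ 1 - (h * |x| / 2) ^ 2 / 45 := by
      have : |Real.cos (h * x / 2)| = |Real.cos (h * |x| / 2)| := by
        rw [← Real.cos_abs (h * x / 2), abs_div, abs_mul]; simp
      rw [this]
      exact abs_cos_le (by positivity) (by linarith)
    have hhm : (h : ℝ) + m = N := by exact_mod_cast hm
    have h3 : (m : ℝ) * |Real.cos (h * x / 2)| ≤ m * (1 - (h * |x| / 2) ^ 2 / 45) := by gcongr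
    have h4 : (N : ℝ) / 4 * ((h * |x| / 2) ^ 2 / 45) ≤ m * ((h * |x| / 2) ^ 2 / 45) := by gcongr
    have h5 : (N : ℝ) * (((h : ℝ) * |x|) ^ 2 / 720) ≤ N * (1 - ‖dirichletAvg N x‖) := by
      nlinarith
    exact le_of_mul_le_mul_left h5 (by linarith)
  -- Below the resolution `1/N` the shift is half the window, so `h ≥ N/3`. Above it, `h` is about
  -- `1/(4|x|)`, so `h |x| ≥ 1/4`; `N ≥ 2` then gives `h ≤ N/4 + 1 ≤ 3N/4`. The two gaps are
  -- `(N|x|)²/6480` and `1/11520`.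
  rcases le_total ((N : ℝ) * |x|) 1 with hu | hu
  · have hh : (N : ℝ) ≤ 3 * (N / 2 : ℕ) := by
      have : N ≤ 3 * (N / 2) := by omega
      exact_mod_cast this
    have hh2 : 2 * ((N / 2 : ℕ) : ℝ) ≤ N := by
      have : 2 * (N / 2) ≤ N := by omega
      exact_mod_cast this
    have := key (N / 2) (N - N / 2) (by omega)
      (by nlinarith [Real.pi_gt_three, abs_nonneg x])
      (by rw [Nat.cast_sub (by omega)]; linarith)
    refine le_trans ?_ this
    have h7 : (N : ℝ) * |x| ≤ 3 * ((N / 2 : ℕ) * |x|) := by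
      nlinarith [abs_nonneg x]
    have h8 : (N * |x|) ^ 2 ≤ (3 * ((N / 2 : ℕ) * |x|)) ^ 2 :=
      pow_le_pow_left₀ (by positivity) h7 2
    have := min_le_right (1 : ℝ) ((N * |x|) ^ 2)
    nlinarith
  · have hxpos : 0 < |x| := by
      by_contra hc
      have : |x| = 0 := le_antisymm (not_lt.1 hc) (abs_nonneg x)
      rw [this] at hu; norm_num at hu
    set h := ⌈1 / (4 * |x|)⌉₊ with hdef
    have hle : 1 / (4 * |x|) ≤ h := Nat.le_ceil _
    have hlt : (h : ℝ) < 1 / (4 * |x|) + 1 := Nat.ceil_lt_add_one (by positivity)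
    have h1 : 1 / 4 ≤ (h : ℝ) * |x| := by
      have := mul_le_mul_of_nonneg_right hle hxpos.le
      have e : 1 / (4 * |x|) * |x| = 1 / 4 := by field_simp
      linarith
    have h2 : (h : ℝ) * |x| ≤ 1 / 4 + |x| := by
      have := mul_le_mul_of_nonneg_right hlt.le hxpos.le
      have e : (1 / (4 * |x|) + 1) * |x| = 1 / 4 + |x| := by field_simp
      linarith
    have h3 : (h : ℝ) ≤ N / 4 + 1 := by
      have : 1 / (4 * |x|) ≤ N / 4 := by
        rw [div_le_div_iff₀ (by positivity) (by norm_num)]; nlinarith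
      linarith
    have h4 : h < N := by
      have : (h : ℝ) < N := by linarith
      exact_mod_cast this
    have h5 : (h : ℝ) * |x| ≤ 3 * Real.pi / 2 := by
      rcases le_or_gt (1 / 4) |x| with hb | hb
      · have : h ≤ 1 := by
          rw [hdef, Nat.ceil_le, div_le_iff₀ (by positivity)]
          push_cast; linarith
        have : (h : ℝ) ≤ 1 := by exact_mod_cast this
        nlinarith
      · linarith [Real.pi_gt_three]
    have := key h (N - h) (by omega) h5 (by rw [Nat.cast_sub h4.le]; linarith)
    refine le_trans ?_ this
    have := min_le_left (1 : ℝ) ((N * |x|) ^ 2)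
    nlinarith

/-! ### Least squares -/

/-- The correlation `N⁻¹ ∑_n Z_n exp(i θ n τ)` of the data with a pure oscillation. -/
def correlation {N : ℕ} (Z : Fin N → ℂ) (τ θ : ℝ) : ℂ :=
  (N : ℂ)⁻¹ * ∑ n : Fin N, Z n * phase (((n : ℕ) : ℝ) * (θ * τ))

lemma exp_neg_eq_phase (θ τ : ℝ) (n : ℕ) :
    Complex.exp (-(Complex.I * θ * (n : ℂ) * τ)) = phase (-((n : ℝ) * (θ * τ))) := by
  rw [phase]; push_cast; ring_nf

lemma sq_norm_sub (z w : ℂ) :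
    ‖z - w‖ ^ 2 = ‖z‖ ^ 2 + ‖w‖ ^ 2 - 2 * (z * (starRingEnd ℂ) w).re := by
  simp only [Complex.sq_norm, Complex.normSq_sub]

/-- Completing the square in `r`: the best amplitude is the correlation itself, so only
`|correlation|` matters for the choice of `θ`. -/
lemma loss_eq {N : ℕ} (hN : 0 < N) (Z : Fin N → ℂ) (τ : ℝ) (r : ℂ) (θ : ℝ) :
    loss Z τ r θ = (N : ℝ)⁻¹ * ∑ n, ‖Z n‖ ^ 2 - ‖correlation Z τ θ‖ ^ 2
      + ‖r - correlation Z τ θ‖ ^ 2 := by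
  have hN' : (N : ℝ) ≠ 0 := by exact_mod_cast hN.ne'
  have hterm : ∀ n : Fin N, ‖Z n - r * phase (-(((n : ℕ) : ℝ) * (θ * τ)))‖ ^ 2
      = ‖Z n‖ ^ 2 + ‖r‖ ^ 2
        - 2 * ((starRingEnd ℂ) r * (Z n * phase (((n : ℕ) : ℝ) * (θ * τ)))).re := by
    intro n
    rw [sq_norm_sub, norm_mul, norm_phase, mul_one, map_mul, conj_phase, neg_neg]
    ring_nf
  have hsum : ∑ n : Fin N, ((starRingEnd ℂ) r * (Z n * phase (((n : ℕ) : ℝ) * (θ * τ)))).re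
      = N * ((starRingEnd ℂ) r * correlation Z τ θ).re := by
    have : (N : ℂ) * correlation Z τ θ
        = ∑ n : Fin N, Z n * phase (((n : ℕ) : ℝ) * (θ * τ)) := by
      rw [correlation, mul_inv_cancel_left₀]; exact_mod_cast hN.ne'
    rw [← Complex.re_sum, ← Finset.mul_sum, ← this]
    have : (starRingEnd ℂ) r * ((N : ℂ) * correlation Z τ θ)
        = ((N : ℝ) : ℂ) * ((starRingEnd ℂ) r * correlation Z τ θ) := by push_cast; ring
    rw [this, Complex.re_ofReal_mul]
  unfold loss
  simp only [exp_neg_eq_phase, hterm]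
  rw [Finset.sum_sub_distrib, Finset.sum_add_distrib, ← Finset.mul_sum, hsum,
    sq_norm_sub]
  simp only [Finset.sum_const, Finset.card_univ, Fintype.card_fin, nsmul_eq_mul]
  have e : (r * (starRingEnd ℂ) (correlation Z τ θ)).re
      = ((starRingEnd ℂ) r * correlation Z τ θ).re := by
    rw [← Complex.conj_re]; simp [mul_comm]
  rw [e]
  field_simp
  ring

lemma norm_correlation_le_of_minimizer {N : ℕ} (hN : 0 < N) {Z : Fin N → ℂ} {τ : ℝ} {r : ℂ}
    {θ lam : ℝ} (h : ∀ r', loss Z τ r θ ≤ loss Z τ r' lam) :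
    ‖correlation Z τ lam‖ ≤ ‖correlation Z τ θ‖ := by
  have := h (correlation Z τ lam)
  rw [loss_eq hN, loss_eq hN, sub_self, norm_zero] at this
  exact le_of_sq_le_sq (by nlinarith [sq_nonneg ‖r - correlation Z τ θ‖]) (norm_nonneg _)

/-! ### Summation by parts -/

lemma sum_mul_eq_summation_by_parts (w c : ℕ → ℂ) (N : ℕ) :
    ∑ n ∈ Finset.range N, w n * c n = (∑ n ∈ Finset.range N, w n) * c N
      - ∑ n ∈ Finset.range N, (∑ j ∈ Finset.range (n + 1), w j) * (c (n + 1) - c n) := by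
  induction N with
  | zero => simp
  | succ N ih =>
    rw [Finset.sum_range_succ, ih, Finset.sum_range_succ _ N,
      Finset.sum_range_succ (fun n => (∑ j ∈ Finset.range (n + 1), w j) * (c (n + 1) - c n)) N,
      Finset.sum_range_succ w N]
    ring

/-- Summation by parts puts the differences on the phases, each at most `|y|`. The bound therefore
sees only the partial sums of `w`, which cancel, and not the individual terms, which for the noise
need not be small. -/
lemma norm_sum_mul_phase_sub_sum_le {w : ℕ → ℂ} {N : ℕ} {B : ℝ}
    (hw : ∀ m ≤ N, ‖∑ n ∈ Finset.range m, w n‖ ≤ B) (y : ℝ) :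
    ‖∑ n ∈ Finset.range N, w n * phase (n * y) - ∑ n ∈ Finset.range N, w n‖
      ≤ 2 * B * (N * |y|) := by
  rw [sum_mul_eq_summation_by_parts]
  set S := ∑ n ∈ Finset.range N, w n with hS
  have hB : 0 ≤ B := (norm_nonneg _).trans (hw 0 (Nat.zero_le _))
  have e : ∀ T : ℂ, S * phase (N * y) - T - S = S * (phase (N * y) - 1) - T := by
    intro T; ring
  rw [e]
  refine (norm_sub_le _ _).trans ?_
  have h1 : ‖S * (phase (N * y) - 1)‖ ≤ B * (N * |y|) := by
    rw [norm_mul]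
    have := norm_phase_sub_one_le (N * y)
    rw [abs_mul, Nat.abs_cast] at this
    gcongr
    exact hw N le_rfl
  have h2 : ‖∑ n ∈ Finset.range N, (∑ j ∈ Finset.range (n + 1), w j)
      * (phase ((n + 1 : ℕ) * y) - phase (n * y))‖ ≤ ∑ n ∈ Finset.range N, B * |y| := by
    refine norm_sum_le_of_le _ fun n hn => ?_
    rw [norm_mul]
    have := norm_phase_sub_le ((n + 1 : ℕ) * y) (n * y)
    have e : ((n + 1 : ℕ) : ℝ) * y - n * y = y := by push_cast; ring
    rw [e] at this
    have := hw (n + 1) (Finset.mem_range.1 hn)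
    gcongr
  rw [Finset.sum_const, Finset.card_range, nsmul_eq_mul] at h2
  linarith

/-! ### One level of the least squares fit -/

/-- Uniform smallness of the partial exponential sums of a noise sequence, on a grid of mesh
`1 / N`. -/
def SmallNoise (N : ℕ) (w : ℕ → ℂ) (σ : ℝ) : Prop :=
  ∀ m ≤ N, ∀ k ∈ Finset.Icc (-(6 * N : ℤ)) (6 * N),
    ‖∑ n ∈ Finset.range m, w n * phase (n * ((k : ℝ) / N))‖ ≤ N * σ

/-- The average `N⁻¹ ∑_{n < N} w_n exp(i n x)`. -/
def noiseAvg (N : ℕ) (w : ℕ → ℂ) (x : ℝ) : ℂ :=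
  (N : ℂ)⁻¹ * ∑ n ∈ Finset.range N, w n * phase (n * x)

/-- This Lipschitz bound, with a constant proportional to `σ`, is what lets noise of relative size
`δ` rather than `δ²` suffice; it is applied with `k = 0` for that purpose. -/
lemma SmallNoise.norm_noiseAvg_sub_le {N : ℕ} {w : ℕ → ℂ} {σ : ℝ} (h : SmallNoise N w σ)
    (hN : 0 < N) {k : ℤ} (hk : k ∈ Finset.Icc (-(6 * N : ℤ)) (6 * N)) (x : ℝ) :
    ‖noiseAvg N w x - noiseAvg N w ((k : ℝ) / N)‖ ≤ 2 * σ * (N * |x - k / N|) := by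
  have hN' : (0 : ℝ) < N := by exact_mod_cast hN
  have h1 := norm_sum_mul_phase_sub_sum_le (w := fun n => w n * phase (n * ((k : ℝ) / N)))
    (fun m hm => h m hm k hk) (x - k / N)
  have e : ∀ n : ℕ, w n * phase (n * ((k : ℝ) / N)) * phase (n * (x - k / N))
      = w n * phase (n * x) := by
    intro n
    rw [mul_assoc, ← phase_add]; congr 2; ring
  simp only [e] at h1
  rw [noiseAvg, noiseAvg, ← mul_sub, norm_mul, norm_inv, Complex.norm_natCast,
    inv_mul_le_iff₀ hN']
  linarith

lemma SmallNoise.norm_noiseAvg_grid_le {N : ℕ} {w : ℕ → ℂ} {σ : ℝ} (h : SmallNoise N w σ)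
    (hN : 0 < N) {k : ℤ} (hk : k ∈ Finset.Icc (-(6 * N : ℤ)) (6 * N)) :
    ‖noiseAvg N w ((k : ℝ) / N)‖ ≤ σ := by
  have hN' : (0 : ℝ) < N := by exact_mod_cast hN
  rw [noiseAvg, norm_mul, norm_inv, Complex.norm_natCast, inv_mul_le_iff₀ hN']
  exact h N le_rfl k hk

/-- The grid point `⌊N x⌋ / N` is within `1/N` of `x`: at most `σ` there, plus `2σ` for the
displacement. The grid reaches `±6`, beyond `3π/2`. -/
lemma SmallNoise.norm_noiseAvg_le {N : ℕ} {w : ℕ → ℂ} {σ : ℝ} (h : SmallNoise N w σ)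
    (hN : 0 < N) {x : ℝ} (hx : |x| ≤ 3 * Real.pi / 2) : ‖noiseAvg N w x‖ ≤ 3 * σ := by
  have hN' : (1 : ℝ) ≤ N := by exact_mod_cast hN
  have hpi := Real.pi_lt_d2
  obtain ⟨hx1, hx2⟩ := abs_le.1 hx
  have f1 := Int.floor_le (N * x)
  have f2 := Int.lt_floor_add_one (N * x)
  have hk : ⌊(N : ℝ) * x⌋ ∈ Finset.Icc (-(6 * N : ℤ)) (6 * N) := by
    rw [Finset.mem_Icc]
    constructor
    · rw [Int.le_floor]; push_cast; nlinarith
    · have : ((⌊(N : ℝ) * x⌋ : ℤ) : ℝ) ≤ ((6 * N : ℤ) : ℝ) := by push_cast; nlinarith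
      exact_mod_cast this
  have h1 := h.norm_noiseAvg_sub_le hN hk x
  have h2 := h.norm_noiseAvg_grid_le hN hk
  have hσ : 0 ≤ σ := (norm_nonneg _).trans h2
  have h3 : (N : ℝ) * |x - ⌊(N : ℝ) * x⌋ / N| ≤ 1 := by
    have e : x - ⌊(N : ℝ) * x⌋ / N = (N * x - ⌊(N : ℝ) * x⌋) / N := by field_simp
    rw [e, abs_div, Nat.abs_cast, mul_div_cancel₀ _ (by positivity), abs_le]
    constructor <;> linarith
  have := norm_le_norm_add_norm_sub' (noiseAvg N w x) (noiseAvg N w (⌊(N : ℝ) * x⌋ / N))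
  nlinarith

lemma SmallNoise.norm_noiseAvg_sub_zero_le {N : ℕ} {w : ℕ → ℂ} {σ : ℝ} (h : SmallNoise N w σ)
    (hN : 0 < N) (x : ℝ) : ‖noiseAvg N w x - noiseAvg N w 0‖ ≤ 2 * σ * (N * |x|) := by
  have := h.norm_noiseAvg_sub_le hN (k := 0) (by simp) x
  simpa using this

lemma SmallNoise.norm_noiseAvg_zero_le {N : ℕ} {w : ℕ → ℂ} {σ : ℝ} (h : SmallNoise N w σ)
    (hN : 0 < N) : ‖noiseAvg N w 0‖ ≤ σ := by
  have := h.norm_noiseAvg_grid_le hN (k := 0) (by simp)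
  simpa using this

lemma correlation_eq {N : ℕ} {Z : Fin N → ℂ} {τ lam : ℝ} {a : ℂ} {b w : ℕ → ℂ}
    (hZ : ∀ n : Fin N, Z n * phase (((n : ℕ) : ℝ) * (lam * τ)) = a + b n + w n) (θ : ℝ) :
    correlation Z τ θ = a * dirichletAvg N ((θ - lam) * τ) + noiseAvg N b ((θ - lam) * τ)
      + noiseAvg N w ((θ - lam) * τ) := by
  have e : ∀ n : Fin N, Z n * phase (((n : ℕ) : ℝ) * (θ * τ))
      = (fun n : ℕ => (a + b n + w n) * phase (n * ((θ - lam) * τ))) n := by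
    intro n
    simp only
    rw [← hZ, mul_assoc, ← phase_add]; congr 2; ring
  rw [correlation, Finset.sum_congr rfl fun n _ => e n, Fin.sum_univ_eq_sum_range
    (fun n : ℕ => (a + b n + w n) * phase (n * ((θ - lam) * τ))), dirichletAvg, noiseAvg, noiseAvg]
  simp only [add_mul, Finset.sum_add_distrib, mul_add, ← Finset.mul_sum]
  ring

lemma norm_noiseAvg_le_of_forall {N : ℕ} (hN : 0 < N) {b : ℕ → ℂ} {β : ℝ}
    (hb : ∀ n < N, ‖b n‖ ≤ β) (x : ℝ) : ‖noiseAvg N b x‖ ≤ β := by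
  have hN' : (0 : ℝ) < N := by exact_mod_cast hN
  rw [noiseAvg, norm_mul, norm_inv, Complex.norm_natCast, inv_mul_le_iff₀ hN']
  calc _ ≤ ∑ n ∈ Finset.range N, β := by
        refine norm_sum_le_of_le _ fun n hn => ?_
        rw [norm_mul, norm_phase, mul_one]
        exact hb n (Finset.mem_range.1 hn)
    _ = N * β := by simp

/-- Suppose `u ≥ δ`. For `u ≤ 1`, the left side of `h1` is at least `p u²/40000`, but `2β ≤ p
u²/100000` and `3σu ≤ p u²/200000`. For `u ≥ 1`, where the factor `u` would be harmful, `h2` is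
contradicted at the scale `p` instead. -/
lemma lt_of_quadratic_bound {p δ β σ k u A B : ℝ} (hp : 0 < p) (hδ : 0 < δ) (hδ1 : δ ≤ 1)
    (hu0 : 0 ≤ u) (hβ : β ≤ p * δ ^ 2 / 200000) (hσ : σ ≤ p * δ / 600000)
    (hk1 : k ≤ 1) (hk : min 1 (u ^ 2) / 20000 ≤ 1 - k)
    (hA : 9 / 10 * p ≤ A) (hB : p / 2 ≤ B)
    (h1 : (1 - k) * B ≤ 2 * β + 3 * σ * u) (h2 : (1 - k) * A ≤ 2 * β + 4 * σ) : u < δ := by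
  by_contra hcon
  push Not at hcon
  have hpδ : p * δ ≤ p := by nlinarith
  have hpδ2 : p * δ ^ 2 ≤ p := by
    have : δ ^ 2 ≤ 1 := pow_le_one₀ hδ.le hδ1
    nlinarith
  rcases le_total u 1 with hu1 | hu1
  · rw [min_eq_right (pow_le_one₀ hu0 hu1)] at hk
    have h4 : u ^ 2 / 20000 * (p / 2) ≤ (1 - k) * B :=
      mul_le_mul hk hB (by positivity) (by linarith)
    have h6 : σ * u ≤ p * u ^ 2 / 600000 := by
      have h61 : σ * u ≤ p * δ / 600000 * u := by gcongr
      have h62 : p * δ * u ≤ p * u * u := by gcongr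
      linarith
    have h7 : p * δ ^ 2 ≤ p * u ^ 2 := by gcongr
    have h8 : 0 < p * u ^ 2 := by
      have : 0 < u := by linarith
      positivity
    linarith
  · rw [min_eq_left (one_le_pow₀ hu1)] at hk
    have h4 : 1 / 20000 * (9 / 10 * p) ≤ (1 - k) * A :=
      mul_le_mul hk hA (by positivity) (by linarith)
    linarith

/-- If the data are a pure oscillation of frequency `lam`, up to a bias of relative size `δ²` and a
noise of relative size `δ`, then the least squares fit finds `lam` up to `δ / (N τ)`. -/
lemma abs_sub_lt_of_minimizer {N : ℕ} (hN : 2 ≤ N) {Z : Fin N → ℂ} {τ lam θ δ p σ β : ℝ} {r a : ℂ}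
    {b w : ℕ → ℂ} (hτ : 0 < τ) (hδ : 0 < δ) (hδ1 : δ ≤ 1) (hp : 0 < p)
    (ha : 9 / 10 * p ≤ ‖a‖)
    (hZ : ∀ n : Fin N, Z n * phase (((n : ℕ) : ℝ) * (lam * τ)) = a + b n + w n)
    (hb : ∀ n < N, ‖b n‖ ≤ β) (hβ : β ≤ p * δ ^ 2 / 200000)
    (hw : SmallNoise N w σ) (hσ : σ ≤ p * δ / 600000)
    (hmin : ∀ r', loss Z τ r θ ≤ loss Z τ r' lam)
    (hx : |θ - lam| * τ ≤ 3 * Real.pi / 2) :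
    |θ - lam| * (N * τ) < δ := by
  have hN0 : 0 < N := by omega
  have hcorr := norm_correlation_le_of_minimizer hN0 hmin
  rw [correlation_eq hZ, correlation_eq hZ] at hcorr
  set x := (θ - lam) * τ with hxdef
  have hxabs : |x| = |θ - lam| * τ := by rw [hxdef, abs_mul, abs_of_pos hτ]
  rw [← hxabs] at hx
  have hu : |θ - lam| * (N * τ) = N * |x| := by rw [hxabs]; ring
  rw [hu]
  have hd0 : dirichletAvg N 0 = 1 := by
    have : (N : ℂ) ≠ 0 := by exact_mod_cast hN0.ne'
    simp [dirichletAvg, phase_zero, this]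
  rw [sub_self, zero_mul, hd0, mul_one] at hcorr
  have hk := one_sub_norm_dirichletAvg_ge hN hx
  set K := dirichletAvg N x with hK
  have hK1 : ‖K‖ ≤ 1 := norm_dirichletAvg_le_one N x
  have hb0 := norm_noiseAvg_le_of_forall hN0 hb 0
  have hbx := norm_noiseAvg_le_of_forall hN0 hb x
  have hE0 := hw.norm_noiseAvg_zero_le hN0
  have hEx := hw.norm_noiseAvg_le hN0 hx
  have hEd := hw.norm_noiseAvg_sub_zero_le hN0 x
  have h1K := norm_one_sub_dirichletAvg_le hN0 x
  rw [← hK] at h1K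
  set E0 := noiseAvg N w 0
  set Ex := noiseAvg N w x
  set u := (N : ℝ) * |x| with hudef
  have hu0 : 0 ≤ u := by positivity
  have hσ0 : 0 ≤ σ := (norm_nonneg _).trans hE0
  have hlow : ‖a + E0‖ - β ≤ ‖a + noiseAvg N b 0 + E0‖ := by
    have : a + E0 = (a + noiseAvg N b 0 + E0) - noiseAvg N b 0 := by ring
    have h2 : ‖a + E0‖ ≤ ‖a + noiseAvg N b 0 + E0‖ + ‖noiseAvg N b 0‖ := by
      rw [this]; exact norm_sub_le _ _
    linarith
  have haE : ‖a‖ - σ ≤ ‖a + E0‖ := by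
    have : ‖a‖ ≤ ‖a + E0‖ + ‖E0‖ := by
      have e : a = (a + E0) - E0 := by ring
      calc ‖a‖ = ‖(a + E0) - E0‖ := by rw [← e]
        _ ≤ _ := norm_sub_le _ _
    linarith
  -- The noise at the true frequency is grouped with the signal as `K (a + E0)`. What remains of the
  -- noise is `(Ex - E0) + (1 - K) E0`, and both terms carry a factor `u`.
  have hup1 : ‖a * K + noiseAvg N b x + Ex‖ ≤ ‖K‖ * ‖a + E0‖ + β + 3 * σ * u := by
    have e : a * K + noiseAvg N b x + Ex
        = K * (a + E0) + noiseAvg N b x + ((Ex - E0) + (1 - K) * E0) := by ring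
    rw [e]
    refine (norm_add₃_le).trans ?_
    have h3 : ‖(Ex - E0) + (1 - K) * E0‖ ≤ 2 * σ * u + u * σ := by
      refine (norm_add_le _ _).trans ?_
      rw [norm_mul]
      gcongr
    rw [norm_mul]
    linarith
  -- For `u ≥ 1` the uniform noise bound is the better one.
  have hup2 : ‖a * K + noiseAvg N b x + Ex‖ ≤ ‖K‖ * ‖a‖ + β + 3 * σ := by
    refine (norm_add₃_le).trans ?_
    rw [norm_mul, mul_comm]
    linarith
  have hpδ : p * δ ≤ p := by nlinarith
  refine lt_of_quadratic_bound hp hδ hδ1 hu0 hβ hσ hK1 hk ha (B := ‖a + E0‖) (by linarith)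
    ?_ ?_ <;> linarith

/-! ### All levels -/

/-- Induction over levels. With `N ≥ 2` and `δ ≤ 1` the previous estimate satisfies `|θ - λ_0| τ ≤
1/2 < π/2`, so `λ_0` is an admissible competitor at the next level. There the candidates have phase
error at most `π + 1 ≤ 3π/2` per step, within the range free of aliasing; at the first level it is
at most `2π · 1/2`. -/
lemma IsRun.abs_sub_lt {J N : ℕ} (hN : 2 ≤ N) {Z : Fin J → Fin N → ℂ} {τ : ℕ → ℝ} {r : ℕ → ℂ}
    {θ : ℕ → ℝ} {lam δ : ℝ} (hrun : IsRun Z τ r θ) (hτ : ∀ i, 0 < τ i)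
    (hτ2 : ∀ i, τ (i + 1) = 2 * τ i) (hτ0 : τ 0 ≤ 1 / 2) (hlam : lam ∈ Set.Icc (-Real.pi) Real.pi)
    (hδ1 : δ ≤ 1)
    (hlevel : ∀ (i : Fin J) (r : ℂ) (θ : ℝ),
      (∀ r', loss (Z i) (τ i) r θ ≤ loss (Z i) (τ i) r' lam) →
      |θ - lam| * τ i ≤ 3 * Real.pi / 2 → |θ - lam| * (N * τ i) < δ) :
    ∀ i < J, |θ i - lam| * (N * τ i) < δ := by
  have hN' : (2 : ℝ) ≤ N := by exact_mod_cast hN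
  have hpi := Real.pi_gt_three
  intro i
  induction i with
  | zero =>
    intro hJ
    obtain ⟨h1, h2⟩ := hrun ⟨0, hJ⟩
    simp only [searchInterval] at h1 h2
    refine hlevel ⟨0, hJ⟩ _ _ (fun r' => h2 r' lam hlam) ?_
    have : |θ 0 - lam| ≤ 2 * Real.pi := by
      rw [abs_le]; constructor <;> linarith [h1.1, h1.2, hlam.1, hlam.2]
    have := mul_le_mul this hτ0 (hτ 0).le (by positivity)
    simp only
    linarith
  | succ i ih =>
    intro hJ
    have ih := ih (by omega)
    obtain ⟨h1, h2⟩ := hrun ⟨i + 1, hJ⟩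
    simp only [searchInterval] at h1 h2
    have hτi := hτ i
    have hnear : |θ i - lam| * τ i ≤ 1 / 2 := by
      have : |θ i - lam| * (2 * τ i) ≤ |θ i - lam| * (N * τ i) := by gcongr
      linarith
    have hmem : lam ∈ Set.Icc (θ i - Real.pi / (2 * τ i)) (θ i + Real.pi / (2 * τ i)) := by
      have : |θ i - lam| ≤ Real.pi / (2 * τ i) := by
        rw [le_div_iff₀ (by positivity)]; linarith
      rw [abs_le] at this
      constructor <;> linarith [this.1, this.2]
    refine hlevel ⟨i + 1, hJ⟩ _ _ (fun r' => h2 r' lam hmem) ?_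
    simp only
    have h3 : |θ (i + 1) - θ i| ≤ Real.pi / (2 * τ i) := by
      rw [abs_le]; constructor <;> linarith [h1.1, h1.2]
    rw [le_div_iff₀ (by positivity)] at h3
    have h4 : |θ (i + 1) - lam| ≤ |θ (i + 1) - θ i| + |θ i - lam| := abs_sub_le _ _ _
    rw [hτ2]
    nlinarith

lemma timeStep_pos {ε δ : ℝ} {N : ℕ} (hε : 0 < ε) (hδ : 0 < δ) (hN : 0 < N) (i : ℕ) :
    0 < timeStep ε δ N i := by
  unfold timeStep; positivity

lemma timeStep_succ (ε δ : ℝ) (N i : ℕ) : timeStep ε δ N (i + 1) = 2 * timeStep ε δ N i := by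
  unfold timeStep
  rw [Nat.cast_add_one, add_sub_right_comm, zpow_add_one₀ (by norm_num)]
  ring

lemma timeStep_eq (ε δ : ℝ) (N i : ℕ) : timeStep ε δ N i = 2 ^ i * timeStep ε δ N 0 := by
  induction i with
  | zero => simp
  | succ i ih => rw [timeStep_succ, ih]; ring

lemma timeStep_last (ε δ : ℝ) (N : ℕ) : timeStep ε δ N (numLevels ε - 1) = δ / (N * ε) := by
  simp [timeStep, numLevels]

lemma mul_timeStep_last {ε δ : ℝ} {N : ℕ} (hε : 0 < ε) (hN : 0 < N) :
    N * timeStep ε δ N (numLevels ε - 1) = δ / ε := by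
  have : (N : ℝ) ≠ 0 := by exact_mod_cast hN.ne'
  rw [timeStep_last]; field_simp

/-- Rounding `log₂(1/ε)` up makes the power of two at most `ε`. The first step is thus short enough
to search all of `[-π, π]`. -/
lemma timeStep_zero_le {ε δ : ℝ} {N : ℕ} (hε : 0 < ε) (hδ : 0 < δ) :
    timeStep ε δ N 0 ≤ δ / N := by
  unfold timeStep
  have h1 : 1 / ε ≤ 2 ^ ⌈Real.logb 2 (1 / ε)⌉₊ := by
    have := Nat.le_ceil (Real.logb 2 (1 / ε))
    rw [Real.logb_le_iff_le_rpow (by norm_num) (by positivity)] at this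
    simpa using this
  have h2 : (2 : ℝ) ^ ((0 : ℕ) - (⌈Real.logb 2 (1 / ε)⌉₊ : ℤ)) ≤ ε := by
    rw [Nat.cast_zero, zero_sub, zpow_neg, zpow_natCast]
    rw [inv_le_comm₀ (by positivity) hε]
    simpa using h1
  calc _ ≤ ε * (δ / (N * ε)) := by gcongr
    _ = δ / N := by
      rcases Nat.eq_zero_or_pos N with rfl | hN
      · simp
      · have : (N : ℝ) ≠ 0 := by exact_mod_cast hN.ne'
        field_simp

/-! ### The Hadamard test -/

section Circuit

variable {E : Type*} [NormedAddCommGroup E] [InnerProductSpace ℂ E]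

lemma exp_apply_of_eigenvector [CompleteSpace E] {T : E →L[ℂ] E} {x : E} {μ : ℂ}
    (h : T x = μ • x) : NormedSpace.exp T x = Complex.exp μ • x := by
  have h1 := NormedSpace.exp_series_hasSum_exp' (𝕂 := ℂ) T
  have h2 := h1.mapL (ContinuousLinearMap.apply ℂ E x)
  have h3 := NormedSpace.exp_series_hasSum_exp' (𝕂 := ℂ) μ
  have h4 := h3.mapL ((ContinuousLinearMap.id ℂ ℂ).smulRight x)
  have hpow : ∀ n : ℕ, (T ^ n) x = μ ^ n • x := by
    intro n
    induction n with
    | zero => simp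
    | succ n ih => rw [pow_succ, mul_apply_eq_comp, h, map_smul, ih, smul_smul, pow_succ']
  have e : (fun n : ℕ => (ContinuousLinearMap.apply ℂ E x) (((n.factorial : ℂ)⁻¹) • T ^ n))
      = fun n : ℕ => ((ContinuousLinearMap.id ℂ ℂ).smulRight x) (((n.factorial : ℂ)⁻¹) • μ ^ n) := by
    funext n
    simp [hpow, smul_smul]
  rw [e] at h2
  have := h2.unique h4
  simpa [Complex.exp_eq_exp_ℂ] using this

variable {M : ℕ} {H : E →L[ℂ] E} {v : OrthonormalBasis (Fin (M + 1)) ℂ E} {lam : Fin (M + 1) → ℝ}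

lemma IsEigensystem.evolution_apply (h : IsEigensystem H v lam) (t : ℝ) (m : Fin (M + 1)) :
    evolution H t (v m) = phase (-(t * lam m)) • v m := by
  have : FiniteDimensional ℂ E := v.toBasis.finiteDimensional_of_finite
  have : CompleteSpace E := FiniteDimensional.complete ℂ E
  have h1 : ((-(Complex.I * (t : ℂ))) • H) (v m) = (-(Complex.I * (t : ℂ)) * lam m) • v m := by
    rw [smul_apply, h m, smul_smul]
  rw [evolution, exp_apply_of_eigenvector h1, phase]
  congr 2
  push_cast; ring

lemma IsEigensystem.inner_evolution (h : IsEigensystem H v lam) (t : ℝ) (m : Fin (M + 1)) (ψ : E) :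
    inner ℂ (v m) (evolution H t ψ) = phase (-(t * lam m)) * inner ℂ (v m) ψ := by
  have h1 : evolution H t ψ = ∑ k, inner ℂ (v k) ψ • (phase (-(t * lam k)) • v k) := by
    conv_lhs => rw [← v.sum_repr' ψ]
    rw [map_sum]
    refine Finset.sum_congr rfl fun k _ => ?_
    rw [map_smul, h.evolution_apply]
  rw [h1, inner_sum]
  rw [Finset.sum_eq_single m]
  · rw [inner_smul_right, inner_smul_right, v.inner_eq_one, mul_one, mul_comm]
  · intro k _ hk
    rw [inner_smul_right, inner_smul_right, v.inner_eq_zero hk.symm, mul_zero, mul_zero]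
  · simp

lemma IsEigensystem.norm_evolution (h : IsEigensystem H v lam) (t : ℝ) (ψ : E) :
    ‖evolution H t ψ‖ = ‖ψ‖ := by
  have h1 := v.sum_sq_norm_inner_right (evolution H t ψ)
  have h2 := v.sum_sq_norm_inner_right ψ
  simp only [h.inner_evolution, norm_mul, norm_phase, one_mul] at h1
  rw [h2] at h1
  exact ((sq_eq_sq₀ (norm_nonneg _) (norm_nonneg _)).1 h1).symm

lemma sum_overlap {ψ : E} (hψ : ‖ψ‖ = 1) : ∑ m, overlap v ψ m = 1 := by
  have := v.sum_sq_norm_inner_right ψ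
  rw [hψ, one_pow] at this
  exact this

lemma overlap_nonneg (ψ : E) (m : Fin (M + 1)) : 0 ≤ overlap v ψ m := sq_nonneg _

lemma IsEigensystem.inner_self_evolution (h : IsEigensystem H v lam) (t : ℝ) (ψ : E) :
    inner ℂ ψ (evolution H t ψ) = ∑ m, (overlap v ψ m : ℂ) * phase (-(t * lam m)) := by
  rw [← v.sum_inner_mul_inner ψ (evolution H t ψ)]
  refine Finset.sum_congr rfl fun m _ => ?_
  rw [h.inner_evolution, overlap, ← inner_conj_symm, mul_left_comm, mul_comm (phase _)]
  congr 1
  rw [← Complex.normSq_eq_conj_mul_self, Complex.normSq_eq_norm_sq]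

lemma circuitState_fst (H : E →L[ℂ] E) (ψ : E) (w : ℂ) (t : ℝ) :
    (circuitState H ψ w t).1 = (1 / 2 : ℂ) • (ψ + w • evolution H t ψ) := by
  have h2 : ((((Real.sqrt 2)⁻¹ : ℝ) : ℂ)) * ((((Real.sqrt 2)⁻¹ : ℝ) : ℂ)) = 1 / 2 := by
    rw [← Complex.ofReal_mul, ← mul_inv, Real.mul_self_sqrt (by norm_num)]; norm_num
  simp only [circuitState, hadamardGate, ancillaPhase, controlled, add_zero, sub_zero, map_smul]
  rw [smul_comm w, ← smul_add, smul_smul, h2]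

lemma circuitState_snd (H : E →L[ℂ] E) (ψ : E) (w : ℂ) (t : ℝ) :
    (circuitState H ψ w t).2 = (1 / 2 : ℂ) • (ψ - w • evolution H t ψ) := by
  have h2 : ((((Real.sqrt 2)⁻¹ : ℝ) : ℂ)) * ((((Real.sqrt 2)⁻¹ : ℝ) : ℂ)) = 1 / 2 := by
    rw [← Complex.ofReal_mul, ← mul_inv, Real.mul_self_sqrt (by norm_num)]; norm_num
  simp only [circuitState, hadamardGate, ancillaPhase, controlled, add_zero, sub_zero, map_smul]
  rw [smul_comm w, ← smul_sub, smul_smul, h2]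

lemma IsEigensystem.circuit_prob_add (h : IsEigensystem H v lam) {ψ : E} (hψ : ‖ψ‖ = 1) {w : ℂ}
    (hw : ‖w‖ = 1) (t : ℝ) :
    ‖(circuitState H ψ w t).1‖ ^ 2 + ‖(circuitState H ψ w t).2‖ ^ 2 = 1 := by
  rw [circuitState_fst, circuitState_snd, norm_smul, norm_smul]
  have := parallelogram_law_with_norm ℂ ψ (w • evolution H t ψ)
  rw [norm_smul, hw, h.norm_evolution, hψ] at this
  norm_num
  nlinarith

lemma circuit_prob_sub (H : E →L[ℂ] E) (ψ : E) (w : ℂ) (t : ℝ) :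
    ‖(circuitState H ψ w t).1‖ ^ 2 - ‖(circuitState H ψ w t).2‖ ^ 2
      = (w * inner ℂ ψ (evolution H t ψ)).re := by
  rw [circuitState_fst, circuitState_snd, norm_smul, norm_smul, mul_pow, mul_pow,
    @norm_add_sq ℂ, @norm_sub_sq ℂ, inner_smul_right]
  norm_num
  ring

lemma IsEigensystem.isProbabilityMeasure_circuitLaw (h : IsEigensystem H v lam) {ψ : E}
    (hψ : ‖ψ‖ = 1) {w : ℂ} (hw : ‖w‖ = 1) (t : ℝ) :
    IsProbabilityMeasure (circuitLaw H ψ w t) := by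
  constructor
  simp only [circuitLaw, Measure.coe_add, Measure.coe_smul, Pi.add_apply, Pi.smul_apply,
    measure_univ, smul_eq_mul, mul_one]
  rw [← ENNReal.ofReal_add (by positivity) (by positivity), h.circuit_prob_add hψ hw,
    ENNReal.ofReal_one]

lemma integral_circuitLaw (H : E →L[ℂ] E) (ψ : E) (w : ℂ) (t : ℝ) (f : Fin 2 → ℂ) :
    ∫ o, f o ∂(circuitLaw H ψ w t)
      = ((‖(circuitState H ψ w t).1‖ ^ 2 : ℝ) : ℂ) * f 0
        + ((‖(circuitState H ψ w t).2‖ ^ 2 : ℝ) : ℂ) * f 1 := by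
  rw [circuitLaw, integral_add_measure, integral_smul_measure, integral_smul_measure,
    integral_dirac, integral_dirac, ENNReal.toReal_ofReal (by positivity),
    ENNReal.toReal_ofReal (by positivity)]
  · simp
  · exact Integrable.smul_measure Integrable.of_finite ENNReal.ofReal_ne_top
  · exact Integrable.smul_measure Integrable.of_finite ENNReal.ofReal_ne_top

/-- For `w = 1` this is the real part of `⟨ψ, exp(-itH) ψ⟩`, and for `w = -i` its imaginary part,
since `Re(-iz) = Im z`. -/
lemma integral_outcomeSign (H : E →L[ℂ] E) (ψ : E) (w : ℂ) (t : ℝ) :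
    ∫ o, (outcomeSign o : ℂ) ∂(circuitLaw H ψ w t)
      = ((w * inner ℂ ψ (evolution H t ψ)).re : ℂ) := by
  rw [integral_circuitLaw, ← circuit_prob_sub]
  simp [outcomeSign]
  ring

/-! ### The filtered data -/

variable {d : ℕ} {F : Freq d → ℂ}

lemma filterNorm_nonneg (F : Freq d → ℂ) : 0 ≤ filterNorm F :=
  Finset.sum_nonneg fun _ _ => norm_nonneg _

lemma norm_filterEval_le (F : Freq d → ℂ) (x : ℝ) : ‖filterEval F x‖ ≤ filterNorm F := by
  refine norm_sum_le_of_le _ fun l _ => ?_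
  have : Complex.exp (-(Complex.I * ((l : ℤ) : ℂ) * (x : ℂ))) = phase (-((l : ℤ) * x)) := by
    rw [phase]; push_cast; ring_nf
  rw [this, norm_mul, norm_phase, mul_one]

lemma IsEigensystem.isProbabilityMeasure_sampleLaw (h : IsEigensystem H v lam) {ψ : E}
    (hψ : ‖ψ‖ = 1) (hF : 0 < filterNorm F) (t : ℝ) :
    IsProbabilityMeasure (sampleLaw H ψ F t) := by
  constructor
  rw [sampleLaw, Measure.finsetSum_apply]
  have : ∀ l : Freq d, (ENNReal.ofReal (‖F l‖ / filterNorm F) •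
    (Measure.dirac l).prod
      ((circuitLaw H ψ 1 (((l : ℤ) : ℝ) + t)).prod
        (circuitLaw H ψ (-Complex.I) (((l : ℤ) : ℝ) + t)))) Set.univ
      = ENNReal.ofReal (‖F l‖ / filterNorm F) := by
    intro l
    have := h.isProbabilityMeasure_circuitLaw hψ (w := 1) (by simp) (((l : ℤ) : ℝ) + t)
    have := h.isProbabilityMeasure_circuitLaw hψ (w := -Complex.I) (by simp) (((l : ℤ) : ℝ) + t)
    rw [Measure.smul_apply, measure_univ, smul_eq_mul, mul_one]
  rw [Finset.sum_congr rfl fun l _ => this l, ← ENNReal.ofReal_sum_of_nonneg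
    (fun l _ => by positivity), ← Finset.sum_div]
  change ENNReal.ofReal (filterNorm F / filterNorm F) = 1
  rw [div_self hF.ne', ENNReal.ofReal_one]

lemma norm_sampleValue_le (F : Freq d → ℂ) (s : Sample d) :
    ‖sampleValue F s‖ ≤ 2 * filterNorm F := by
  have hs : ∀ o, ‖(outcomeSign o : ℂ)‖ = 1 := by
    intro o; unfold outcomeSign; split_ifs <;> simp
  have h1 : ‖(outcomeSign s.2.1 : ℂ) + Complex.I * (outcomeSign s.2.2 : ℂ)‖ ≤ 2 := by
    refine (norm_add_le _ _).trans ?_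
    rw [norm_mul, hs, hs]; norm_num
  have h2 : ‖Complex.exp (Complex.I * ((F s.1).arg : ℂ))‖ = 1 := by
    rw [mul_comm]; exact Complex.norm_exp_ofReal_mul_I _
  rw [sampleValue, norm_mul, norm_mul, h2, mul_one, Complex.norm_real, Real.norm_eq_abs,
    abs_of_nonneg (filterNorm_nonneg F)]
  exact mul_le_mul_of_nonneg_right h1 (filterNorm_nonneg F)

/-- The factor `∑ |F̂|` cancels the normalization of the sampling weights, and `|F̂_l| exp(i φ_l) =
F̂_l`. The mean is therefore `∑_l F̂_l ⟨ψ, exp(-i(l + t)H) ψ⟩`, which is expanded in eigenvectors.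
-/
lemma IsEigensystem.integral_sampleValue (h : IsEigensystem H v lam) {ψ : E} (hψ : ‖ψ‖ = 1)
    (hF : 0 < filterNorm F) (t : ℝ) :
    ∫ s, sampleValue F s ∂(sampleLaw H ψ F t)
      = ∑ m, (overlap v ψ m : ℂ) * filterEval F (lam m) * phase (-(t * lam m)) := by
  have hprob1 : ∀ l : Freq d, IsProbabilityMeasure (circuitLaw H ψ 1 (((l : ℤ) : ℝ) + t)) :=
    fun l => h.isProbabilityMeasure_circuitLaw hψ (w := 1) (by simp) _
  have hprob2 : ∀ l : Freq d,
      IsProbabilityMeasure (circuitLaw H ψ (-Complex.I) (((l : ℤ) : ℝ) + t)) :=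
    fun l => h.isProbabilityMeasure_circuitLaw hψ (w := -Complex.I) (by simp) _
  have hone : ∀ l : Freq d, ∫ s, sampleValue F s ∂((Measure.dirac l).prod
      ((circuitLaw H ψ 1 (((l : ℤ) : ℝ) + t)).prod
        (circuitLaw H ψ (-Complex.I) (((l : ℤ) : ℝ) + t))))
      = inner ℂ ψ (evolution H (((l : ℤ) : ℝ) + t) ψ)
        * Complex.exp (Complex.I * ((F l).arg : ℂ)) * (filterNorm F : ℂ) := by
    intro l
    have := hprob1 l
    have := hprob2 l
    rw [integral_prod _ Integrable.of_finite, integral_dirac, integral_prod _ Integrable.of_finite]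
    simp only [sampleValue, integral_mul_const]
    congr 2
    have hin : ∀ x : Fin 2, ∫ y, ((outcomeSign x : ℂ) + Complex.I * (outcomeSign y : ℂ))
        ∂(circuitLaw H ψ (-Complex.I) (((l : ℤ) : ℝ) + t))
        = (outcomeSign x : ℂ) + Complex.I *
          ((-Complex.I * inner ℂ ψ (evolution H (((l : ℤ) : ℝ) + t) ψ)).re : ℂ) := by
      intro x
      rw [integral_add Integrable.of_finite Integrable.of_finite, integral_const_mul,
        integral_outcomeSign]
      simp
    simp only [hin]
    rw [integral_add Integrable.of_finite Integrable.of_finite, integral_outcomeSign]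
    apply Complex.ext <;> simp
  have hfour : ∀ x : ℝ, filterEval F x = ∑ l : Freq d, F l * phase (-(((l : ℤ) : ℝ) * x)) := by
    intro x
    refine Finset.sum_congr rfl fun l _ => ?_
    rw [phase]; push_cast; ring_nf
  rw [sampleLaw, integral_finsetSum_measure]
  · simp only [integral_smul_measure, hone]
    have hterm : ∀ l : Freq d, (ENNReal.ofReal (‖F l‖ / filterNorm F)).toReal •
        (inner ℂ ψ (evolution H (((l : ℤ) : ℝ) + t) ψ)
          * Complex.exp (Complex.I * ((F l).arg : ℂ)) * (filterNorm F : ℂ))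
        = ∑ m, (overlap v ψ m : ℂ) * (F l * phase (-(((l : ℤ) : ℝ) * lam m)))
          * phase (-(t * lam m)) := by
      intro l
      have hne : (filterNorm F : ℂ) ≠ 0 := by exact_mod_cast hF.ne'
      rw [ENNReal.toReal_ofReal (by positivity), h.inner_self_evolution, Complex.real_smul]
      have e : ((‖F l‖ / filterNorm F : ℝ) : ℂ) *
          ((∑ m, (overlap v ψ m : ℂ) * phase (-((((l : ℤ) : ℝ) + t) * lam m)))
            * Complex.exp (Complex.I * ((F l).arg : ℂ)) * (filterNorm F : ℂ))
          = (‖F l‖ * Complex.exp (Complex.I * ((F l).arg : ℂ))) *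
            ∑ m, (overlap v ψ m : ℂ) * phase (-((((l : ℤ) : ℝ) + t) * lam m)) := by
        push_cast; field_simp
      rw [e, mul_comm Complex.I, Complex.norm_mul_exp_arg_mul_I, Finset.mul_sum]
      refine Finset.sum_congr rfl fun m _ => ?_
      rw [add_mul, neg_add, phase_add]
      ring
    rw [Finset.sum_congr rfl fun l _ => hterm l, Finset.sum_comm]
    refine Finset.sum_congr rfl fun m _ => ?_
    rw [← Finset.sum_mul, ← Finset.mul_sum, hfour]
  · intro l _
    have := hprob1 l
    have := hprob2 l
    exact Integrable.smul_measure Integrable.of_finite ENNReal.ofReal_ne_top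

/-! ### The bias -/

/-- The contribution of the eigenvalues other than `lam 0` to the expected data. -/
def bias (v : OrthonormalBasis (Fin (M + 1)) ℂ E) (lam : Fin (M + 1) → ℝ) (ψ : E)
    (F : Freq d → ℂ) (t : ℝ) : ℂ :=
  ∑ m ∈ Finset.univ.erase 0, (overlap v ψ m : ℂ) * filterEval F (lam m) * phase (-(t * lam m))

/-- If `S` is the total overlap in `I'`, then `p_0 / S ≥ 1 - ρ ≥ 1/2`, so the unwanted overlap in
`I'` is at most `ρ S ≤ 2 ρ p_0`, proportional to `p_0`. Outside `I'` the filter contributes at most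
`q`. -/
lemma norm_bias_le {ψ : E} (hψ : ‖ψ‖ = 1) {I I' : Set ℝ} {q ρ : ℝ} (hq : 0 ≤ q)
    (hlam : ∀ m, lam m ∈ Set.Icc (-Real.pi) Real.pi) (h0 : 0 < overlap v ψ 0)
    (hI : lam 0 ∈ I) (hII' : I ⊆ I') (hF : IsFilter F q I I')
    (hρ : 1 - relOverlap v lam ψ I I' ≤ ρ) (hρ2 : ρ ≤ 1 / 2) (t : ℝ) :
    ‖bias v lam ψ F t‖ ≤ (1 + q) * (2 * ρ * overlap v ψ 0) + q := by
  classical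
  set p := overlap v ψ with hp
  have hp0 : ∀ m, 0 ≤ p m := fun m => overlap_nonneg ψ m
  set S := ∑ k, I'.indicator (fun _ => p k) (lam k) with hS
  have hsplit : S = p 0 + ∑ k ∈ Finset.univ.erase 0, I'.indicator (fun _ => p k) (lam k) := by
    rw [hS, ← Finset.add_sum_erase _ _ (Finset.mem_univ 0), Set.indicator_of_mem (hII' hI)]
  have hrest : 0 ≤ ∑ k ∈ Finset.univ.erase 0, I'.indicator (fun _ => p k) (lam k) :=
    Finset.sum_nonneg fun k _ => Set.indicator_nonneg (fun _ _ => hp0 k) _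
  have hSpos : 0 < S := by linarith
  have hrel : relOverlap v lam ψ I I' = p 0 / S := by
    rw [relOverlap, Set.indicator_of_mem hI]
  have hSle : S - p 0 ≤ 2 * ρ * p 0 := by
    rw [hrel, sub_le_iff_le_add, ← sub_le_iff_le_add', le_div_iff₀ hSpos] at hρ
    nlinarith
  have hterm : ∀ m, ‖(p m : ℂ) * filterEval F (lam m) * phase (-(t * lam m))‖
      ≤ (1 + q) * I'.indicator (fun _ => p m) (lam m) + q * p m := by
    intro m
    rw [norm_mul, norm_mul, norm_phase, mul_one, Complex.norm_real, Real.norm_eq_abs,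
      abs_of_nonneg (hp0 m)]
    by_cases hm : lam m ∈ I'
    · rw [Set.indicator_of_mem hm]
      nlinarith [hF.2.2 (lam m), hp0 m]
    · rw [Set.indicator_of_notMem hm]
      nlinarith [hF.2.1 (lam m) ⟨hlam m, hm⟩, hp0 m]
  calc ‖bias v lam ψ F t‖
      ≤ ∑ m ∈ Finset.univ.erase 0,
          ((1 + q) * I'.indicator (fun _ => p m) (lam m) + q * p m) :=
        norm_sum_le_of_le _ fun m _ => hterm m
    _ = (1 + q) * (S - p 0) + q * ∑ m ∈ Finset.univ.erase 0, p m := by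
        rw [Finset.sum_add_distrib, ← Finset.mul_sum, ← Finset.mul_sum, hsplit]; ring
    _ ≤ (1 + q) * (2 * ρ * p 0) + q * 1 := by
        have : ∑ m ∈ Finset.univ.erase 0, p m ≤ 1 := by
          rw [← sum_overlap (v := v) hψ]
          exact Finset.sum_le_sum_of_subset_of_nonneg (Finset.erase_subset _ _)
            fun m _ _ => hp0 m
        gcongr
    _ = _ := by ring

lemma IsEigensystem.integral_sampleValue_eq_add_bias (h : IsEigensystem H v lam) {ψ : E}
    (hψ : ‖ψ‖ = 1) (hF : 0 < filterNorm F) (t : ℝ) :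
    ∫ s, sampleValue F s ∂(sampleLaw H ψ F t)
      = (overlap v ψ 0 : ℂ) * filterEval F (lam 0) * phase (-(t * lam 0)) + bias v lam ψ F t := by
  rw [h.integral_sampleValue hψ hF]
  exact (Finset.add_sum_erase _
    (fun m => (overlap v ψ m : ℂ) * filterEval F (lam m) * phase (-(t * lam m)))
    (Finset.mem_univ 0)).symm

end Circuit

/-! ### Concentration for sums over a product space -/

section Concentration

variable {ι Ω : Type*} [Fintype ι] [MeasurableSpace Ω] {μ : ι → Measure Ω}
  [∀ i, IsProbabilityMeasure (μ i)]

/-- Hoeffding's inequality, with an upper bound `n` for the number of terms so that the estimate is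
uniform over partial sums. -/
lemma measureReal_le_sum_sub_integral {f : ι → Ω → ℝ} (hf : ∀ i, Measurable (f i)) {B t : ℝ}
    (hB : 0 < B) (hfB : ∀ i x, |f i x| ≤ B) (ht : 0 < t) (s : Finset ι) {n : ℕ} (hs : s.card ≤ n) :
    (Measure.pi μ).real {ω | t ≤ ∑ i ∈ s, (f i (ω i) - ∫ x, f i x ∂(μ i))}
      ≤ Real.exp (-t ^ 2 / (2 * (n * B ^ 2))) := by
  -- For empty `s` the general bound would divide by zero, giving only `exp 0 = 1`, so this case is
  -- separate.
  rcases s.eq_empty_or_nonempty with rfl | hne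
  · have : {ω : ι → Ω | t ≤ ∑ i ∈ (∅ : Finset ι), (f i (ω i) - ∫ x, f i x ∂(μ i))} = ∅ := by
      ext ω; simp [ht]
    rw [this]
    simp [Real.exp_nonneg]
  have hind := ProbabilityTheory.iIndepFun_pi (μ := μ)
    (X := fun i x => f i x - ∫ x, f i x ∂(μ i)) fun i => ((hf i).sub_const _).aemeasurable
  have hsub : ∀ i ∈ s, ProbabilityTheory.HasSubgaussianMGF
      (fun ω : ι → Ω => f i (ω i) - ∫ x, f i x ∂(μ i)) ((‖B - (-B)‖₊ / 2) ^ 2)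
      (Measure.pi μ) := by
    intro i _
    have h1 : ProbabilityTheory.HasSubgaussianMGF (fun x => f i x - ∫ x, f i x ∂(μ i))
        ((‖B - (-B)‖₊ / 2) ^ 2) (μ i) :=
      ProbabilityTheory.hasSubgaussianMGF_of_mem_Icc (hf i).aemeasurable
        (ae_of_all _ fun x => abs_le.1 (hfB i x))
    have hmap : (Measure.pi μ).map (fun ω : ι → Ω => ω i) = μ i :=
      (measurePreserving_eval μ i).map_eq
    refine ProbabilityTheory.HasSubgaussianMGF.of_map (Y := fun ω : ι → Ω => ω i)
      (X := fun x => f i x - ∫ x, f i x ∂(μ i)) (measurable_pi_apply i).aemeasurable ?_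
    rwa [hmap]
  refine (ProbabilityTheory.HasSubgaussianMGF.measure_sum_ge_le_of_iIndepFun hind hsub
    ht.le).trans ?_
  have hc : ((∑ i ∈ s, ((‖B - (-B)‖₊ / 2) ^ 2 : NNReal) : NNReal) : ℝ) = s.card * B ^ 2 := by
    rw [Finset.sum_const, nsmul_eq_mul]
    push_cast
    rw [Real.norm_eq_abs, abs_of_pos (by linarith)]
    ring
  have hcard : (1 : ℝ) ≤ s.card := by exact_mod_cast hne.card_pos
  have hcn : (s.card : ℝ) ≤ n := by exact_mod_cast hs
  rw [Real.exp_le_exp, neg_div, neg_div, neg_le_neg_iff]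
  have e : ∑ i ∈ s, (((‖B - (-B)‖₊ / 2) ^ 2 : NNReal) : ℝ) = s.card * B ^ 2 := by
    rw [← hc]; push_cast; rfl
  push_cast at e ⊢
  rw [e]
  gcongr

/-- A complex number of modulus above `t` has `±Re` or `±Im` at least `t/2`. This accounts for the
factor `4` and for `8 = 2 · 2²`. -/
lemma measureReal_lt_norm_sum_sub_integral {g : ι → Ω → ℂ} (hg : ∀ i, Measurable (g i)) {B t : ℝ}
    (hB : 0 < B) (hgB : ∀ i x, ‖g i x‖ ≤ B) (ht : 0 < t) (s : Finset ι) {n : ℕ}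
    (hs : s.card ≤ n) :
    (Measure.pi μ).real {ω | t < ‖∑ i ∈ s, (g i (ω i) - ∫ x, g i x ∂(μ i))‖}
      ≤ 4 * Real.exp (-t ^ 2 / (8 * (n * B ^ 2))) := by
  have hmass : ∀ i, Integrable (g i) (μ i) := fun i =>
    Integrable.of_bound (hg i).aestronglyMeasurable B (ae_of_all _ (hgB i))
  have hlin : ∀ (L : ℂ →L[ℝ] ℝ), (∀ z, |L z| ≤ ‖z‖) →
      (Measure.pi μ).real {ω | t / 2 ≤ L (∑ i ∈ s, (g i (ω i) - ∫ x, g i x ∂(μ i)))}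
        ≤ Real.exp (-t ^ 2 / (8 * (n * B ^ 2))) := by
    intro L hL
    have h1 := measureReal_le_sum_sub_integral (μ := μ) (f := fun i x => L (g i x))
      (fun i => L.measurable.comp (hg i)) hB (fun i x => (hL _).trans (hgB i x))
      (half_pos ht) s hs
    have e1 : ∀ i, ∫ x, L (g i x) ∂(μ i) = L (∫ x, g i x ∂(μ i)) := fun i =>
      L.integral_comp_comm (hmass i)
    have e2 : -(t / 2) ^ 2 / (2 * (n * B ^ 2)) = -t ^ 2 / (8 * (n * B ^ 2)) := by
      rw [div_pow, ← neg_div, div_div]; congr 1; ring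
    simp only [e1, e2] at h1
    simpa only [map_sum, map_sub] using h1
  have hre : ∀ z, |Complex.reCLM z| ≤ ‖z‖ := fun z => Complex.abs_re_le_norm z
  have him : ∀ z, |Complex.imCLM z| ≤ ‖z‖ := fun z => Complex.abs_im_le_norm z
  have h1 := hlin Complex.reCLM hre
  have h2 := hlin (-Complex.reCLM) (fun z => by simpa using hre z)
  have h3 := hlin Complex.imCLM him
  have h4 := hlin (-Complex.imCLM) (fun z => by simpa using him z)
  set W := fun ω : ι → Ω => ∑ i ∈ s, (g i (ω i) - ∫ x, g i x ∂(μ i)) with hW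
  have hsub : {ω | t < ‖W ω‖} ⊆ (({ω | t / 2 ≤ Complex.reCLM (W ω)}
      ∪ {ω | t / 2 ≤ (-Complex.reCLM) (W ω)}) ∪ ({ω | t / 2 ≤ Complex.imCLM (W ω)}
      ∪ {ω | t / 2 ≤ (-Complex.imCLM) (W ω)})) := by
    intro ω hω
    by_contra hc
    simp only [Set.mem_union, Set.mem_ofPred_eq, not_or, not_le, Complex.reCLM_apply,
      Complex.imCLM_apply, neg_apply] at hc hω
    obtain ⟨⟨c1, c2⟩, c3, c4⟩ := hc
    have := Complex.norm_le_abs_re_add_abs_im (W ω)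
    have a1 : |(W ω).re| < t / 2 := abs_lt.2 ⟨by linarith, c1⟩
    have a2 : |(W ω).im| < t / 2 := abs_lt.2 ⟨by linarith, c3⟩
    linarith
  refine (measureReal_mono hsub).trans ?_
  refine (measureReal_union_le _ _).trans ?_
  have u1 := measureReal_union_le (μ := Measure.pi μ) {ω | t / 2 ≤ Complex.reCLM (W ω)}
      {ω | t / 2 ≤ (-Complex.reCLM) (W ω)}
  have u2 := measureReal_union_le (μ := Measure.pi μ) {ω | t / 2 ≤ Complex.imCLM (W ω)}
      {ω | t / 2 ≤ (-Complex.imCLM) (W ω)}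
  linarith

end Concentration

/-! ### The noise of the data -/

section Noise

variable {E : Type*} [NormedAddCommGroup E] [InnerProductSpace ℂ E]

/-- Deviation of the data at level `i` from its mean, rotated by the frequency `x`. -/
def noise {d J N Ns : ℕ} (H : E →L[ℂ] E) (ψ : E) (F : Freq d → ℂ) (τ : ℕ → ℝ) (x : ℝ)
    (ω : Outcomes d J N Ns) (i : Fin J) (n : ℕ) : ℂ :=
  if h : n < N then (filteredData F ω i ⟨n, h⟩
    - ∫ s, sampleValue F s ∂(sampleLaw H ψ F ((n : ℝ) * τ i))) * phase (n * (x * τ i))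
  else 0

lemma sum_range_dite {N m : ℕ} (hm : m ≤ N) (G : Fin N → ℂ) :
    ∑ n ∈ Finset.range m, (if h : n < N then G ⟨n, h⟩ else 0)
      = ∑ n ∈ Finset.univ.filter (fun n : Fin N => (n : ℕ) < m), G n := by
  have h1 : ∑ n ∈ Finset.range m, (if h : n < N then G ⟨n, h⟩ else 0)
      = ∑ n ∈ Finset.range N, if n < m then (if h : n < N then G ⟨n, h⟩ else 0) else 0 := by
    rw [← Finset.sum_filter]
    refine Finset.sum_congr ?_ fun _ _ => rfl
    ext n; simp; omega
  rw [h1, ← Fin.sum_univ_eq_sum_range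
    (fun n => if n < m then (if h : n < N then G ⟨n, h⟩ else 0) else 0), Finset.sum_filter]
  refine Finset.sum_congr rfl fun n _ => ?_
  simp

variable {M : ℕ} {H : E →L[ℂ] E} {v : OrthonormalBasis (Fin (M + 1)) ℂ E} {lam : Fin (M + 1) → ℝ}
  {d J N Ns : ℕ} {F : Freq d → ℂ}

/-- Exhibits a partial noise sum as a sum of centred independent variables over a block of runs. The
deterministic phases are absorbed into the summands, which is the form needed for concentration. -/
lemma sum_noise_mul_phase (hNs : 0 < Ns) (H : E →L[ℂ] E) (ψ : E) (τ : ℕ → ℝ) (x y : ℝ)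
    (i : Fin J) {m : ℕ} (hm : m ≤ N) (ω : Outcomes d J N Ns) :
    (Ns : ℂ) * ∑ n ∈ Finset.range m, noise H ψ F τ x ω i n * phase (n * y)
      = ∑ a ∈ ({i} : Finset (Fin J)) ×ˢ ((Finset.univ.filter (fun n : Fin N => (n : ℕ) < m)) ×ˢ
          (Finset.univ : Finset (Fin Ns))),
        (sampleValue F (ω a) * phase (((a.2.1 : ℕ) : ℝ) * (x * τ a.1 + y))
          - ∫ s, sampleValue F s * phase (((a.2.1 : ℕ) : ℝ) * (x * τ a.1 + y))
            ∂(sampleLaw H ψ F (((a.2.1 : ℕ) : ℝ) * τ a.1))) := by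
  have hNs' : (Ns : ℂ) ≠ 0 := by exact_mod_cast hNs.ne'
  rw [Finset.sum_product, Finset.sum_singleton, Finset.sum_product]
  set G : Fin N → ℂ := fun n => (filteredData F ω i n
        - ∫ s, sampleValue F s ∂(sampleLaw H ψ F (((n : ℕ) : ℝ) * τ i)))
          * phase (((n : ℕ) : ℝ) * (x * τ i + y)) with hG
  have e1 : ∀ n : ℕ, noise H ψ F τ x ω i n * phase (n * y)
      = if h : n < N then G ⟨n, h⟩ else 0 := by
    intro n
    unfold noise
    split_ifs with h
    · rw [mul_assoc, ← phase_add, ← mul_add]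
    · simp
  rw [Finset.sum_congr rfl fun n _ => e1 n, sum_range_dite hm, Finset.mul_sum]
  refine Finset.sum_congr rfl fun n _ => ?_
  simp only [hG]
  simp only [integral_mul_const]
  rw [Finset.sum_sub_distrib, ← Finset.sum_mul, Finset.sum_const, Finset.card_univ,
    Fintype.card_fin, nsmul_eq_mul, filteredData]
  field_simp

lemma IsEigensystem.isProbabilityMeasure_outcomesLaw (h : IsEigensystem H v lam) {ψ : E}
    (hψ : ‖ψ‖ = 1) (hF : 0 < filterNorm F) (τ : ℕ → ℝ) :
    IsProbabilityMeasure (outcomesLaw H ψ F J N Ns τ) := by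
  have : ∀ t, IsProbabilityMeasure (sampleLaw H ψ F t) :=
    fun t => h.isProbabilityMeasure_sampleLaw hψ hF t
  unfold outcomesLaw
  infer_instance

lemma IsEigensystem.measureReal_noise_le (h : IsEigensystem H v lam) {ψ : E}
    (hψ : ‖ψ‖ = 1) (hF : 0 < filterNorm F) (hN : 0 < N) (hNs : 0 < Ns) (τ : ℕ → ℝ) (x y : ℝ)
    (i : Fin J) {m : ℕ} (hm : m ≤ N) {σ : ℝ} (hσ : 0 < σ) :
    (outcomesLaw H ψ F J N Ns τ).real
      {ω | N * σ < ‖∑ n ∈ Finset.range m, noise H ψ F τ x ω i n * phase (n * y)‖}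
      ≤ 4 * Real.exp (-((N : ℝ) * Ns * σ ^ 2 / (32 * filterNorm F ^ 2))) := by
  have : ∀ t, IsProbabilityMeasure (sampleLaw H ψ F t) :=
    fun t => h.isProbabilityMeasure_sampleLaw hψ hF t
  have hNr : (0 : ℝ) < N := by exact_mod_cast hN
  have hNsr : (0 : ℝ) < Ns := by exact_mod_cast hNs
  have key := measureReal_lt_norm_sum_sub_integral
    (μ := fun a : Fin J × Fin N × Fin Ns => sampleLaw H ψ F (((a.2.1 : ℕ) : ℝ) * τ a.1))
    (g := fun a s => sampleValue F s * phase (((a.2.1 : ℕ) : ℝ) * (x * τ a.1 + y)))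
    (fun a => measurable_of_finite _) (B := 2 * filterNorm F) (t := N * Ns * σ) (by positivity)
    (fun a s => by rw [norm_mul, norm_phase, mul_one]; exact norm_sampleValue_le F s)
    (by positivity)
    (({i} : Finset (Fin J)) ×ˢ ((Finset.univ.filter (fun n : Fin N => (n : ℕ) < m)) ×ˢ
          (Finset.univ : Finset (Fin Ns)))) (n := N * Ns) (by
      rw [Finset.card_product, Finset.card_product, Finset.card_singleton, one_mul,
        Finset.card_univ, Fintype.card_fin]
      exact Nat.mul_le_mul_right _ ((Finset.card_filter_le _ _).trans (by simp)))
  have e : -((N : ℝ) * Ns * σ) ^ 2 / (8 * (((N * Ns : ℕ) : ℝ) * (2 * filterNorm F) ^ 2))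
      = -((N : ℝ) * Ns * σ ^ 2 / (32 * filterNorm F ^ 2)) := by
    push_cast; field_simp; ring
  rw [e] at key
  refine le_trans (le_of_eq ?_) key
  unfold outcomesLaw
  congr 1
  ext ω
  simp only [Set.mem_ofPred_eq]
  rw [← sum_noise_mul_phase hNs H ψ τ x y i hm ω, norm_mul, Complex.norm_natCast]
  have : (N : ℝ) * Ns * σ = Ns * (N * σ) := by ring
  rw [this, mul_lt_mul_iff_right₀ hNsr]

/-- With high probability the noise is small at all levels. -/
lemma IsEigensystem.smallNoise_prob (h : IsEigensystem H v lam) {ψ : E}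
    (hψ : ‖ψ‖ = 1) (hF : 0 < filterNorm F) (hN : 2 ≤ N) (hNs : 0 < Ns) (τ : ℕ → ℝ) (x : ℝ)
    {σ : ℝ} (hσ : 0 < σ) :
    1 - 104 * J * N ^ 2 * Real.exp (-((N : ℝ) * Ns * σ ^ 2 / (32 * filterNorm F ^ 2)))
      ≤ (outcomesLaw H ψ F J N Ns τ).real {ω | ∀ i, SmallNoise N (noise H ψ F τ x ω i) σ} := by
  have := h.isProbabilityMeasure_outcomesLaw (J := J) (N := N) (Ns := Ns) hψ hF τ
  set μ := outcomesLaw H ψ F J N Ns τ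
  set e := Real.exp (-((N : ℝ) * Ns * σ ^ 2 / (32 * filterNorm F ^ 2)))
  set G := {ω : Outcomes d J N Ns | ∀ i, SmallNoise N (noise H ψ F τ x ω i) σ} with hG
  have hsub : Gᶜ ⊆ ⋃ a ∈ (Finset.univ : Finset (Fin J)) ×ˢ (Finset.range (N + 1) ×ˢ
      Finset.Icc (-(6 * N : ℤ)) (6 * N)),
      {ω : Outcomes d J N Ns | N * σ < ‖∑ n ∈ Finset.range a.2.1,
        noise H ψ F τ x ω a.1 n * phase (n * ((a.2.2 : ℝ) / N))‖} := by
    intro ω hω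
    simp only [hG, SmallNoise, Set.mem_compl_iff, Set.mem_ofPred_eq, not_forall, not_le] at hω
    obtain ⟨i, m, hm, k, hk, hlt⟩ := hω
    simp only [Set.mem_iUnion]
    refine ⟨(i, m, k), ?_, hlt⟩
    simp only [Finset.mem_product, Finset.mem_univ, Finset.mem_range, true_and]
    exact ⟨by omega, hk⟩
  have h1 : μ.real Gᶜ ≤ ∑ a ∈ (Finset.univ : Finset (Fin J)) ×ˢ (Finset.range (N + 1) ×ˢ
      Finset.Icc (-(6 * N : ℤ)) (6 * N)), 4 * e := by
    refine (measureReal_mono hsub (measure_ne_top _ _)).trans ((measureReal_biUnion_finset_le _ _).trans ?_)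
    refine Finset.sum_le_sum fun a ha => ?_
    simp only [Finset.mem_product, Finset.mem_range] at ha
    exact h.measureReal_noise_le hψ hF (by omega) hNs τ x _ a.1 (by omega) hσ
  have hcard : (((Finset.univ : Finset (Fin J)) ×ˢ (Finset.range (N + 1) ×ˢ
      Finset.Icc (-(6 * N : ℤ)) (6 * N))).card : ℝ) = J * ((N + 1) * (12 * N + 1)) := by
    have : ((6 * N : ℤ) + 1 - -(6 * N : ℤ)).toNat = 12 * N + 1 := by omega
    rw [Finset.card_product, Finset.card_product, Int.card_Icc, this]
    simp
  rw [Finset.sum_const, nsmul_eq_mul, hcard] at h1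
  have hNr : (2 : ℝ) ≤ N := by exact_mod_cast hN
  -- There are `N + 1` partial sums and `12 N + 1` grid points per level; with the factor `4` per
  -- event, `104 = 4 · 26`.
  have h2 : ((N : ℝ) + 1) * (12 * N + 1) ≤ 26 * N ^ 2 := by nlinarith
  have h3 : (J : ℝ) * ((N + 1) * (12 * N + 1)) * (4 * e) ≤ J * (26 * N ^ 2) * (4 * e) := by
    gcongr
  rw [probReal_compl_eq_one_sub (Set.toFinite _).measurableSet] at h1
  linarith

/-- The success probability of the algorithm. -/
lemma IsEigensystem.success_prob (h : IsEigensystem H v lam) {ψ : E} (hψ : ‖ψ‖ = 1)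
    (hlam : ∀ m, lam m ∈ Set.Icc (-Real.pi) Real.pi) (h0 : 0 < overlap v ψ 0)
    {I I' : Set ℝ} (hI : lam 0 ∈ I) (hII' : I ⊆ I') {q δ ε : ℝ} (hF : IsFilter F q I I')
    (hq0 : 0 ≤ q) (hδ : 0 < δ) (hδ1 : δ ≤ 1)
    (hpr : 2000 * Real.sqrt (1 - relOverlap v lam ψ I I') ≤ δ)
    (hq : q ≤ 1 / 400000 * (overlap v ψ 0 * δ ^ 2)) (hε : 0 < ε)
    (hN : 2 ≤ N) (hNs : 0 < Ns) :
    0 < filterNorm F ∧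
    1 - 104 * (numLevels ε) * N ^ 2 * Real.exp (-((N : ℝ) * Ns *
        (overlap v ψ 0 * δ / 600000) ^ 2 / (32 * filterNorm F ^ 2)))
      ≤ (outcomesLaw H ψ F (numLevels ε) N Ns (timeStep ε δ N)).real
          (successEvent F (timeStep ε δ N) (lam 0) ε) := by
  set p := overlap v ψ 0 with hp
  set τ := timeStep ε δ N with hτ
  have hN0 : 0 < N := by omega
  have hp1 : p ≤ 1 := by
    rw [← sum_overlap (v := v) hψ]
    exact Finset.single_le_sum (fun m _ => overlap_nonneg ψ m) (Finset.mem_univ 0)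
  have hδ2 : δ ^ 2 ≤ 1 := pow_le_one₀ hδ.le hδ1
  have hpd : p * δ ^ 2 ≤ 1 := by nlinarith [sq_nonneg δ]
  have hF0 : 1 - q ≤ ‖filterEval F (lam 0)‖ := by
    have h1 := hF.1 _ hI
    have h2 := norm_sub_norm_le (1 : ℂ) (filterEval F (lam 0))
    rw [norm_one, norm_sub_rev] at h2
    linarith
  have hFn : 0 < filterNorm F := by
    have := norm_filterEval_le F (lam 0)
    linarith
  refine ⟨hFn, ?_⟩
  have := h.isProbabilityMeasure_outcomesLaw (J := numLevels ε) (N := N) (Ns := Ns) hψ hFn τ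
  refine (h.smallNoise_prob hψ hFn hN hNs τ (lam 0) (σ := p * δ / 600000)
    (by positivity)).trans (measureReal_mono ?_)
  intro ω hω r θ hrun
  have hρ : 1 - relOverlap v lam ψ I I' ≤ (δ / 2000) ^ 2 := by
    apply Real.sqrt_le_iff.1 _ |>.2
    linarith
  have hbias : ∀ t, ‖bias v lam ψ F t‖ ≤ p * δ ^ 2 / 200000 := by
    intro t
    have h1 := norm_bias_le hψ hq0 hlam h0 hI hII' hF hρ (by nlinarith) t
    rw [← hp] at h1
    have h2 : (1 + q) * (2 * (δ / 2000) ^ 2 * p) ≤ 2 * (2 * (δ / 2000) ^ 2 * p) := by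
      gcongr; linarith
    -- The budget for the bias: `1/1000000` from the overlaps inside `I'` and `1/400000` from `q`,
    -- together below `1/200000`.
    have e : 2 * (2 * (δ / 2000) ^ 2 * p) = p * δ ^ 2 / 1000000 := by ring
    linarith
  have hpos : ∀ i, 0 < τ i := timeStep_pos hε hδ hN0
  have hmain := hrun.abs_sub_lt (δ := δ) hN hpos (timeStep_succ ε δ N) (by
    have h1 := timeStep_zero_le (N := N) hε hδ
    have hNr : (2 : ℝ) ≤ N := by exact_mod_cast hN
    have : δ / N ≤ 1 / 2 := by rw [div_le_div_iff₀ (by linarith) (by norm_num)]; linarith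
    linarith) (hlam 0) hδ1 (by
    intro i r θ hmin hx
    refine abs_sub_lt_of_minimizer (a := (p : ℂ) * filterEval F (lam 0))
      (b := fun n => bias v lam ψ F ((n : ℝ) * τ i) * phase (n * (lam 0 * τ i)))
      (w := noise H ψ F τ (lam 0) ω i) (σ := p * δ / 600000) (β := p * δ ^ 2 / 200000)
      hN (hpos i) hδ hδ1 h0 ?_ ?_ ?_ le_rfl (hω i) le_rfl hmin hx
    · rw [norm_mul, Complex.norm_real, Real.norm_eq_abs, abs_of_pos h0]
      nlinarith
    · intro n
      simp only [noise, Fin.is_lt, dif_pos, Fin.eta]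
      rw [sub_mul, h.integral_sampleValue_eq_add_bias hψ hFn, add_mul, ← hp]
      have : phase (-(((n : ℕ) : ℝ) * τ i * lam 0)) * phase (((n : ℕ) : ℝ) * (lam 0 * τ i))
          = 1 := by
        rw [← phase_add, ← phase_zero]; congr 1; ring
      linear_combination (p : ℂ) * filterEval F (lam 0) * this
    · intro n _
      rw [norm_mul, norm_phase, mul_one]
      exact hbias _)
  -- At the last level the bound reads `|θ - λ_0| δ / ε < δ`.
  have hlast := hmain (numLevels ε - 1) (by simp [numLevels])
  rw [hτ, mul_timeStep_last hε hN0, mul_div_assoc', div_lt_iff₀ hε, mul_comm δ] at hlast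
  exact lt_of_mul_lt_mul_right hlast hδ.le

end Noise

/-! ### The number of samples -/

/-- `log(e + x)`. -/
def logE (x : ℝ) : ℝ := Real.log (Real.exp 1 + x)

lemma polylog_eq (k : ℕ) (x : ℝ) : polylog k x = logE x ^ k := rfl

lemma one_le_logE {x : ℝ} (hx : 0 ≤ x) : 1 ≤ logE x := by
  unfold logE
  rw [Real.le_log_iff_exp_le (by positivity)]
  linarith

lemma logE_mono {x y : ℝ} (hx : 0 ≤ x) (h : x ≤ y) : logE x ≤ logE y :=
  Real.log_le_log (by positivity) (by linarith)

lemma log_le_logE {x : ℝ} (hx : 0 < x) : Real.log x ≤ logE x :=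
  Real.log_le_log hx (by linarith [Real.exp_pos 1])

lemma logE_mul_le {x y : ℝ} (hx : 0 ≤ x) (hy : 0 ≤ y) : logE (x * y) ≤ logE x + logE y := by
  unfold logE
  rw [← Real.log_mul (by positivity) (by positivity)]
  have h1 : (1 : ℝ) ≤ Real.exp 1 := Real.one_le_exp (by norm_num)
  refine Real.log_le_log (by positivity) ?_
  nlinarith [mul_nonneg hx hy, mul_nonneg (sub_nonneg.2 h1) hx, mul_nonneg (sub_nonneg.2 h1) hy]

lemma logE_pow_le {x : ℝ} (hx : 0 ≤ x) (k : ℕ) : logE (x ^ (k + 1)) ≤ (k + 1) * logE x := by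
  induction k with
  | zero => simp
  | succ k ih =>
    rw [pow_succ]
    have := logE_mul_le (pow_nonneg hx (k + 1)) hx
    push_cast at ih ⊢
    linarith

lemma logE_le_of_le_mul {x y M : ℝ} (hx : 0 ≤ x) (hy : 0 ≤ y) (hM : 0 ≤ M) (h : x ≤ M * y) :
    logE x ≤ 2 * logE M * logE y := by
  have h1 := logE_mono hx h
  have h2 := logE_mul_le hM hy
  have h3 := one_le_logE hM
  have h4 := one_le_logE hy
  nlinarith

lemma logE_le_two_mul {x : ℝ} (hx : 1 ≤ x) : logE x ≤ 2 * x := by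
  have h1 : (1 : ℝ) ≤ Real.exp 1 := Real.one_le_exp (by norm_num)
  unfold logE
  rw [Real.log_le_iff_le_exp (by positivity)]
  have h2 : Real.exp 1 * (x + 1) ≤ Real.exp (2 * x) := by
    have h3 : Real.exp 1 ≤ Real.exp x := Real.exp_le_exp.2 hx
    have h4 := Real.add_one_le_exp x
    rw [two_mul, Real.exp_add]
    exact mul_le_mul h3 h4 (by linarith) (Real.exp_nonneg _)
  nlinarith

lemma logE_le_sqrt {x : ℝ} (hx : 1 ≤ x) : logE x ≤ 4 * Real.sqrt x := by
  have h1 : Real.exp 1 + x ≤ 4 * x := by linarith [Real.exp_one_lt_d9]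
  have h2 : logE x ≤ Real.log (4 * x) := Real.log_le_log (by positivity) h1
  have h3 := Real.log_le_rpow_div (x := 4 * x) (by positivity) (ε := 1 / 2) (by norm_num)
  rw [← Real.sqrt_eq_rpow, Real.sqrt_mul (by norm_num)] at h3
  have h4 : Real.sqrt 4 = 2 := by
    rw [show (4 : ℝ) = 2 ^ 2 by norm_num, Real.sqrt_sq (by norm_num)]
  rw [h4] at h3
  linarith

/-- The polylogarithm in the sample bound does not contain `δ⁻¹`, so powers of `log δ⁻¹` have to be
paid for by `δ^(-ζ)`, using `log y ≤ y^(ζ/4) / (ζ/4)` at `y = 4 δ⁻¹`. -/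
lemma exists_logE_inv_pow_le {ζ : ℝ} (hζ : 0 < ζ) :
    ∃ K > 0, ∀ δ : ℝ, 0 < δ → δ ≤ 1 → logE δ⁻¹ ^ 4 ≤ K * δ ^ (-ζ) := by
  refine ⟨(4 / ζ) ^ 4 * 4 ^ ζ, by positivity, fun δ hδ hδ1 => ?_⟩
  have hinv : 1 ≤ δ⁻¹ := (one_le_inv₀ hδ).2 hδ1
  have h1 : Real.exp 1 + δ⁻¹ ≤ 4 * δ⁻¹ := by linarith [Real.exp_one_lt_d9]
  have h2 : logE δ⁻¹ ≤ Real.log (4 * δ⁻¹) := Real.log_le_log (by positivity) h1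
  have h3 := Real.log_le_rpow_div (x := 4 * δ⁻¹) (by positivity) (ε := ζ / 4) (by positivity)
  have h4 : logE δ⁻¹ ^ 4 ≤ ((4 * δ⁻¹) ^ (ζ / 4) / (ζ / 4)) ^ 4 :=
    pow_le_pow_left₀ (zero_le_one.trans (one_le_logE (by positivity))) (h2.trans h3) 4
  refine h4.trans (le_of_eq ?_)
  rw [div_pow, ← Real.rpow_natCast ((4 * δ⁻¹) ^ (ζ / 4)), ← Real.rpow_mul (by positivity)]
  have e : ζ / 4 * ((4 : ℕ) : ℝ) = ζ := by push_cast; ring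
  rw [e, Real.mul_rpow (by norm_num) (by positivity), Real.inv_rpow hδ.le, Real.rpow_neg hδ.le]
  field_simp

lemma numLevels_le {ε : ℝ} (hε : 0 < ε) (hε2 : ε < 1 / 2) :
    (numLevels ε : ℝ) ≤ 6 * Real.log ε⁻¹ := by
  have hl2 := Real.log_two_gt_d9
  have h1 : Real.log 2 ≤ Real.log ε⁻¹ := by
    apply Real.log_le_log (by norm_num)
    rw [le_inv_comm₀ (by norm_num) hε]; linarith
  have h2 : (⌈Real.logb 2 (1 / ε)⌉₊ : ℝ) < Real.logb 2 (1 / ε) + 1 := by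
    apply Nat.ceil_lt_add_one
    apply Real.logb_nonneg (by norm_num)
    rw [le_div_iff₀ hε]; linarith
  have h3 : Real.logb 2 (1 / ε) ≤ 2 * Real.log ε⁻¹ := by
    rw [Real.logb, one_div, div_le_iff₀ (by linarith)]
    nlinarith
  unfold numLevels
  push_cast
  linarith

lemma sampleBound_pos {k : ℕ} {ζ ε η p δ D : ℝ} (hζ : 0 < ζ) (hζ1 : ζ < 1) (hε : 0 < ε)
    (hε2 : ε < 1 / 2) (hη : 0 < η) (hp : 0 < p) (hδ : 0 < δ) (hD : 0 < D) :
    0 < sampleBound k ζ ε η p δ D := by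
  have h1 : 0 < Real.log ζ⁻¹ := Real.log_pos ((one_lt_inv₀ hζ).2 hζ1)
  have h2 : 0 < Real.log ε⁻¹ := Real.log_pos ((one_lt_inv₀ hε).2 (by linarith))
  have h3 : 1 ≤ logE (Real.log ζ⁻¹ * Real.log ε⁻¹ * D⁻¹ * η⁻¹ * p⁻¹) :=
    one_le_logE (by positivity)
  rw [sampleBound, polylog_eq]
  positivity

/-- The arithmetic core of the sample complexity bound. -/
lemma mul_log_le_of_scale {S X R p δ δζ L ℓ s K G Λ T K₁ K₂ : ℝ} (hS : S = R * X)
    (hp : 0 < p) (hδ : 0 < δ) (hs : 0 < s)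
    (hX : X = (p ^ 2)⁻¹ * (δ ^ 2)⁻¹ * δζ * L ^ 4) (hR : 0 ≤ R)
    (hL : 1 ≤ L) (hℓ : 1 ≤ ℓ) (hK : 0 ≤ K) (hℓK : ℓ ^ 4 ≤ K * δζ)
    (hG0 : 0 ≤ G) (hG : G ≤ K₁ * (L * ℓ)) (hT0 : 0 ≤ K₂)
    (hT : T ≤ K₂ * (Real.sqrt R * (L ^ 2 * ℓ))) (hΛ : Λ = S * (p * δ * s) ^ 2)
    (hC : 32 * K₁ ^ 2 * K₂ * K ≤ s ^ 2 * Real.sqrt R) : 32 * G ^ 2 * T ≤ Λ := by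
  have hr := Real.sqrt_nonneg R
  have hδζ : 0 ≤ K * δζ := (pow_nonneg (by linarith) 4).trans hℓK
  have h1 : G ^ 2 ≤ (K₁ * (L * ℓ)) ^ 2 := pow_le_pow_left₀ hG0 hG 2
  have hT' : 0 ≤ K₂ * (Real.sqrt R * (L ^ 2 * ℓ)) := by positivity
  have h2 : ℓ ^ 3 ≤ ℓ ^ 4 := pow_le_pow_right₀ hℓ (by norm_num)
  have hΛ' : Λ = s ^ 2 * R * δζ * L ^ 4 := by
    rw [hΛ, hS, hX]; field_simp
  have hζ : 0 ≤ δζ := by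
    by_contra hc
    push Not at hc
    have : 1 ≤ ℓ ^ 4 := one_le_pow₀ hℓ
    nlinarith
  -- `G²` and `T` each contribute `L²`, which is why the polylogarithm has exponent `4`. They
  -- contribute `ℓ³` in all, covered by `K δ^(-ζ)`. Since `T` grows like `√R` and `Λ` like `R`, a
  -- large `R` also beats the constants.
  calc 32 * G ^ 2 * T ≤ 32 * G ^ 2 * (K₂ * (Real.sqrt R * (L ^ 2 * ℓ))) := by gcongr
    _ ≤ 32 * (K₁ * (L * ℓ)) ^ 2 * (K₂ * (Real.sqrt R * (L ^ 2 * ℓ))) := by gcongr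
    _ = 32 * K₁ ^ 2 * K₂ * Real.sqrt R * L ^ 4 * ℓ ^ 3 := by ring
    _ ≤ 32 * K₁ ^ 2 * K₂ * Real.sqrt R * L ^ 4 * (K * δζ) := by
        gcongr; exact h2.trans hℓK
    _ = 32 * K₁ ^ 2 * K₂ * K * (Real.sqrt R * L ^ 4 * δζ) := by ring
    _ ≤ s ^ 2 * Real.sqrt R * (Real.sqrt R * L ^ 4 * δζ) := by gcongr
    _ = s ^ 2 * (Real.sqrt R * Real.sqrt R) * δζ * L ^ 4 := by ring
    _ = Λ := by rw [Real.mul_self_sqrt hR, hΛ']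

-- The exponential must beat `Q = 104 J N² / η`, that is, `S (p δ s)² ≥ 32 G² log Q` with `S = N
-- N_s`. As `S` may exceed the required minimum arbitrarily, and `N` is bounded only by `S`, `log Q`
-- grows with `S`. Writing `S = R X` with `X` the sample bound, `log S` costs only `√R`, while the
-- left side gains `R`. The logarithms of `p⁻¹`, `D⁻¹` and `J / η` are multiples of `L`; that of
-- `δ⁻¹` is kept apart as `ℓ`.
set_option maxHeartbeats 800000 in
lemma exists_sample_constant {A ζ s : ℝ} (hA : 1 ≤ A) (hζ : 0 < ζ) (hζ1 : ζ < 1) (hs : 0 < s) :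
    ∃ C > 0, ∀ (D p δ ε η G : ℝ) (d N Ns : ℕ), 0 < D → D ≤ 8 → 0 < p → p ≤ 1 → 0 < δ → δ ≤ 1 →
      0 < ε → ε < 1 / 2 → 0 < η → η < 1 → (d : ℝ) ≤ A * (D⁻¹ * polylog 1 (p⁻¹ * δ⁻¹)) →
      0 < G → G ≤ A * Real.log (Real.exp 1 + d) → 2 ≤ N →
      C * sampleBound 4 ζ ε η p δ D ≤ (N : ℝ) * Ns →
      104 * (numLevels ε) * N ^ 2 *
        Real.exp (-((N : ℝ) * Ns * (p * δ * s) ^ 2 / (32 * G ^ 2))) ≤ η := by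
  obtain ⟨K, hK, hKb⟩ := exists_logE_inv_pow_le hζ
  have hz : 0 < Real.log ζ⁻¹ := Real.log_pos ((one_lt_inv₀ hζ).2 hζ1)
  set z := Real.log ζ⁻¹
  -- The factor `z = log ζ⁻¹` inside the polylogarithm may be small, and `1/z` undoes it; `100`
  -- outweighs `log ε⁻¹ ≥ 1/2`, `D⁻¹ ≥ 1/8` and `J ≤ 6 log ε⁻¹`.
  set m := 100 / z with hm
  have hm0 : 0 < m := by positivity
  set κ := 2 * logE m with hκ
  have hκ2 : 2 ≤ κ := by have := one_le_logE hm0.le; linarith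
  set K₁ := A * (logE A + 3 * κ + 2) with hK₁
  have hlA : 1 ≤ logE A := one_le_logE (by linarith)
  have hl104 : 1 ≤ logE 104 := one_le_logE (by norm_num)
  set K₂ := (logE 104 + κ + 2) * (5 * (2 * κ + 11)) with hK₂
  have hK₂0 : 0 < K₂ := by positivity
  -- The square makes `√R ≥ 32 K₁² K₂ K / s²` follow from `R ≥ C`; the summand `1` ensures `R ≥ 1`.
  refine ⟨1 + (32 * K₁ ^ 2 * K₂ * K / s ^ 2) ^ 2, by positivity, ?_⟩
  intro D p δ ε η G d N Ns hD hD8 hp hp1 hδ hδ1 hε hε2 hη hη1 hd hG0 hG hN hS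
  have hl2 := Real.log_two_gt_d9
  have hle : 1 / 2 ≤ Real.log ε⁻¹ := by
    have : Real.log 2 ≤ Real.log ε⁻¹ := by
      apply Real.log_le_log (by norm_num)
      rw [le_inv_comm₀ (by norm_num) hε]; linarith
    linarith
  have hDi : 1 / 8 ≤ D⁻¹ := by rw [one_div]; exact inv_anti₀ hD hD8
  have hηi : 1 ≤ η⁻¹ := (one_le_inv₀ hη).2 hη1.le
  have hpi : 1 ≤ p⁻¹ := (one_le_inv₀ hp).2 hp1
  have hδi : 1 ≤ δ⁻¹ := (one_le_inv₀ hδ).2 hδ1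
  set a := z * Real.log ε⁻¹ * D⁻¹ * η⁻¹ * p⁻¹ with ha
  have ha0 : 0 < a := by
    have : 0 < Real.log ε⁻¹ := by linarith
    positivity
  have hma : m * a = 100 * (Real.log ε⁻¹ * D⁻¹ * η⁻¹ * p⁻¹) := by
    rw [hm, ha]; field_simp
  have hp_le : p⁻¹ ≤ m * a := by
    rw [hma]
    have : 1 / 2 * (1 / 8) * 1 * p⁻¹ ≤ Real.log ε⁻¹ * D⁻¹ * η⁻¹ * p⁻¹ := by gcongr
    linarith
  have hD_le : D⁻¹ ≤ m * a := by
    rw [hma]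
    have : 1 / 2 * D⁻¹ * 1 * 1 ≤ Real.log ε⁻¹ * D⁻¹ * η⁻¹ * p⁻¹ := by gcongr
    linarith
  have hJ := numLevels_le hε hε2
  have hJ_le : numLevels ε * η⁻¹ ≤ m * a := by
    rw [hma]
    have h1 : Real.log ε⁻¹ * (1 / 8) * η⁻¹ * 1 ≤ Real.log ε⁻¹ * D⁻¹ * η⁻¹ * p⁻¹ := by gcongr
    have h2 : numLevels ε * η⁻¹ ≤ 6 * Real.log ε⁻¹ * η⁻¹ := by gcongr
    have h3 : 0 ≤ Real.log ε⁻¹ * η⁻¹ := by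
      have : 0 ≤ Real.log ε⁻¹ := by linarith
      positivity
    linarith
  set L := logE a with hL
  set ℓ := logE δ⁻¹ with hℓ
  have hL1 : 1 ≤ L := one_le_logE ha0.le
  have hℓ1 : 1 ≤ ℓ := one_le_logE (by positivity)
  have lp : logE p⁻¹ ≤ κ * L := logE_le_of_le_mul (by positivity) ha0.le hm0.le hp_le
  have lD : logE D⁻¹ ≤ κ * L := logE_le_of_le_mul (by positivity) ha0.le hm0.le hD_le
  have lJ : logE (numLevels ε * η⁻¹) ≤ κ * L :=
    logE_le_of_le_mul (by positivity) ha0.le hm0.le hJ_le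
  have hLℓ : L ≤ L * ℓ := le_mul_of_one_le_right (by linarith) hℓ1
  have hℓL : ℓ ≤ L * ℓ := le_mul_of_one_le_left (by linarith) hL1
  have hLℓ1 : 1 ≤ L * ℓ := hL1.trans hLℓ
  have hκL : κ * L ≤ κ * (L * ℓ) := mul_le_mul_of_nonneg_left hLℓ (by linarith)
  -- the filter norm
  have hGb : G ≤ K₁ * (L * ℓ) := by
    have h1 : 1 ≤ logE (p⁻¹ * δ⁻¹) := one_le_logE (by positivity)
    have h2 : logE (p⁻¹ * δ⁻¹) ≤ κ * L + ℓ :=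
      (logE_mul_le (by positivity) (by positivity)).trans (by linarith)
    have h3 : logE d ≤ logE A + (logE D⁻¹ + logE (logE (p⁻¹ * δ⁻¹))) := by
      rw [polylog_eq, pow_one] at hd
      refine (logE_mono (by positivity) hd).trans
        ((logE_mul_le (by positivity) (by positivity)).trans ?_)
      gcongr
      exact logE_mul_le (by positivity) (by linarith)
    have h4 := logE_le_two_mul h1
    have h7 : logE A ≤ logE A * (L * ℓ) := le_mul_of_one_le_right (by linarith) hLℓ1
    have h5 : logE d ≤ (logE A + 3 * κ + 2) * (L * ℓ) := by linarith
    have h6 : G ≤ A * logE d := hG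
    calc G ≤ A * logE d := h6
      _ ≤ A * ((logE A + 3 * κ + 2) * (L * ℓ)) := by gcongr
      _ = _ := by rw [hK₁]; ring
  -- the scale of the number of samples
  set X := sampleBound 4 ζ ε η p δ D with hXdef
  have hδpow : δ ^ (-(2 + ζ)) = (δ ^ 2)⁻¹ * δ ^ (-ζ) := by
    rw [neg_add, Real.rpow_add hδ, Real.rpow_neg hδ.le 2]
    norm_cast
  have hX : X = (p ^ 2)⁻¹ * (δ ^ 2)⁻¹ * δ ^ (-ζ) * L ^ 4 := by
    rw [hXdef, sampleBound, hδpow, polylog_eq]; ring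
  have hδζ0 : 0 < δ ^ (-ζ) := Real.rpow_pos_of_pos hδ _
  have hX0 : 0 < X := by rw [hX]; positivity
  have hδζ1 : δ ^ (-ζ) ≤ δ⁻¹ := by
    rw [← Real.rpow_neg_one]
    exact Real.rpow_le_rpow_of_exponent_ge hδ hδ1 (by linarith)
  -- With `δ^(-ζ) ≤ δ⁻¹`, the factors `p⁻²`, `δ⁻³` and `L⁴` contribute `2κ`, `3` and `4 · 2`.
  have hlX : logE X ≤ (2 * κ + 11) * (L * ℓ) := by
    have h1 : X ≤ (p⁻¹) ^ (1 + 1) * ((δ⁻¹) ^ (2 + 1) * L ^ (3 + 1)) := by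
      rw [hX]
      have : (p ^ 2)⁻¹ * (δ ^ 2)⁻¹ * δ ^ (-ζ) * L ^ 4 ≤ (p ^ 2)⁻¹ * (δ ^ 2)⁻¹ * δ⁻¹ * L ^ 4 := by
        gcongr
      refine this.trans (le_of_eq ?_)
      simp only [inv_pow]; field_simp; ring
    have h2 := logE_mono hX0.le h1
    have h3 := logE_mul_le (x := (p⁻¹) ^ (1 + 1)) (y := (δ⁻¹) ^ (2 + 1) * L ^ (3 + 1))
      (by positivity) (by positivity)
    have h4 := logE_mul_le (x := (δ⁻¹) ^ (2 + 1)) (y := L ^ (3 + 1)) (by positivity)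
      (by positivity)
    have h5 := logE_pow_le (x := p⁻¹) (by positivity) 1
    have h6 := logE_pow_le (x := δ⁻¹) (by positivity) 2
    have h7 := logE_pow_le (x := L) (by positivity) 3
    have h8 := logE_le_two_mul hL1
    push_cast at h5 h6 h7
    linarith
  set S := (N : ℝ) * Ns with hSdef
  set C := 1 + (32 * K₁ ^ 2 * K₂ * K / s ^ 2) ^ 2 with hC
  have hC1 : 1 ≤ C := by rw [hC]; linarith [sq_nonneg (32 * K₁ ^ 2 * K₂ * K / s ^ 2)]
  have hS0 : 0 < S := (mul_pos (by linarith) hX0).trans_le hS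
  have hNs : 0 < Ns := by
    rcases Nat.eq_zero_or_pos Ns with h | h
    · rw [hSdef, h] at hS0; simp at hS0
    · exact h
  set R := S / X with hR
  have hSR : S = R * X := by rw [hR]; field_simp
  have hRC : C ≤ R := by rw [hR, le_div_iff₀ hX0]; exact hS
  have hR1 : 1 ≤ R := hC1.trans hRC
  have hsq1 : 1 ≤ Real.sqrt R := Real.one_le_sqrt.2 hR1
  have hlS : logE S ≤ 5 * (2 * κ + 11) * (Real.sqrt R * (L * ℓ)) := by
    have h1 : logE S ≤ logE R + logE X := by
      rw [hSR]; exact logE_mul_le (by positivity) hX0.le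
    have h2 := logE_le_sqrt hR1
    have h3 : Real.sqrt R ≤ (2 * κ + 11) * (Real.sqrt R * (L * ℓ)) := by
      have : 1 * (Real.sqrt R * 1) ≤ (2 * κ + 11) * (Real.sqrt R * (L * ℓ)) := by
        gcongr; linarith
      linarith
    have h4 : (2 * κ + 11) * (1 * (L * ℓ)) ≤ (2 * κ + 11) * (Real.sqrt R * (L * ℓ)) := by
      gcongr
    linarith
  have hNr : (2 : ℝ) ≤ N := by exact_mod_cast hN
  have hNsr : (1 : ℝ) ≤ Ns := by exact_mod_cast hNs
  have hNS : (N : ℝ) ≤ S := by rw [hSdef]; exact le_mul_of_one_le_right (by linarith) hNsr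
  have hJpos : (0 : ℝ) < numLevels ε := by simp [numLevels]; positivity
  set Q := 104 * (numLevels ε : ℝ) * N ^ 2 * η⁻¹ with hQ
  have hQ0 : 0 < Q := by positivity
  have hT : Real.log Q ≤ K₂ * (Real.sqrt R * (L ^ 2 * ℓ)) := by
    have h1 : Q ≤ 104 * ((numLevels ε * η⁻¹) * S ^ (1 + 1)) := by
      have : (N : ℝ) ^ 2 ≤ S ^ 2 := by gcongr
      calc Q = 104 * ((numLevels ε * η⁻¹) * N ^ 2) := by rw [hQ]; ring
        _ ≤ _ := by gcongr
    have h2 := (log_le_logE hQ0).trans (logE_mono hQ0.le h1)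
    have h3 := logE_mul_le (x := 104) (y := (numLevels ε * η⁻¹) * S ^ (1 + 1)) (by norm_num)
      (by positivity)
    have h4 := logE_mul_le (x := numLevels ε * η⁻¹) (y := S ^ (1 + 1)) (by positivity)
      (by positivity)
    have h5 := logE_pow_le hS0.le 1
    push_cast at h5
    have hlS1 := one_le_logE hS0.le
    have h6 : Real.log Q ≤ (logE 104 + κ + 2) * (L * logE S) := by
      have g2 : L ≤ L * logE S := le_mul_of_one_le_right (by linarith) hlS1
      have g1 : logE 104 ≤ logE 104 * (L * logE S) :=
        le_mul_of_one_le_right (by linarith) (hL1.trans g2)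
      have g3 : logE S ≤ L * logE S := le_mul_of_one_le_left (by linarith) hL1
      have g4 : κ * L ≤ κ * (L * logE S) := mul_le_mul_of_nonneg_left g2 (by linarith)
      linarith
    calc Real.log Q ≤ (logE 104 + κ + 2) * (L * logE S) := h6
      _ ≤ (logE 104 + κ + 2) * (L * (5 * (2 * κ + 11) * (Real.sqrt R * (L * ℓ)))) := by gcongr
      _ = _ := by rw [hK₂]; ring
  have hCR : 32 * K₁ ^ 2 * K₂ * K ≤ s ^ 2 * Real.sqrt R := by
    have h1 : 32 * K₁ ^ 2 * K₂ * K / s ^ 2 ≤ Real.sqrt R := by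
      apply Real.le_sqrt_of_sq_le
      rw [hC] at hRC; linarith
    rwa [div_le_iff₀' (by positivity)] at h1
  have hfin := mul_log_le_of_scale hSR hp hδ hs hX (by linarith) hL1 hℓ1 hK.le (hKb δ hδ hδ1) hG0.le
    hGb hK₂0.le hT rfl hCR
  have hexp : Real.exp (-(S * (p * δ * s) ^ 2 / (32 * G ^ 2))) ≤ Q⁻¹ := by
    rw [← Real.exp_log hQ0, ← Real.exp_neg, Real.exp_le_exp, neg_le_neg_iff,
      le_div_iff₀ (by positivity)]
    linarith
  calc _ ≤ 104 * (numLevels ε) * N ^ 2 * Q⁻¹ := by gcongr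
    _ = η := by rw [hQ]; field_simp

/-! ### Trigonometric polynomials -/

/-- `f` is a trigonometric polynomial of degree at most `d`. -/
def IsTrigPoly (d : ℕ) (f : ℝ → ℂ) : Prop :=
  ∃ c : ℤ → ℂ, ∀ x, f x = ∑ l ∈ Finset.Icc (-(d : ℤ)) d, c l * phase (-((l : ℝ) * x))

lemma isTrigPoly_phase {d : ℕ} {l : ℤ} (hl : l ∈ Finset.Icc (-(d : ℤ)) d) (a : ℂ) :
    IsTrigPoly d fun x => a * phase (-((l : ℝ) * x)) := by
  refine ⟨fun k => if k = l then a else 0, fun x => ?_⟩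
  rw [Finset.sum_eq_single_of_mem l hl]
  · simp
  · intro k _ hk; simp [hk]

lemma IsTrigPoly.sum {ι : Type*} {d : ℕ} {s : Finset ι} {f : ι → ℝ → ℂ}
    (h : ∀ i ∈ s, IsTrigPoly d (f i)) : IsTrigPoly d fun x => ∑ i ∈ s, f i x := by
  classical
  choose! c hc using h
  refine ⟨fun l => ∑ i ∈ s, c i l, fun x => ?_⟩
  simp only [Finset.sum_mul]
  rw [Finset.sum_comm]
  exact Finset.sum_congr rfl fun i hi => hc i hi x

lemma IsTrigPoly.mul {d e : ℕ} {f g : ℝ → ℂ} (hf : IsTrigPoly d f) (hg : IsTrigPoly e g) :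
    IsTrigPoly (d + e) fun x => f x * g x := by
  obtain ⟨b, hb⟩ := hf
  obtain ⟨c, hc⟩ := hg
  have : (fun x => f x * g x) = fun x => ∑ a ∈ Finset.Icc (-(d : ℤ)) d ×ˢ Finset.Icc (-(e : ℤ)) e,
      b a.1 * c a.2 * phase (-(((a.1 + a.2 : ℤ) : ℝ) * x)) := by
    funext x
    rw [hb, hc, Finset.sum_mul_sum, ← Finset.sum_product']
    refine Finset.sum_congr rfl fun a _ => ?_
    have : -(((a.1 + a.2 : ℤ) : ℝ) * x) = -((a.1 : ℝ) * x) + -((a.2 : ℝ) * x) := by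
      push_cast; ring
    rw [this, phase_add]; ring
  rw [this]
  refine IsTrigPoly.sum fun a ha => isTrigPoly_phase ?_ _
  simp only [Finset.mem_product, Finset.mem_Icc] at ha ⊢
  push_cast; omega

lemma IsTrigPoly.pow {d : ℕ} {f : ℝ → ℂ} (hf : IsTrigPoly d f) (r : ℕ) :
    IsTrigPoly (r * d) fun x => f x ^ r := by
  induction r with
  | zero =>
    have := isTrigPoly_phase (d := 0 * d) (l := 0) (by simp) 1
    simpa [phase_zero] using this
  | succ r ih =>
    simp only [pow_succ]
    rw [Nat.succ_mul]
    exact ih.mul hf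

lemma IsTrigPoly.const_mul {d : ℕ} {f : ℝ → ℂ} (hf : IsTrigPoly d f) (a : ℂ) :
    IsTrigPoly d fun x => a * f x := by
  obtain ⟨c, hc⟩ := hf
  refine ⟨fun l => a * c l, fun x => ?_⟩
  simp only [hc, Finset.mul_sum]
  exact Finset.sum_congr rfl fun l _ => by ring

lemma continuous_phase : Continuous phase := by unfold phase; fun_prop

lemma phase_add_two_pi_mul (n : ℤ) (x : ℝ) : phase (n * (x + 2 * Real.pi)) = phase (n * x) := by
  rw [mul_add, phase_add]
  have : phase (n * (2 * Real.pi)) = 1 := by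
    rw [phase, Complex.exp_eq_one_iff]
    exact ⟨n, by push_cast; ring⟩
  rw [this, mul_one]

lemma integral_phase_mul {n : ℤ} (hn : n ≠ 0) (a b : ℝ) :
    ∫ x in a..b, phase (n * x) = (phase (n * b) - phase (n * a)) / (n * Complex.I) := by
  have hc : (n : ℂ) * Complex.I ≠ 0 := by
    simp [hn]
  have := integral_exp_mul_complex (a := a) (b := b) hc
  have e : ∀ x : ℝ, phase (n * x) = Complex.exp ((n : ℂ) * Complex.I * x) := by
    intro x; rw [phase]; push_cast; ring_nf
  simp only [e]
  exact this

lemma norm_integral_phase_mul_le {n : ℤ} (hn : n ≠ 0) (a b : ℝ) :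
    ‖∫ x in a..b, phase (n * x)‖ ≤ 2 / |(n : ℝ)| := by
  rw [integral_phase_mul hn, norm_div]
  have h1 : ‖(n : ℂ) * Complex.I‖ = |(n : ℝ)| := by simp
  have h2 : ‖phase (n * b) - phase (n * a)‖ ≤ 2 := by
    refine (norm_sub_le _ _).trans ?_
    rw [norm_phase, norm_phase]; norm_num
  rw [h1]
  gcongr

lemma integral_phase_period {n : ℤ} (hn : n ≠ 0) :
    ∫ x in (-Real.pi)..Real.pi, phase (n * x) = 0 := by
  have h := phase_add_two_pi_mul n (-Real.pi)
  have e : -Real.pi + 2 * Real.pi = Real.pi := by ring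
  rw [e] at h
  rw [integral_phase_mul hn, h, sub_self, zero_div]

lemma intervalIntegrable_phase (n : ℤ) (c : ℂ) (a b : ℝ) :
    IntervalIntegrable (fun x => c * phase (n * x)) volume a b := by
  apply Continuous.intervalIntegrable
  exact continuous_const.mul (continuous_phase.comp (by fun_prop))

/-- The Fourier coefficients of a trigonometric polynomial are bounded by its `L¹` norm. -/
lemma norm_coeff_le {d : ℕ} {c : ℤ → ℂ} {f : ℝ → ℂ}
    (hf : ∀ x, f x = ∑ l ∈ Finset.Icc (-(d : ℤ)) d, c l * phase (-((l : ℝ) * x)))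
    {k : ℤ} (hk : k ∈ Finset.Icc (-(d : ℤ)) d) :
    2 * Real.pi * ‖c k‖ ≤ ∫ x in (-Real.pi)..Real.pi, ‖f x‖ := by
  have h1 : ∀ x, f x * phase (k * x)
      = ∑ l ∈ Finset.Icc (-(d : ℤ)) d, c l * phase (((k - l : ℤ) : ℝ) * x) := by
    intro x
    rw [hf, Finset.sum_mul]
    refine Finset.sum_congr rfl fun l _ => ?_
    rw [mul_assoc, ← phase_add]; congr 2; push_cast; ring
  have h2 : ∫ x in (-Real.pi)..Real.pi, f x * phase (k * x) = 2 * Real.pi * c k := by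
    simp only [h1]
    rw [intervalIntegral.integral_finsetSum fun l _ => intervalIntegrable_phase _ _ _ _,
      Finset.sum_eq_single_of_mem k hk]
    · rw [sub_self, intervalIntegral.integral_const_mul]
      simp only [Int.cast_zero, zero_mul, phase_zero, intervalIntegral.integral_const]
      rw [Complex.real_smul]; push_cast; ring
    · intro l _ hl
      rw [intervalIntegral.integral_const_mul, integral_phase_period (sub_ne_zero.2 hl.symm),
        mul_zero]
  have h3 : ‖∫ x in (-Real.pi)..Real.pi, f x * phase (k * x)‖
      ≤ ∫ x in (-Real.pi)..Real.pi, ‖f x * phase (k * x)‖ :=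
    intervalIntegral.norm_integral_le_integral_norm (by linarith [Real.pi_pos])
  simp only [norm_mul, norm_phase, mul_one] at h3
  rw [h2, norm_mul, norm_mul] at h3
  simpa [abs_of_pos Real.pi_pos] using h3

/-! ### A localized kernel -/

lemma isTrigPoly_dirichletAvg (m : ℕ) : IsTrigPoly m (dirichletAvg m) := by
  have : dirichletAvg m = fun x => ∑ n ∈ Finset.range m,
      (m : ℂ)⁻¹ * phase (-(((-(n : ℤ) : ℤ) : ℝ) * x)) := by
    funext x
    rw [dirichletAvg, Finset.mul_sum]
    refine Finset.sum_congr rfl fun n _ => ?_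
    congr 2; push_cast; ring
  rw [this]
  refine IsTrigPoly.sum fun n hn => isTrigPoly_phase ?_ _
  rw [Finset.mem_range] at hn
  rw [Finset.mem_Icc]; omega

lemma conj_dirichletAvg (m : ℕ) (x : ℝ) :
    (starRingEnd ℂ) (dirichletAvg m x) = dirichletAvg m (-x) := by
  simp [dirichletAvg, conj_phase]

lemma isTrigPoly_normSq_dirichletAvg (m : ℕ) :
    IsTrigPoly (m + m) fun x => ((‖dirichletAvg m x‖ ^ 2 : ℝ) : ℂ) := by
  have h1 : IsTrigPoly m fun x => dirichletAvg m (-x) := by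
    obtain ⟨c, hc⟩ := isTrigPoly_dirichletAvg m
    have : (fun x => dirichletAvg m (-x)) = fun x => ∑ l ∈ Finset.Icc (-(m : ℤ)) m,
        c l * phase (-(((-l : ℤ) : ℝ) * x)) := by
      funext x
      rw [hc]
      refine Finset.sum_congr rfl fun l _ => ?_
      congr 2; push_cast; ring
    rw [this]
    refine IsTrigPoly.sum fun l hl => isTrigPoly_phase ?_ _
    rw [Finset.mem_Icc] at hl ⊢; omega
  have := (isTrigPoly_dirichletAvg m).mul h1
  convert this using 2 with x
  rw [← conj_dirichletAvg, Complex.mul_conj, Complex.normSq_eq_norm_sq]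

lemma continuous_dirichletAvg (m : ℕ) : Continuous (dirichletAvg m) := by
  unfold dirichletAvg
  refine continuous_const.mul (continuous_finsetSum _ fun n _ => ?_)
  exact continuous_phase.comp (by fun_prop)

lemma dirichletAvg_periodic (m : ℕ) : Function.Periodic (dirichletAvg m) (2 * Real.pi) := by
  intro x
  unfold dirichletAvg
  congr 1
  refine Finset.sum_congr rfl fun n _ => ?_
  have := phase_add_two_pi_mul n x
  simpa using this

/-- By orthogonality only the `m` diagonal terms survive, each equal to `2π / m²`. -/
lemma integral_normSq_dirichletAvg {m : ℕ} (hm : 0 < m) :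
    ∫ x in (-Real.pi)..Real.pi, ‖dirichletAvg m x‖ ^ 2 = 2 * Real.pi / m := by
  have hm' : (m : ℂ) ≠ 0 := by exact_mod_cast hm.ne'
  have h1 : ∀ x, ((‖dirichletAvg m x‖ ^ 2 : ℝ) : ℂ)
      = ∑ j ∈ Finset.range m, ∑ k ∈ Finset.range m,
        ((m : ℂ)⁻¹ * (m : ℂ)⁻¹) * phase (((j - k : ℤ) : ℝ) * x) := by
    intro x
    rw [← Complex.normSq_eq_norm_sq, ← Complex.mul_conj, conj_dirichletAvg, dirichletAvg,
      dirichletAvg, mul_mul_mul_comm, Finset.sum_mul_sum, Finset.mul_sum]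
    refine Finset.sum_congr rfl fun j _ => ?_
    rw [Finset.mul_sum]
    refine Finset.sum_congr rfl fun k _ => ?_
    rw [← phase_add]; congr 2; push_cast; ring
  have h2 : ((∫ x in (-Real.pi)..Real.pi, ‖dirichletAvg m x‖ ^ 2 : ℝ) : ℂ)
      = ((2 * Real.pi / m : ℝ) : ℂ) := by
    rw [← intervalIntegral.integral_ofReal]
    simp only [h1]
    have hmass : ∀ j ∈ Finset.range m, IntervalIntegrable (fun x => ∑ k ∈ Finset.range m,
        ((m : ℂ)⁻¹ * (m : ℂ)⁻¹) * phase (((j - k : ℤ) : ℝ) * x)) volume (-Real.pi) Real.pi := by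
      intro j _
      refine Continuous.intervalIntegrable (continuous_finsetSum _ fun k _ => ?_) _ _
      exact continuous_const.mul (continuous_phase.comp (by fun_prop))
    rw [intervalIntegral.integral_finsetSum hmass]
    have h3 : ∀ j ∈ Finset.range m, ∫ x in (-Real.pi)..Real.pi, ∑ k ∈ Finset.range m,
        ((m : ℂ)⁻¹ * (m : ℂ)⁻¹) * phase (((j - k : ℤ) : ℝ) * x)
        = ((m : ℂ)⁻¹ * (m : ℂ)⁻¹) * (2 * Real.pi) := by
      intro j hj
      rw [intervalIntegral.integral_finsetSum fun l _ => intervalIntegrable_phase _ _ _ _,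
        Finset.sum_eq_single_of_mem j hj]
      · rw [sub_self, intervalIntegral.integral_const_mul]
        simp only [Int.cast_zero, zero_mul, phase_zero, intervalIntegral.integral_const]
        rw [Complex.real_smul]; push_cast; ring
      · intro k _ hk
        rw [intervalIntegral.integral_const_mul, integral_phase_period
          (sub_ne_zero.2 (by exact_mod_cast hk.symm)), mul_zero]
    rw [Finset.sum_congr rfl h3, Finset.sum_const, Finset.card_range, nsmul_eq_mul]
    push_cast
    field_simp
  exact_mod_cast h2

lemma norm_phase_sub_one (x : ℝ) : ‖phase x - 1‖ = 2 * |Real.sin (x / 2)| := by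
  have h := norm_one_add_phase (x + Real.pi)
  have e1 : phase (x + Real.pi) = -phase x := by
    rw [phase_add]
    have : phase Real.pi = -1 := Complex.exp_pi_mul_I
    rw [this, mul_neg_one]
  have e2 : Real.cos ((x + Real.pi) / 2) = -Real.sin (x / 2) := by
    rw [add_div, Real.cos_add_pi_div_two]
  rw [e1, e2, abs_neg, ← sub_eq_add_neg, norm_sub_rev] at h
  exact h

lemma norm_dirichletAvg_mul_sin_le {m : ℕ} (hm : 0 < m) (x : ℝ) :
    m * |Real.sin (x / 2)| * ‖dirichletAvg m x‖ ≤ 1 := by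
  have hm' : (m : ℝ) ≠ 0 := by exact_mod_cast hm.ne'
  have h1 : ∀ m : ℕ, (phase x - 1) * ∑ n ∈ Finset.range m, phase (n * x) = phase (m * x) - 1 := by
    intro m
    induction m with
    | zero => simp [phase_zero]
    | succ m ih =>
      rw [Finset.sum_range_succ, mul_add, ih]
      have : phase ((m + 1 : ℕ) * x) = phase x * phase (m * x) := by
        rw [← phase_add]; congr 1; push_cast; ring
      rw [this]; ring
  have h2 : ‖(phase x - 1) * ∑ n ∈ Finset.range m, phase (n * x)‖ ≤ 2 := by
    rw [h1]
    refine (norm_sub_le _ _).trans ?_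
    rw [norm_phase, norm_one]; norm_num
  have h3 : ‖∑ n ∈ Finset.range m, phase (n * x)‖ = m * ‖dirichletAvg m x‖ := by
    rw [dirichletAvg, norm_mul, norm_inv, Complex.norm_natCast, mul_inv_cancel_left₀ hm']
  rw [norm_mul, norm_phase_sub_one, h3] at h2
  linarith

lemma sin_half_ge {D x : ℝ} (hD : 0 < D) (h1 : D / 2 ≤ x) (h2 : x ≤ 2 * Real.pi - D / 2) :
    D / (2 * Real.pi) ≤ |Real.sin (x / 2)| := by
  have hpi := Real.pi_pos
  have key : ∀ y, D / 4 ≤ y → y ≤ Real.pi / 2 → D / (2 * Real.pi) ≤ Real.sin y := by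
    intro y hy1 hy2
    have := Real.mul_le_sin (x := y) (by linarith) hy2
    refine le_trans ?_ this
    calc D / (2 * Real.pi) = 2 / Real.pi * (D / 4) := by field_simp; norm_num
      _ ≤ 2 / Real.pi * y := by gcongr
  refine le_trans ?_ (le_abs_self _)
  rcases le_total (x / 2) (Real.pi / 2) with h | h
  · exact key _ (by linarith) h
  · rw [← Real.sin_pi_sub]
    exact key _ (by linarith) (by linarith)

/-- The kernel `|m⁻¹ ∑_{n < m} exp(i n x)|^{2 r}`, up to normalization. -/
def rawKernel (m r : ℕ) (x : ℝ) : ℝ := (‖dirichletAvg m x‖ ^ 2) ^ r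

lemma continuous_rawKernel (m r : ℕ) : Continuous (rawKernel m r) :=
  ((continuous_dirichletAvg m).norm.pow 2).pow r

lemma rawKernel_nonneg (m r : ℕ) (x : ℝ) : 0 ≤ rawKernel m r x := by
  unfold rawKernel; positivity

lemma rawKernel_periodic (m r : ℕ) : Function.Periodic (rawKernel m r) (2 * Real.pi) := by
  intro x
  simp only [rawKernel, dirichletAvg_periodic m x]

lemma isTrigPoly_rawKernel (m r : ℕ) :
    IsTrigPoly (r * (m + m)) fun x => ((rawKernel m r x : ℝ) : ℂ) := by
  have := (isTrigPoly_normSq_dirichletAvg m).pow r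
  simpa [rawKernel] using this

/-- For `|x| ≤ 1/(4 m r)` the average has modulus at least `1 - 1/(4r)`, and Bernoulli's inequality
keeps its power `2r` above `1/2`. -/
lemma integral_rawKernel_ge {m r : ℕ} (hm : 0 < m) (hr : 0 < r) :
    1 / (4 * m * r) ≤ ∫ x in (-Real.pi)..Real.pi, rawKernel m r x := by
  have hm' : (1 : ℝ) ≤ m := by exact_mod_cast hm
  have hr' : (1 : ℝ) ≤ r := by exact_mod_cast hr
  set w := 1 / (4 * (m : ℝ) * r) with hw
  have hw0 : 0 < w := by positivity
  have hw1 : w ≤ 1 := by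
    rw [hw, div_le_one (by positivity)]; nlinarith
  have hpi := Real.pi_gt_three
  have h1 : ∀ x ∈ Set.Icc (-w) w, (1 / 2 : ℝ) ≤ rawKernel m r x := by
    intro x hx
    have hx' : |x| ≤ w := abs_le.2 hx
    have h2 := norm_one_sub_dirichletAvg_le hm x
    have h3 := norm_sub_norm_le (1 : ℂ) (dirichletAvg m x)
    rw [norm_one] at h3
    have h4 : (m : ℝ) * |x| ≤ 1 / (4 * r) := by
      calc (m : ℝ) * |x| ≤ m * w := by gcongr
        _ = 1 / (4 * r) := by rw [hw]; field_simp
    have h5 : 1 + -(1 / (4 * (r : ℝ))) ≤ ‖dirichletAvg m x‖ := by linarith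
    have h6 : 1 / (4 * (r : ℝ)) ≤ 1 := by rw [div_le_one (by positivity)]; linarith
    have h7 := one_add_mul_le_pow (a := -(1 / (4 * (r : ℝ)))) (by linarith) (2 * r)
    have h8 : (1 + -(1 / (4 * (r : ℝ)))) ^ (2 * r) ≤ ‖dirichletAvg m x‖ ^ (2 * r) :=
      pow_le_pow_left₀ (by linarith) h5 _
    have e : 1 + ((2 * r : ℕ) : ℝ) * -(1 / (4 * (r : ℝ))) = 1 / 2 := by
      push_cast; field_simp; norm_num
    rw [rawKernel, ← pow_mul]
    linarith
  calc w = ∫ x in (-w)..w, (1 / 2 : ℝ) := by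
        rw [intervalIntegral.integral_const]; simp; ring
    _ ≤ ∫ x in (-w)..w, rawKernel m r x := by
        apply intervalIntegral.integral_mono_on (by linarith) _
          ((continuous_rawKernel m r).intervalIntegrable _ _) h1
        exact intervalIntegrable_const
    _ ≤ ∫ x in (-Real.pi)..Real.pi, rawKernel m r x := by
        apply intervalIntegral.integral_mono_interval (by linarith) (by linarith) (by linarith)
          (ae_of_all _ fun x => rawKernel_nonneg m r x)
          ((continuous_rawKernel m r).intervalIntegrable _ _)

/-- `[D/2, 2π - D/2]` is the part of a period away from the origin. All but one of the squared
factors are bounded pointwise by the geometric sum formula, and the last is integrated exactly. -/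
lemma integral_rawKernel_tail_le {m r : ℕ} (hm : 0 < m) {D : ℝ} (hD : 0 < D)
    (hD2 : D ≤ 2 * Real.pi) :
    ∫ x in (D / 2)..(2 * Real.pi - D / 2), rawKernel m (r + 1) x
      ≤ ((2 * Real.pi / (m * D)) ^ 2) ^ r * (2 * Real.pi / m) := by
  have hm' : (1 : ℝ) ≤ m := by exact_mod_cast hm
  have hpi := Real.pi_pos
  have hcont : Continuous fun x => ‖dirichletAvg m x‖ ^ 2 := (continuous_dirichletAvg m).norm.pow 2
  have h1 : ∀ x ∈ Set.Icc (D / 2) (2 * Real.pi - D / 2), rawKernel m (r + 1) x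
      ≤ ((2 * Real.pi / (m * D)) ^ 2) ^ r * ‖dirichletAvg m x‖ ^ 2 := by
    intro x hx
    have h2 := sin_half_ge hD hx.1 hx.2
    have h3 := norm_dirichletAvg_mul_sin_le hm x
    have h4 : m * (D / (2 * Real.pi)) * ‖dirichletAvg m x‖ ≤ 1 := by
      refine le_trans ?_ h3
      gcongr
    have h5 : ‖dirichletAvg m x‖ ≤ 2 * Real.pi / (m * D) := by
      rw [le_div_iff₀ (by positivity)]
      have e : m * (D / (2 * Real.pi)) * ‖dirichletAvg m x‖
          = ‖dirichletAvg m x‖ * (m * D) / (2 * Real.pi) := by ring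
      rw [e, div_le_one (by positivity)] at h4
      exact h4
    rw [rawKernel, pow_succ]
    gcongr
  have hper : ∫ x in (0 : ℝ)..(2 * Real.pi), ‖dirichletAvg m x‖ ^ 2 = 2 * Real.pi / m := by
    rw [← integral_normSq_dirichletAvg hm]
    have hp : Function.Periodic (fun x => ‖dirichletAvg m x‖ ^ 2) (2 * Real.pi) := by
      intro x; simp only [dirichletAvg_periodic m x]
    have := hp.intervalIntegral_add_eq 0 (-Real.pi)
    have e : -Real.pi + 2 * Real.pi = Real.pi := by ring
    rwa [zero_add, e] at this
  calc _ ≤ ∫ x in (D / 2)..(2 * Real.pi - D / 2),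
        ((2 * Real.pi / (m * D)) ^ 2) ^ r * ‖dirichletAvg m x‖ ^ 2 :=
        intervalIntegral.integral_mono_on (by linarith)
          ((continuous_rawKernel m _).intervalIntegrable _ _)
          ((continuous_const.mul hcont).intervalIntegrable _ _) h1
    _ = ((2 * Real.pi / (m * D)) ^ 2) ^ r
        * ∫ x in (D / 2)..(2 * Real.pi - D / 2), ‖dirichletAvg m x‖ ^ 2 :=
        intervalIntegral.integral_const_mul _ _
    _ ≤ ((2 * Real.pi / (m * D)) ^ 2) ^ r * (2 * Real.pi / m) := by
        rw [← hper]
        gcongr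
        exact intervalIntegral.integral_mono_interval (by linarith) (by linarith) (by linarith)
          (ae_of_all _ fun x => by positivity) (hcont.intervalIntegrable _ _)

/-- There are non-negative trigonometric kernels of degree `O(D⁻¹ log(1/q))` with all but `q` of
their mass within distance `D / 2` of the origin. -/
lemma exists_kernel {D : ℝ} (hD : 0 < D) (hD2 : D ≤ 2 * Real.pi) (r : ℕ) :
    ∃ (e : ℕ) (K : ℝ → ℝ), (e : ℝ) ≤ 50 * (r + 1) / D ∧ Continuous K ∧ (∀ x, 0 ≤ K x) ∧
      Function.Periodic K (2 * Real.pi) ∧ IsTrigPoly e (fun x => (K x : ℂ)) ∧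
      (∫ x in (-Real.pi)..Real.pi, K x = 1) ∧
      ∫ x in (D / 2)..(2 * Real.pi - D / 2), K x ≤ 26 * Real.exp (-r) := by
  have hpi := Real.pi_gt_three
  have hpi' := Real.pi_lt_d2
  -- `18` makes `2π/(m D) ≤ 2π/18 < 1/e`, so each squared factor gains `e⁻²`.
  set m := ⌈18 / D⌉₊ with hm
  have hm1 : 18 / D ≤ m := Nat.le_ceil _
  have hm2 : (m : ℝ) < 18 / D + 1 := Nat.ceil_lt_add_one (by positivity)
  have hm0 : 0 < m := Nat.ceil_pos.2 (by positivity)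
  have hm0' : (0 : ℝ) < m := by exact_mod_cast hm0
  have hc := integral_rawKernel_ge (r := r + 1) hm0 (by omega)
  set c := ∫ x in (-Real.pi)..Real.pi, rawKernel m (r + 1) x with hcdef
  have hc0 : 0 < c := lt_of_lt_of_le (by positivity) hc
  refine ⟨(r + 1) * (m + m), fun x => c⁻¹ * rawKernel m (r + 1) x, ?_, ?_, ?_, ?_, ?_, ?_, ?_⟩
  · push_cast
    have h1 : (m : ℝ) + m ≤ 50 / D := by
      have h2 : 1 ≤ 2 * Real.pi / D := by rw [le_div_iff₀ hD]; linarith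
      have h3 : (m : ℝ) + m ≤ (36 + 4 * Real.pi) / D := by
        have : (36 + 4 * Real.pi) / D = 2 * (18 / D) + 2 * (2 * Real.pi / D) := by ring
        linarith
      refine h3.trans ?_
      gcongr
      linarith
    calc ((r : ℝ) + 1) * (m + m) ≤ (r + 1) * (50 / D) := by gcongr
      _ = 50 * (r + 1) / D := by ring
  · exact continuous_const.mul (continuous_rawKernel _ _)
  · intro x
    exact mul_nonneg (inv_nonneg.2 hc0.le) (rawKernel_nonneg _ _ _)
  · intro x
    simp only [rawKernel_periodic m (r + 1) x]
  · have := (isTrigPoly_rawKernel m (r + 1)).const_mul ((c⁻¹ : ℝ) : ℂ)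
    convert this using 2 with x
    push_cast; rfl
  · rw [intervalIntegral.integral_const_mul, ← hcdef, inv_mul_cancel₀ hc0.ne']
  · rw [intervalIntegral.integral_const_mul]
    have h1 := integral_rawKernel_tail_le (r := r) hm0 hD hD2
    have hci : c⁻¹ ≤ 4 * m * (r + 1) := by
      have := inv_anti₀ (by positivity) hc
      simpa using this
    have h2 : 2 * Real.pi / (m * D) ≤ Real.exp (-1) := by
      rw [Real.exp_neg, ← one_div, div_le_div_iff₀ (by positivity) (Real.exp_pos 1)]
      have h18 : 18 ≤ m * D := by rwa [div_le_iff₀ hD] at hm1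
      have := Real.exp_one_lt_d9
      nlinarith
    have h3 : ((2 * Real.pi / (m * D)) ^ 2) ^ r ≤ Real.exp (-r) * Real.exp (-r) := by
      have h4 : ((2 * Real.pi / (m * D)) ^ 2) ^ r ≤ (Real.exp (-1) ^ 2) ^ r := by gcongr
      have h5 : (Real.exp (-1) ^ 2) ^ r = Real.exp (-r) * Real.exp (-r) := by
        rw [← pow_mul, ← Real.exp_nat_mul, ← Real.exp_add]
        congr 1; push_cast; ring
      linarith
    -- Of the decay `exp(-2r)`, one factor `exp(-r)` pays for the `r + 1` lost in the normalization;
    -- the constant left is `8π < 26`.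
    have h6 : ((r : ℝ) + 1) * Real.exp (-r) ≤ 1 := by
      rw [Real.exp_neg, ← div_eq_mul_inv, div_le_one (Real.exp_pos _)]
      exact Real.add_one_le_exp _
    have htail0 : 0 ≤ ∫ x in (D / 2)..(2 * Real.pi - D / 2), rawKernel m (r + 1) x :=
      intervalIntegral.integral_nonneg (by linarith) fun x _ => rawKernel_nonneg _ _ _
    calc c⁻¹ * ∫ x in (D / 2)..(2 * Real.pi - D / 2), rawKernel m (r + 1) x
        ≤ (4 * m * (r + 1)) * (((2 * Real.pi / (m * D)) ^ 2) ^ r * (2 * Real.pi / m)) := by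
          gcongr
      _ ≤ (4 * m * (r + 1)) * ((Real.exp (-r) * Real.exp (-r)) * (2 * Real.pi / m)) := by
          gcongr
      _ = 8 * Real.pi * (((r : ℝ) + 1) * Real.exp (-r)) * Real.exp (-r) := by
          field_simp; ring
      _ ≤ 8 * Real.pi * 1 * Real.exp (-r) := by gcongr
      _ ≤ 26 * Real.exp (-r) := by
          gcongr; linarith

/-! ### Existence of filters -/

lemma IsTrigPoly.mono {d e : ℕ} {f : ℝ → ℂ} (hf : IsTrigPoly e f) (h : e ≤ d) : IsTrigPoly d f := by
  obtain ⟨c, hc⟩ := hf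
  have : f = fun x => ∑ l ∈ Finset.Icc (-(e : ℤ)) e, c l * phase (-((l : ℝ) * x)) := funext hc
  rw [this]
  refine IsTrigPoly.sum fun l hl => isTrigPoly_phase ?_ _
  rw [Finset.mem_Icc] at hl ⊢; omega

lemma sum_Icc_inv_le (d : ℕ) :
    ∑ l ∈ Finset.Icc (-(d : ℤ)) d, (if l = 0 then (1 : ℝ) else 1 / 3 / |(l : ℝ)|)
      ≤ 3 * logE d := by
  have heven : Function.Even fun l : ℤ => if l = 0 then (1 : ℝ) else 1 / 3 / |(l : ℝ)| := by
    intro l; simp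
  rw [Finset.sum_Icc_of_even_eq_range heven, Finset.sum_range_succ']
  have h1 : ∀ i ∈ Finset.range d, (if ((i + 1 : ℕ) : ℤ) = 0 then (1 : ℝ)
      else 1 / 3 / |(((i + 1 : ℕ) : ℤ) : ℝ)|) = 1 / 3 * ((i + 1 : ℕ) : ℝ)⁻¹ := by
    intro i _
    rw [if_neg (by omega), Int.cast_natCast, Nat.abs_cast, div_eq_mul_inv (1 / 3 : ℝ)]
  rw [Finset.sum_congr rfl h1, ← Finset.mul_sum]
  have h2 := harmonic_le_one_add_log d
  have h3 : ((harmonic d : ℚ) : ℝ) = ∑ i ∈ Finset.range d, ((i + 1 : ℕ) : ℝ)⁻¹ := by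
    simp [harmonic]
  rw [h3] at h2
  have h4 : 1 ≤ logE d := one_le_logE (by positivity)
  have h5 : Real.log d ≤ logE d := by
    rcases Nat.eq_zero_or_pos d with h | h
    · rw [h]; simp; linarith [one_le_logE (le_refl (0 : ℝ))]
    · exact log_le_logE (by exact_mod_cast h)
  have h6 : 0 ≤ ∑ i ∈ Finset.range d, ((i + 1 : ℕ) : ℝ)⁻¹ :=
    Finset.sum_nonneg fun i _ => by positivity
  simp only [Nat.cast_zero, if_true, nsmul_eq_mul]
  push_cast at *
  linarith

section Convolution

variable {K : ℝ → ℝ} {a b D T : ℝ}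

lemma integral_comp_sub_le_one (hK : Continuous K) (hK0 : ∀ x, 0 ≤ K x)
    (hper : Function.Periodic K (2 * Real.pi)) (hmass : ∫ x in (-Real.pi)..Real.pi, K x = 1)
    (hab : a ≤ b) (hba : b - a ≤ 2 * Real.pi) (x : ℝ) :
    0 ≤ ∫ y in a..b, K (x - y) ∧ ∫ y in a..b, K (x - y) ≤ 1 := by
  rw [intervalIntegral.integral_comp_sub_left]
  refine ⟨intervalIntegral.integral_nonneg (by linarith) fun y _ => hK0 y, ?_⟩
  have h1 := hper.intervalIntegral_add_eq (x - b) (-Real.pi)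
  have e : -Real.pi + 2 * Real.pi = Real.pi := by ring
  rw [e, hmass] at h1
  rw [← h1]
  exact intervalIntegral.integral_mono_interval le_rfl (by linarith) (by linarith)
    (ae_of_all _ hK0) (hK.intervalIntegrable _ _)

/-- The part of a full period missed by the window `[x - b, x - a]` runs from `x - a` to `x - b +
2π`, inside the tail interval. -/
lemma one_sub_integral_comp_sub_le (hK : Continuous K) (hK0 : ∀ x, 0 ≤ K x)
    (hper : Function.Periodic K (2 * Real.pi)) (hmass : ∫ x in (-Real.pi)..Real.pi, K x = 1)
    (htail : ∫ x in (D / 2)..(2 * Real.pi - D / 2), K x ≤ T)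
    (hba : b - a ≤ 2 * Real.pi) {x : ℝ} (hxa : a + D / 2 ≤ x) (hxb : x ≤ b - D / 2) :
    1 - T ≤ ∫ y in a..b, K (x - y) := by
  rw [intervalIntegral.integral_comp_sub_left]
  have h1 := hper.intervalIntegral_add_eq (x - b) (-Real.pi)
  have e : -Real.pi + 2 * Real.pi = Real.pi := by ring
  rw [e, hmass] at h1
  have hi : ∀ s t : ℝ, IntervalIntegrable K volume s t := fun s t => hK.intervalIntegrable s t
  have h2 := intervalIntegral.integral_add_adjacent_intervals (hi (x - b) (x - a))
    (hi (x - a) (x - b + 2 * Real.pi))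
  have h3 : ∫ y in (x - a)..(x - b + 2 * Real.pi), K y
      ≤ ∫ y in (D / 2)..(2 * Real.pi - D / 2), K y :=
    intervalIntegral.integral_mono_interval (by linarith) (by linarith) (by linarith)
      (ae_of_all _ hK0) (hi _ _)
  linarith

/-- The window `[x - b, x - a]`, shifted by `2π` if `x` is to the left, lies in the tail interval.
Keeping `a` and `b` at distance `D/2` from `±π` prevents mass from leaking in around the circle. -/
lemma integral_comp_sub_le_tail (hK : Continuous K) (hK0 : ∀ x, 0 ≤ K x)
    (hper : Function.Periodic K (2 * Real.pi))
    (htail : ∫ x in (D / 2)..(2 * Real.pi - D / 2), K x ≤ T) (hab : a ≤ b)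
    (ha : -Real.pi + D / 2 ≤ a) (hb : b ≤ Real.pi - D / 2) {x : ℝ}
    (hx : x ∈ Set.Icc (-Real.pi) Real.pi) (hxab : x ≤ a - D / 2 ∨ b + D / 2 ≤ x) :
    ∫ y in a..b, K (x - y) ≤ T := by
  have hi : ∀ s t : ℝ, IntervalIntegrable K volume s t := fun s t => hK.intervalIntegrable s t
  rw [intervalIntegral.integral_comp_sub_left]
  refine le_trans ?_ htail
  rcases hxab with h | h
  · have h1 : ∫ y in (x - b)..(x - a), K y
        = ∫ y in (x - b + 2 * Real.pi)..(x - a + 2 * Real.pi), K y := by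
      rw [← intervalIntegral.integral_comp_add_right]
      exact intervalIntegral.integral_congr fun y _ => (hper y).symm
    rw [h1]
    exact intervalIntegral.integral_mono_interval (by linarith [hx.1]) (by linarith)
      (by linarith) (ae_of_all _ hK0) (hi _ _)
  · exact intervalIntegral.integral_mono_interval (by linarith) (by linarith)
      (by linarith [hx.2]) (ae_of_all _ hK0) (hi _ _)

end Convolution

/-- Smoothing the indicator of `[a, b]` by a trigonometric kernel. -/
lemma exists_smoothed_indicator {d : ℕ} {K : ℝ → ℝ} (hK0 : ∀ x, 0 ≤ K x)
    (hmass : ∫ x in (-Real.pi)..Real.pi, K x = 1) (htrig : IsTrigPoly d fun x => (K x : ℂ))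
    {a b : ℝ} (hab : a ≤ b) (hba : b - a ≤ 2 * Real.pi) :
    ∃ F : Freq d → ℂ, (∀ x, filterEval F x = ((∫ y in a..b, K (x - y) : ℝ) : ℂ)) ∧
      filterNorm F ≤ 3 * logE d := by
  obtain ⟨c, hc⟩ := htrig
  simp only at hc
  set G : ℤ → ℂ := fun l => c l * ∫ y in a..b, phase (l * y) with hG
  refine ⟨fun l => G l, fun x => ?_, ?_⟩
  · have h1 : filterEval (fun l : Freq d => G l) x
        = ∑ l ∈ Finset.Icc (-(d : ℤ)) d, G l * phase (-((l : ℝ) * x)) := by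
      rw [← Finset.sum_coe_sort]
      refine Finset.sum_congr rfl fun l _ => ?_
      rw [phase]; push_cast; ring_nf
    have h2 : ∀ y, ((K (x - y) : ℝ) : ℂ) = ∑ l ∈ Finset.Icc (-(d : ℤ)) d,
        (c l * phase (-((l : ℝ) * x))) * phase (l * y) := by
      intro y
      rw [hc]
      refine Finset.sum_congr rfl fun l _ => ?_
      rw [mul_assoc, ← phase_add]; congr 2; ring
    rw [h1, ← intervalIntegral.integral_ofReal]
    simp only [h2]
    rw [intervalIntegral.integral_finsetSum fun l _ => intervalIntegrable_phase _ _ _ _]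
    refine Finset.sum_congr rfl fun l _ => ?_
    rw [intervalIntegral.integral_const_mul, hG]
    ring
  · have hpi := Real.pi_gt_three
    have hcb : ∀ l ∈ Finset.Icc (-(d : ℤ)) d, 2 * Real.pi * ‖c l‖ ≤ 1 := by
      intro l hl
      have := norm_coeff_le hc hl
      simp only [Complex.norm_real, Real.norm_eq_abs, abs_of_nonneg (hK0 _)] at this
      rwa [hmass] at this
    have h1 : filterNorm (fun l : Freq d => G l) = ∑ l ∈ Finset.Icc (-(d : ℤ)) d, ‖G l‖ := by
      rw [← Finset.sum_coe_sort]; rfl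
    rw [h1]
    -- The coefficients of `K` are at most `1/(2π) ≤ 1/6`, and integrating the phase over the
    -- interval gives `2/|l|`; the product `1/(3|l|)` has a harmonic sum.
    refine le_trans (Finset.sum_le_sum fun l hl => ?_) (sum_Icc_inv_le d)
    have h2 := hcb l hl
    rw [hG, norm_mul]
    split_ifs with h0
    · have h3 : ‖∫ y in a..b, phase ((l : ℝ) * y)‖ ≤ 2 * Real.pi := by
        have := intervalIntegral.norm_integral_le_of_norm_le_const (a := a) (b := b) (C := 1)
          (f := fun y => phase ((l : ℝ) * y)) fun y _ => (norm_phase _).le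
        rw [abs_of_nonneg (by linarith)] at this
        linarith
      calc ‖c l‖ * ‖∫ y in a..b, phase ((l : ℝ) * y)‖ ≤ ‖c l‖ * (2 * Real.pi) := by gcongr
        _ ≤ 1 := by linarith
    · have h3 := norm_integral_phase_mul_le h0 a b
      have h4 : ‖c l‖ ≤ 1 / 6 := by nlinarith [norm_nonneg (c l)]
      calc ‖c l‖ * ‖∫ y in a..b, phase ((l : ℝ) * y)‖ ≤ 1 / 6 * (2 / |(l : ℝ)|) := by gcongr
        _ = 1 / 3 / |(l : ℝ)| := by ring

lemma gapDist_le {I I' : Set ℝ} {x₁ x₂ : ℝ} (h₁ : x₁ ∉ I') (h₂ : x₂ ∈ I) :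
    gapDist I I' ≤ |x₁ - x₂| := by
  refine csInf_le ⟨0, ?_⟩ ⟨x₁, h₁, x₂, h₂, rfl⟩
  rintro s ⟨x, _, y, _, rfl⟩
  exact abs_nonneg _

/-- Since the complement is taken in `ℝ`, the ends `±π` count as boundary. Otherwise the midpoint of
`-π` and `y - D` (or of `π` and `y + D`) would be outside `I'` and too close to `y`. This gives the
enlarged interval its margin `D/2`. -/
lemma gapDist_le_of_mem {I I' : Set ℝ} (hI' : I' ⊆ Set.Icc (-Real.pi) Real.pi)
    (hII' : I ⊆ I') {y : ℝ} (hy : y ∈ I) :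
    -Real.pi + gapDist I I' ≤ y ∧ y ≤ Real.pi - gapDist I I' := by
  have hy' := hI' (hII' hy)
  constructor
  · by_contra hc
    push Not at hc
    have hx : (y - gapDist I I' + -Real.pi) / 2 ∉ I' := fun h => by linarith [(hI' h).1]
    have := gapDist_le hx hy
    rw [abs_sub_comm, abs_of_nonneg (by linarith [hy'.1])] at this
    linarith
  · by_contra hc
    push Not at hc
    have hx : (y + gapDist I I' + Real.pi) / 2 ∉ I' := fun h => by linarith [(hI' h).2]
    have := gapDist_le hx hy
    rw [abs_of_nonneg (by linarith [hy'.2])] at this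
    linarith

/-- The indicator of `I` enlarged by `D/2` is smoothed by a kernel concentrated within `D/2`. Points
of `I` are `D/2` inside the enlarged interval, points outside `I'` are `D/2` beyond it, so in both
cases the error is the tail of the kernel. -/
lemma exists_isFilter {I I' : Set ℝ} (hI : I.OrdConnected) (hne : I.Nonempty) (hII' : I ⊆ I')
    (hI' : I' ⊆ Set.Icc (-Real.pi) Real.pi) (hD : 0 < gapDist I I') {q : ℝ} {r d : ℕ}
    (hq : 26 * Real.exp (-r) ≤ q) (hd : 50 * (r + 1) / gapDist I I' ≤ d) :
    ∃ F : Freq d → ℂ, IsFilter F q I I' ∧ filterNorm F ≤ 3 * logE d := by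
  obtain ⟨y₀, hy₀⟩ := hne
  set D := gapDist I I' with hDdef
  have hmem : ∀ y ∈ I, -Real.pi + D ≤ y ∧ y ≤ Real.pi - D := fun y hy =>
    gapDist_le_of_mem hI' hII' hy
  have hD2 : D ≤ 2 * Real.pi := by linarith [hmem y₀ hy₀, Real.pi_pos]
  have hbelow : BddBelow I := ⟨_, fun y hy => (hmem y hy).1⟩
  have habove : BddAbove I := ⟨_, fun y hy => (hmem y hy).2⟩
  have hα : -Real.pi + D ≤ sInf I := le_csInf ⟨y₀, hy₀⟩ fun y hy => (hmem y hy).1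
  have hβ : sSup I ≤ Real.pi - D := csSup_le ⟨y₀, hy₀⟩ fun y hy => (hmem y hy).2
  have hαβ : sInf I ≤ sSup I := (csInf_le hbelow hy₀).trans (le_csSup habove hy₀)
  obtain ⟨e, K, he, hK, hK0, hper, htrig, hmass, htail⟩ := exists_kernel hD hD2 r
  have hed : e ≤ d := by exact_mod_cast he.trans hd
  obtain ⟨F, hF, hFn⟩ := exists_smoothed_indicator hK0 hmass (htrig.mono hed)
    (a := sInf I - D / 2) (b := sSup I + D / 2) (by linarith) (by linarith)
  have hrange := integral_comp_sub_le_one hK hK0 hper hmass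
    (a := sInf I - D / 2) (b := sSup I + D / 2) (by linarith) (by linarith)
  have hq0 : 0 ≤ q := le_trans (by positivity) hq
  refine ⟨F, ⟨fun x hx => ?_, fun x hx => ?_, fun x => ?_⟩, hFn⟩
  · have h1 := one_sub_integral_comp_sub_le hK hK0 hper hmass htail
      (a := sInf I - D / 2) (b := sSup I + D / 2) (by linarith) (x := x)
      (by linarith [csInf_le hbelow hx]) (by linarith [le_csSup habove hx])
    rw [hF, ← Complex.ofReal_one, ← Complex.ofReal_sub, Complex.norm_real, Real.norm_eq_abs,
      abs_le]
    constructor <;> linarith [(hrange x).2]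
  · have hside : x ≤ sInf I - D / 2 - D / 2 ∨ sSup I + D / 2 + D / 2 ≤ x := by
      by_cases hall : ∀ y ∈ I, x ≤ y
      · left
        have : x + D ≤ sInf I := le_csInf ⟨y₀, hy₀⟩ fun y hy => by
          have := gapDist_le hx.2 hy
          rw [abs_sub_comm, abs_of_nonneg (by linarith [hall y hy])] at this
          linarith
        linarith
      · right
        push Not at hall
        obtain ⟨z, hz, hzx⟩ := hall
        have : sSup I ≤ x - D := csSup_le ⟨y₀, hy₀⟩ fun y hy => by
          have hyx : y ≤ x := by
            by_contra hc
            push Not at hc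
            exact hx.2 (hII' (hI.out hz hy ⟨hzx.le, hc.le⟩))
          have := gapDist_le hx.2 hy
          rw [abs_of_nonneg (by linarith)] at this
          linarith
        linarith
    have h1 := integral_comp_sub_le_tail hK hK0 hper htail (by linarith) (by linarith)
      (by linarith) hx.1 hside
    rw [hF, Complex.norm_real, Real.norm_eq_abs, abs_of_nonneg (hrange x).1]
    linarith
  · rw [hF, Complex.norm_real, Real.norm_eq_abs, abs_of_nonneg (hrange x).1]
    linarith [(hrange x).2]

/-- Error `q` needs `r` of order `log(1/q)`, and `q ≥ κ' p δ²` makes this `O(log(1/(p δ)))` with a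
constant depending on `κ'`: the exponent of the polylogarithm is `1`. -/
lemma exists_filterSize_constant {κ' : ℝ} (hκ' : 0 < κ') :
    ∃ A₀ ≥ (1 : ℝ), ∀ A ≥ A₀, ∀ (I I' : Set ℝ) (p δ q : ℝ), I.OrdConnected → I.Nonempty → I ⊆ I' →
      I' ⊆ Set.Icc (-Real.pi) Real.pi → 0 < gapDist I I' → 0 < p → p ≤ 1 → 0 < δ → δ ≤ 1 →
      κ' * (p * δ ^ 2) ≤ q → q ≤ 1 →
      ∃ (d : ℕ) (F : Freq d → ℂ), IsFilter F q I I' ∧ FilterSize F A 1 (gapDist I I') p δ := by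
  set A₁ := 50 * (logE (26 / κ') + 4) with hA₁
  have hl : 1 ≤ logE (26 / κ') := one_le_logE (by positivity)
  refine ⟨A₁ + 8, by linarith, ?_⟩
  intro A hA I I' p δ q hI hne hII' hI' hD hp hp1 hδ hδ1 hq hq1
  set D := gapDist I I' with hDdef
  have hD8 : D ≤ 8 := by
    obtain ⟨y, hy⟩ := hne
    have := gapDist_le_of_mem hI' hII' hy
    linarith [Real.pi_lt_d2]
  have hq0 : 0 < q := lt_of_lt_of_le (by positivity) hq
  set ℒ := logE (p⁻¹ * δ⁻¹) with hℒ
  have hℒ1 : 1 ≤ ℒ := one_le_logE (by positivity)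
  set r := ⌈Real.log (26 / q)⌉₊ with hr
  have hr1 : Real.log (26 / q) ≤ r := Nat.le_ceil _
  have hr2 : (r : ℝ) < Real.log (26 / q) + 1 := by
    apply Nat.ceil_lt_add_one
    apply Real.log_nonneg
    rw [le_div_iff₀ hq0]; linarith
  have hlog : Real.log (26 / q) ≤ logE (26 / κ') + 2 * ℒ := by
    have h1 : 26 / q ≤ 26 / κ' * (p⁻¹ * δ⁻¹) ^ (1 + 1) := by
      have h2 : κ' * (p ^ 2 * δ ^ 2) ≤ q := by
        refine le_trans ?_ hq
        have : p ^ 2 ≤ p := by nlinarith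
        gcongr
      calc 26 / q ≤ 26 / (κ' * (p ^ 2 * δ ^ 2)) := by gcongr
        _ = _ := by rw [one_add_one_eq_two, mul_pow, inv_pow, inv_pow]; field_simp
    have h3 := logE_mul_le (x := 26 / κ') (y := (p⁻¹ * δ⁻¹) ^ (1 + 1)) (by positivity)
      (by positivity)
    have h4 := logE_pow_le (x := p⁻¹ * δ⁻¹) (by positivity) 1
    have h5 := (log_le_logE (by positivity)).trans (logE_mono (by positivity) h1)
    push_cast at h4
    linarith
  have hrA : 50 * ((r : ℝ) + 1) ≤ A₁ * ℒ := by
    have : logE (26 / κ') ≤ logE (26 / κ') * ℒ := le_mul_of_one_le_right (by linarith) hℒ1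
    rw [hA₁]
    linarith
  -- The degree is prescribed, padding with zero coefficients, so that the lower bound on `d` holds
  -- too. Rounding up costs at most `1 ≤ 8 D⁻¹ ℒ`, the reason for the `8` in `A₁ + 8`.
  set d := ⌈A₁ * (D⁻¹ * ℒ)⌉₊ with hd
  have hd1 : A₁ * (D⁻¹ * ℒ) ≤ d := Nat.le_ceil _
  have hd2 : (d : ℝ) < A₁ * (D⁻¹ * ℒ) + 1 := Nat.ceil_lt_add_one (by positivity)
  obtain ⟨F, hF, hFn⟩ := exists_isFilter hI hne hII' hI' hD (q := q) (r := r) (d := d) (by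
      have : Real.exp (-r) ≤ q / 26 := by
        rw [← Real.exp_log (show 0 < q / 26 by positivity), Real.exp_le_exp,
          ← inv_div 26 q, Real.log_inv]
        linarith
      linarith) (by
      refine le_trans ?_ hd1
      rw [← hDdef, div_le_iff₀ hD]
      have : A₁ * (D⁻¹ * ℒ) * D = A₁ * ℒ := by field_simp
      linarith)
  have hDi : 1 / 8 ≤ D⁻¹ := by rw [one_div]; exact inv_anti₀ hD hD8
  have hDL : 1 / 8 ≤ D⁻¹ * ℒ := by nlinarith
  have hA1 : 1 ≤ A := by linarith
  refine ⟨d, F, hF, ?_, ?_, ?_⟩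
  · rw [polylog_eq, pow_one]
    refine le_trans ?_ hd1
    gcongr
    exact (inv_le_one_of_one_le₀ hA1).trans (by linarith)
  · rw [polylog_eq, pow_one]
    have h1 : (A₁ + 8) * (D⁻¹ * ℒ) ≤ A * (D⁻¹ * ℒ) := by gcongr
    linarith
  · refine hFn.trans ?_
    have : 0 ≤ logE d := by linarith [one_le_logE (show (0 : ℝ) ≤ d by positivity)]
    change 3 * logE d ≤ A * logE d
    gcongr
    linarith

/-! ### Evolution times -/

section Times

variable {ε δ : ℝ} {d N Ns : ℕ}

lemma sum_timeStep (ε δ : ℝ) (N J : ℕ) :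
    ∑ i ∈ Finset.range (J + 1), timeStep ε δ N i
      = 2 * timeStep ε δ N J - timeStep ε δ N 0 := by
  induction J with
  | zero => simp; ring
  | succ J ih => rw [Finset.sum_range_succ, ih, timeStep_succ]; ring

lemma timeStep_le_last (hε : 0 < ε) (hδ : 0 < δ) (hN : 0 < N) (i : Fin (numLevels ε)) :
    timeStep ε δ N i ≤ timeStep ε δ N (numLevels ε - 1) := by
  rw [timeStep_eq, timeStep_eq _ _ _ (numLevels ε - 1)]
  have := timeStep_pos hε hδ hN 0
  gcongr
  · norm_num
  · omega

lemma totalTime_eq (d J N Ns : ℕ) (τ : ℕ → ℝ) :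
    totalTime d J N Ns τ
      = 2 * (N * Ns) * (J * d + (N - 1) / 2 * ∑ i ∈ Finset.range J, τ i) := by
  have h1 : ∀ N : ℕ, ∑ n ∈ Finset.range N, (n : ℝ) = N * (N - 1) / 2 := by
    intro N
    induction N with
    | zero => simp
    | succ N ih => rw [Finset.sum_range_succ, ih]; push_cast; ring
  have h2 : ∀ i, ∑ n ∈ Finset.range N, 2 * (Ns : ℝ) * (d + n * τ i)
      = 2 * Ns * (N * d) + (Ns * (N * (N - 1))) * τ i := by
    intro i
    rw [← Finset.mul_sum, Finset.sum_add_distrib, ← Finset.sum_mul, h1]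
    simp; ring
  simp only [totalTime, h2, Finset.sum_add_distrib, ← Finset.mul_sum]
  simp; ring

lemma circuitTime_le {J : ℕ} {τ : ℕ → ℝ} (hτ : ∀ i, 0 ≤ τ i) (ω : Outcomes d J N Ns)
    (a : Fin J × Fin N × Fin Ns) : circuitTime τ ω a ≤ d + ((a.2.1 : ℕ) : ℝ) * τ a.1 := by
  have h1 := Finset.mem_Icc.1 (ω a).1.2
  have h2 : |(((ω a).1 : ℤ) : ℝ)| ≤ d := by
    rw [abs_le]; exact ⟨by exact_mod_cast h1.1, by exact_mod_cast h1.2⟩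
  refine (abs_add_le _ _).trans ?_
  rw [abs_of_nonneg (mul_nonneg (Nat.cast_nonneg _) (hτ _))]
  linarith

lemma sum_circuitTime_le {J : ℕ} {τ : ℕ → ℝ} (hτ : ∀ i, 0 ≤ τ i) (ω : Outcomes d J N Ns) :
    ∑ a, 2 * circuitTime τ ω a ≤ totalTime d J N Ns τ := by
  calc ∑ a, 2 * circuitTime τ ω a
      ≤ ∑ a : Fin J × Fin N × Fin Ns, 2 * (d + ((a.2.1 : ℕ) : ℝ) * τ a.1) := by
        refine Finset.sum_le_sum fun a _ => ?_
        have := circuitTime_le hτ ω a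
        linarith
    _ = totalTime d J N Ns τ := by
        rw [totalTime, ← Fin.sum_univ_eq_sum_range
          (fun i => ∑ n ∈ Finset.range N, 2 * (Ns : ℝ) * (d + n * τ i)), Fintype.sum_prod_type]
        refine Finset.sum_congr rfl fun i _ => ?_
        rw [← Fin.sum_univ_eq_sum_range (fun n => 2 * (Ns : ℝ) * (d + n * τ i)),
          Fintype.sum_prod_type]
        refine Finset.sum_congr rfl fun n _ => ?_
        simp; ring

/-- The steps double, so their sum lies between the last one and twice the last one, and `N τ_J = δ
/ ε`. The lower bound uses `N - 1 ≥ N/2`. -/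
lemma totalTime_bounds (hε : 0 < ε) (hδ : 0 < δ) (hN : 2 ≤ N) :
    (N : ℝ) * Ns / 2 * (numLevels ε * d + δ / ε)
        ≤ totalTime d (numLevels ε) N Ns (timeStep ε δ N) ∧
      totalTime d (numLevels ε) N Ns (timeStep ε δ N)
        ≤ 2 * (N * Ns) * (numLevels ε * d + δ / ε) := by
  have hN0 : 0 < N := by omega
  have hNr : (2 : ℝ) ≤ N := by exact_mod_cast hN
  have hlast := mul_timeStep_last (δ := δ) hε hN0
  have hJ : numLevels ε - 1 + 1 = numLevels ε := by simp [numLevels]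
  have hsum := sum_timeStep ε δ N (numLevels ε - 1)
  rw [hJ] at hsum
  have h0 := timeStep_pos hε hδ hN0 0
  have h0l : timeStep ε δ N 0 ≤ timeStep ε δ N (numLevels ε - 1) :=
    timeStep_le_last hε hδ hN0 ⟨0, by simp [numLevels]⟩
  set t := timeStep ε δ N (numLevels ε - 1)
  set T := ∑ i ∈ Finset.range (numLevels ε), timeStep ε δ N i
  have hT1 : t ≤ T := by linarith
  have hT2 : T ≤ 2 * t := by linarith
  have ht : 0 < t := by linarith
  rw [totalTime_eq, ← hlast]
  have hS : (0 : ℝ) ≤ N * Ns := by positivity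
  have hlow : (N : ℝ) * t / 4 ≤ (N - 1) / 2 * T := by
    have h1 : (N - 1 : ℝ) / 2 * t ≤ (N - 1) / 2 * T := by
      apply mul_le_mul_of_nonneg_left hT1; linarith
    nlinarith
  have hup : (N - 1 : ℝ) / 2 * T ≤ N * t := by
    have h1 : (N - 1 : ℝ) / 2 * T ≤ (N - 1) / 2 * (2 * t) := by
      apply mul_le_mul_of_nonneg_left hT2; linarith
    nlinarith
  have hJd : (0 : ℝ) ≤ numLevels ε * d := by positivity
  constructor
  · calc (N : ℝ) * Ns / 2 * (numLevels ε * d + N * t)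
        = 2 * (N * Ns) * ((numLevels ε * d) / 4 + N * t / 4) := by ring
      _ ≤ _ := by
        gcongr
        linarith
  · gcongr

end Times

end QCELS

end

/-! ### Assembly of the theorem. -/

theorem mainTheorem3 :
    -- `p_r` close to `1` and `δ = Θ(√(1 - p_r))`: `c₁ √(1 - p_r) ≤ δ ≤ δ₀`
    ∃ c₁ > (0 : ℝ), ∃ δ₀ > (0 : ℝ), ∃ κ > (0 : ℝ), ∃ k₁ k₂ : ℕ,
    -- `q = Θ(p₀ δ²)`: `κ' p₀ δ² ≤ q ≤ κ p₀ δ²`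
    ∀ κ' : ℝ, 0 < κ' → κ' ≤ κ →
    ∃ A₀ ≥ (1 : ℝ), ∀ A ≥ A₀, ∀ ζ : ℝ, 0 < ζ → ζ < 1 →
    ∃ C > (0 : ℝ),
    ∀ (E : Type*) [NormedAddCommGroup E] [InnerProductSpace ℂ E] (M : ℕ)
      (H : E →L[ℂ] E) (v : OrthonormalBasis (Fin (M + 1)) ℂ E) (lam : Fin (M + 1) → ℝ) (ψ : E)
      (I I' : Set ℝ) (δ q ε η : ℝ),
      QCELS.IsEigensystem H v lam →
      (∀ m, lam m ∈ Set.Icc (-Real.pi) Real.pi) →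
      ‖ψ‖ = 1 →
      0 < QCELS.overlap v ψ 0 →
      I.OrdConnected → I'.OrdConnected → lam 0 ∈ I → I ⊆ I' →
      I' ⊆ Set.Icc (-Real.pi) Real.pi →
      0 < QCELS.gapDist I I' →
      0 < δ → c₁ * Real.sqrt (1 - QCELS.relOverlap v lam ψ I I') ≤ δ → δ ≤ δ₀ →
      κ' * (QCELS.overlap v ψ 0 * δ ^ 2) ≤ q → q ≤ κ * (QCELS.overlap v ψ 0 * δ ^ 2) →
      0 < ε → ε < 1 / 2 → 0 < η → η < 1 →
      -- suitable filters exist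
      (∃ (d : ℕ) (F : QCELS.Freq d → ℂ), QCELS.IsFilter F q I I' ∧
        QCELS.FilterSize F A k₁ (QCELS.gapDist I I') (QCELS.overlap v ψ 0) δ) ∧
      -- and the algorithm works with each of them
      ∀ (d : ℕ) (F : QCELS.Freq d → ℂ), QCELS.IsFilter F q I I' →
        QCELS.FilterSize F A k₁ (QCELS.gapDist I I') (QCELS.overlap v ψ 0) δ →
        ∀ N Ns : ℕ, 2 ≤ N →
          C * QCELS.sampleBound k₂ ζ ε η (QCELS.overlap v ψ 0) δ (QCELS.gapDist I I') ≤
            (N : ℝ) * Ns →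
          -- precision `ε` with probability at least `1 - η`
          1 - η ≤ (QCELS.outcomesLaw H ψ F (QCELS.numLevels ε) N Ns
              (QCELS.timeStep ε δ N)).real
            (QCELS.successEvent F (QCELS.timeStep ε δ N) (lam 0) ε) ∧
          -- maximal evolution time
          QCELS.maxTime d (QCELS.numLevels ε) N (QCELS.timeStep ε δ N) = d + δ / ε ∧
          (∀ (ω : QCELS.Outcomes d (QCELS.numLevels ε) N Ns)
              (a : Fin (QCELS.numLevels ε) × Fin N × Fin Ns),
            QCELS.circuitTime (QCELS.timeStep ε δ N) ω a ≤ d + δ / ε) ∧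
          -- total evolution time
          (∀ ω : QCELS.Outcomes d (QCELS.numLevels ε) N Ns,
            ∑ a, 2 * QCELS.circuitTime (QCELS.timeStep ε δ N) ω a ≤
              QCELS.totalTime d (QCELS.numLevels ε) N Ns (QCELS.timeStep ε δ N)) ∧
          C / 2 * QCELS.sampleBound k₂ ζ ε η (QCELS.overlap v ψ 0) δ (QCELS.gapDist I I') *
              (QCELS.numLevels ε * d + δ / ε) ≤
            QCELS.totalTime d (QCELS.numLevels ε) N Ns (QCELS.timeStep ε δ N) ∧
          ∀ B : ℝ,
            (N : ℝ) * Ns ≤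
              B * QCELS.sampleBound k₂ ζ ε η (QCELS.overlap v ψ 0) δ (QCELS.gapDist I I') →
            QCELS.totalTime d (QCELS.numLevels ε) N Ns (QCELS.timeStep ε δ N) ≤
              2 * B *
                QCELS.sampleBound k₂ ζ ε η (QCELS.overlap v ψ 0) δ (QCELS.gapDist I I') *
                (QCELS.numLevels ε * d + δ / ε) := by
  -- `2000` and `1/400000` are the bias budget of `IsEigensystem.success_prob`. The exponents are
  -- `1` for the filter degree and `4` for the samples.
  refine ⟨2000, by norm_num, 1, by norm_num, 1 / 400000, by norm_num, 1, 4, ?_⟩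
  intro κ' hκ' _
  obtain ⟨A₀, hA₀, hfilter⟩ := QCELS.exists_filterSize_constant hκ'
  refine ⟨A₀, hA₀, fun A hA ζ hζ hζ1 => ?_⟩
  -- `s = 1/600000` is the admissible noise level in units of `p_0 δ`.
  obtain ⟨C, hC, hsample⟩ := QCELS.exists_sample_constant (hA₀.trans hA) hζ hζ1
    (s := 1 / 600000) (by norm_num)
  refine ⟨C, hC, ?_⟩
  intro E _ _ M H v lam ψ I I' δ q ε η hH hlam hψ hp hI _ hI0 hII' hI' hD hδ hpr hδ1 hq1 hq2
    hε hε2 hη hη1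
  have hp1 : QCELS.overlap v ψ 0 ≤ 1 := by
    rw [← QCELS.sum_overlap (v := v) hψ]
    exact Finset.single_le_sum (fun m _ => QCELS.overlap_nonneg ψ m) (Finset.mem_univ 0)
  have hq0 : 0 ≤ q := le_trans (by positivity) hq1
  have hpδ : QCELS.overlap v ψ 0 * δ ^ 2 ≤ 1 :=
    mul_le_one₀ hp1 (sq_nonneg δ) (pow_le_one₀ hδ.le hδ1)
  have hD8 : QCELS.gapDist I I' ≤ 8 := by
    have := QCELS.gapDist_le_of_mem hI' hII' hI0
    linarith [Real.pi_lt_d2]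
  refine ⟨hfilter A hA I I' _ δ q hI ⟨_, hI0⟩ hII' hI' hD hp hp1 hδ hδ1 hq1 (by linarith), ?_⟩
  intro d F hF hsize N Ns hN hNNs
  have hN0 : 0 < N := by omega
  have hτ : ∀ i, 0 ≤ QCELS.timeStep ε δ N i := fun i => (QCELS.timeStep_pos hε hδ hN0 i).le
  have hNs : 0 < Ns := by
    rcases Nat.eq_zero_or_pos Ns with h | h
    · have hX : 0 < QCELS.sampleBound 4 ζ ε η (QCELS.overlap v ψ 0) δ (QCELS.gapDist I I') :=
        QCELS.sampleBound_pos hζ hζ1 hε hε2 hη hp hδ hD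
      rw [h, Nat.cast_zero, mul_zero] at hNNs
      exact absurd hNNs (not_le.2 (mul_pos hC hX))
    · exact h
  obtain ⟨hFn, hprob⟩ := hH.success_prob hψ hlam hp hI0 hII' hF hq0 hδ hδ1 hpr hq2 hε hN hNs
  have hsmall := hsample (QCELS.gapDist I I') (QCELS.overlap v ψ 0) δ ε η (QCELS.filterNorm F) d N
    Ns hD hD8 hp hp1 hδ hδ1 hε hε2 hη hη1 hsize.2.1 hFn hsize.2.2 hN hNNs
  rw [mul_one_div] at hsmall
  obtain ⟨hlow, hup⟩ := QCELS.totalTime_bounds (d := d) (Ns := Ns) hε hδ hN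
  have htime : 0 ≤ (QCELS.numLevels ε * d + δ / ε : ℝ) := by positivity
  refine ⟨by linarith, ?_, fun ω a => ?_, QCELS.sum_circuitTime_le hτ, ?_, fun B hB => ?_⟩
  · rw [QCELS.maxTime, QCELS.mul_timeStep_last hε hN0]
  · refine (QCELS.circuitTime_le hτ ω a).trans ?_
    rw [← QCELS.mul_timeStep_last (δ := δ) hε hN0]
    have h1 := QCELS.timeStep_le_last hε hδ hN0 a.1
    have h2 : ((a.2.1 : ℕ) : ℝ) ≤ N := by exact_mod_cast a.2.1.2.le
    have h3 := hτ a.1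
    gcongr
  · refine le_trans (mul_le_mul_of_nonneg_right ?_ htime) hlow
    linarith
  · refine hup.trans (mul_le_mul_of_nonneg_right ?_ htime)
    linarith
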